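/- **Setting.** A bounded tiling instance consists of a finite set $\Gamma$ of colours, a tile set $T\subseteq\Gamma^4$ of words $\mathbf w=(w_u,w_d,w_l,w_r)$, a non-empty rectangular piece $\Lambda$ of the square lattice, and a colour for each link on the boundary of $\Lambda$. (It is written as a word in any of the usual ways in which $\Gamma$, $T$ and the boundary links are listed, say with colours in unary.) It is solvable if one can assign a colour to each link of $\Lambda$ such that the boundary links get their prescribed colours and the colours (up, down, left, right) around each plaquette form an element of $T$. Put on each plaquette a qudit with orthonormal basis $\{|\mathbf w\rangle:\mathbf w\in\Gamma^4\}$ and let $$H^{\mathsf{BT}}=\sum_{\langle p,p'\rangle}h_{p,p'}+\sum_{p\in\partial\Lambda}h^{\partial}_p .$$ The first sum runs over the pairs of neighbouring plaquettes. If $p,p'$ meet on a vertical link, $p$ being on the right, then $$h_{p,p'}=\mathbf 1-\sum_{\mathbf w,\mathbf w'\in T}\delta(w_l,w'_r)\,|\mathbf w,\mathbf w'\rangle\langle\mathbf w,\mathbf w'|,$$ and if they meet on a horizontal link, $p$ being the lower one, $\delta(w_l,w'_r)$ is replaced by $\delta(w_u,w'_d)$. For a plaquette $p$ on the boundary, $h^\partial_p=\mathbf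 1-\sum_{\mathbf w}|\mathbf w\rangle\langle\mathbf w|$, the sum running over those $\mathbf w\in T$ that carry the prescribed colour on each boundary link of $p$ (so on both of them at a corner). **Theorem.** For every bounded tiling instance, $H^{\mathsf{BT}}$ is a sum of pairwise commuting self-adjoint terms, each acting on at most two qudits and diagonal in the basis above; the terms of neighbouring plaquettes with the same orientation are all given by the same two-qudit operator (translation invariance in the bulk); $H^{\mathsf{BT}}\ge 0$; the ground state energy (least eigenvalue) of $H^{\mathsf{BT}}$ is $0$ if and only if the instance is solvable; and it is always either at most $\beta=1/3$ or at least $\alpha=2/3$. The 2-local commuting Hamiltonian problem restricted to these Hamiltonians, namely to decide, given a bounded tiling instance, whether the ground state energy of $H^{\mathsf{BT}}$ is at most $\beta=1/3$ or at least $\alpha=2/3$, is $\mathsf{NP}$-complete: the language of the instances with ground state energy at most $1/3$ is in $\mathsf{NP}$, and for every language $L\in\mathsf{NP}$ there is a map, computable in polynomial time, that sends each word of $L$ to an instance with ground state energy at most $1/3$ and each other word to an instance with ground state energy at least $2/3$. -/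

import Mathlib

open scoped ComplexOrder

/-! ### Nondeterministic Turing machines and the class NP -/

/-- A head move. -/
inductive Move
  | left
  | stay
  | right

/-- The displacement of the head. -/
def Move.toInt : Move → ℤ
  | .left => -1
  | .stay => 0
  | .right => 1

/-- A nondeterministic Turing machine with one two-way infinite tape, whose inputs are words over
the alphabet `A`.  The tape alphabet `Symbol` contains a blank symbol and a copy of `A` that avoids
the blank; the program is a table of quintuples `(q, s, q', s', M)`. -/
structure NTM (A : Type) where
  Symbol : Type
  State : Type
  finSymbol : Finite Symbol
  finState : Finite State
  blank : Symbol
  letter : A ↪ Symbol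
  letter_ne_blank : ∀ a, letter a ≠ blank
  start : State
  accept : State
  program : Set (State × Symbol × State × Symbol × Move)

namespace NTM

variable {A : Type} (M : NTM A)

/-- An instantaneous description: state, head position and tape content. -/
structure Cfg where
  state : M.State
  head : ℤ
  tape : ℤ → M.Symbol

/-- The initial description on input `w`: the word is written on the cells `0, 1, …, |w| - 1`, all
other cells are blank, and the head is on cell `0` in the initial state. -/
def init (w : List A) : M.Cfg where
  state := M.start
  head := 0
  tape z := match z with
    | Int.ofNat k => (w[k]?).elim M.blank M.letter
    | Int.negSucc _ => M.blank

/-- `c'` results from `c` by carrying out one instruction of the program. -/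
def Step (c c' : M.Cfg) : Prop :=
  ∃ q' s' m, (c.state, c.tape c.head, q', s', m) ∈ M.program ∧
    c'.state = q' ∧ c'.head = c.head + m.toInt ∧
    c'.tape = fun z => if z = c.head then s' else c.tape z

/-- `M.ReachesIn t c c'`: some computation of exactly `t` steps leads from `c` to `c'`. -/
def ReachesIn : ℕ → M.Cfg → M.Cfg → Prop
  | 0, c, c' => c = c'
  | t + 1, c, c' => ∃ d, M.Step c d ∧ ReachesIn t d c'

/-- Some computation of exactly `t` steps on input `w` leads to the accepting state. -/
def AcceptsIn (w : List A) (t : ℕ) : Prop :=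
  ∃ c, M.ReachesIn t (M.init w) c ∧ c.state = M.accept

end NTM

/-- The class NP: `L` is accepted by a nondeterministic machine, and every word of `L` has an
accepting computation whose number of steps is polynomial in the length of the word. -/
def InNP {A : Type} (L : Language A) : Prop :=
  ∃ (M : NTM A) (p : Polynomial ℕ),
    (∀ w, w ∈ L ↔ ∃ t, M.AcceptsIn w t) ∧
    (∀ w ∈ L, ∃ t ≤ p.eval w.length, M.AcceptsIn w t)

/-- NP-completeness of the problem whose instances are the elements of `X`, written as words by
`enc`, with sets `yes` and `no` of positive and negative instances.  Membership: the language of all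
words that encode a positive instance is in NP.  Hardness: for every language `L` in NP over a
finite alphabet there is a polynomial-time computable map from words to instances that sends the
words of `L` to positive and all other words to negative instances. -/
def IsNPComplete {X S : Type} (enc : X → List S) (yes no : Set X) : Prop :=
  InNP ({s | ∃ x ∈ yes, enc x = s} : Language S) ∧
  ∀ (A : Type) [Finite A] (L : Language A), InNP L →
    ∃ f : List A → X,
      Nonempty (Turing.TM2ComputableInPolyTime (id : List A → List A) enc f) ∧
      (∀ w ∈ L, f w ∈ yes) ∧ (∀ w ∉ L, f w ∈ no)

/-! ### Local Hamiltonians -/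

/-- A Hamiltonian on finitely many qudits, given as a sum of local terms.  The qudits sit at the
sites `V`, the basis states of each of them are labelled by `S`, and the term `i` is an operator
`op i` on `arity i` qudits together with the distinct sites on which it acts. -/
structure LocalHamiltonian (V S ι : Type) where
  arity : ι → ℕ
  site : (i : ι) → Fin (arity i) ↪ V
  op : (i : ι) → Matrix (Fin (arity i) → S) (Fin (arity i) → S) ℂ

namespace LocalHamiltonian

variable {V S ι : Type} (H : LocalHamiltonian V S ι)

/-- The local operator of a term, together with its arity, regardless of where it acts. -/
def localOp (i : ι) : Σ k : ℕ, Matrix (Fin k → S) (Fin k → S) ℂ :=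
  ⟨H.arity i, H.op i⟩

open Classical in
/-- The term `i` as an operator on all qudits: `op i` on its sites, tensored with the identity on
the other sites. -/
noncomputable def term (i : ι) : Matrix (V → S) (V → S) ℂ :=
  fun x y =>
    if ∀ v, v ∉ Set.range (H.site i) → x v = y v then
      H.op i (fun k => x (H.site i k)) (fun k => y (H.site i k))
    else 0

/-- The Hamiltonian: the sum of its terms. -/
noncomputable def total [Fintype ι] : Matrix (V → S) (V → S) ℂ :=
  ∑ i, H.term i

/-- Every term acts on at most `k` qudits and is self-adjoint. -/
def IsLocal (k : ℕ) : Prop :=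
  ∀ i, H.arity i ≤ k ∧ (H.op i).IsHermitian

/-- The terms commute pairwise. -/
def IsCommuting [Fintype V] [DecidableEq V] [Fintype S] : Prop :=
  ∀ i j, H.term i * H.term j = H.term j * H.term i

/-- The ground state energy: the least eigenvalue of the Hamiltonian. -/
noncomputable def groundEnergy [Fintype V] [DecidableEq V] [Fintype S] [DecidableEq S]
    [Fintype ι] : ℝ :=
  sInf (spectrum ℝ H.total)

end LocalHamiltonian

/-! ### Bounded tiling -/

/-- A four-letter word of colours `(w_u, w_d, w_l, w_r)`. -/
structure Tile (Γ : Type) where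
  u : Γ
  d : Γ
  l : Γ
  r : Γ
  deriving DecidableEq, Fintype

/-- An instance of bounded tiling: a set of `colours` colours, a non-empty rectangular piece of the
square lattice with `height` rows (numbered from top to bottom) and `width` columns (numbered from
left to right) of plaquettes, a list of the elements of the tile set, and a colour for each
boundary link. -/
structure BoundedTiling where
  colours : ℕ
  height : ℕ
  width : ℕ
  height_pos : 0 < height
  width_pos : 0 < width
  tiles : List (Tile (Fin colours))
  top : Fin width → Fin colours
  bottom : Fin width → Fin colours
  left : Fin height → Fin colours
  right : Fin height → Fin colours

/-- The letters with which instances are written down. -/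
inductive Letter
  | one
  | sep
  | tile
  | column
  | row
  deriving DecidableEq

/-- A number (of colours, or of a colour) in unary. -/
def encodeNat (k : ℕ) : List Letter :=
  List.replicate k .one ++ [.sep]

/-- A tile as a word: a marker, then its four colours. -/
def encodeTile {c : ℕ} (w : Tile (Fin c)) : List Letter :=
  .tile :: (encodeNat w.u ++ encodeNat w.d ++ encodeNat w.l ++ encodeNat w.r)

/-- The two boundary colours of a column or of a row as a word that starts with a marker. -/
def encodePair {c : ℕ} (marker : Letter) (e : Fin c × Fin c) : List Letter :=
  marker :: (encodeNat e.1 ++ encodeNat e.2)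

namespace BoundedTiling

/-- An instance as a word: the number of colours, the tiles, the top and bottom boundary colour of
each column, and the left and right boundary colour of each row. -/
def encode (I : BoundedTiling) : List Letter :=
  encodeNat I.colours ++ I.tiles.flatMap encodeTile ++
    (List.ofFn fun j => (I.top j, I.bottom j)).flatMap (encodePair .column) ++
    (List.ofFn fun i => (I.left i, I.right i)).flatMap (encodePair .row)

variable (I : BoundedTiling)

/-- The tile set. -/
def tileSet : Finset (Tile (Fin I.colours)) := I.tiles.toFinset

/-- A tiling: a colour for each horizontal link (there are `height + 1` lines of them) and for each
vertical link (there are `width + 1` lines of them). -/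
structure Tiling where
  horizontal : Fin (I.height + 1) → Fin I.width → Fin I.colours
  vertical : Fin I.height → Fin (I.width + 1) → Fin I.colours

/-- A tiling is valid if the colours around each plaquette form an element of the tile set and the
boundary condition is respected. -/
def IsValid (t : I.Tiling) : Prop :=
  (∀ i j, (⟨t.horizontal i.castSucc j, t.horizontal i.succ j,
      t.vertical i j.castSucc, t.vertical i j.succ⟩ : Tile (Fin I.colours)) ∈ I.tileSet) ∧
  (∀ j, t.horizontal 0 j = I.top j) ∧
  (∀ j, t.horizontal (Fin.last I.height) j = I.bottom j) ∧
  (∀ i, t.vertical i 0 = I.left i) ∧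
  (∀ i, t.vertical i (Fin.last I.width) = I.right i)

/-- The instance has a solution. -/
def Solvable : Prop := ∃ t : I.Tiling, I.IsValid t

/-! ### The Hamiltonian of a bounded tiling instance -/

/-- The plaquettes: row and column. -/
abbrev Plaquette : Type := Fin I.height × Fin I.width

/-- The pairs `(p, p')` of plaquettes that meet on a vertical link, `p` being on the right. -/
abbrev HorizontalBond : Type :=
  {b : I.Plaquette × I.Plaquette // b.1.1 = b.2.1 ∧ b.1.2.val = b.2.2.val + 1}

/-- The pairs `(p, p')` of plaquettes that meet on a horizontal link, `p` being the lower one. -/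
abbrev VerticalBond : Type :=
  {b : I.Plaquette × I.Plaquette // b.1.2 = b.2.2 ∧ b.1.1.val = b.2.1.val + 1}

/-- The plaquettes on the boundary of the lattice. -/
abbrev BoundaryPlaquette : Type :=
  {p : I.Plaquette // p.1.val = 0 ∨ p.1.val + 1 = I.height ∨ p.2.val = 0 ∨ p.2.val + 1 = I.width}

/-- A tile carries the prescribed colour on each link that it shares with the boundary when it is
put on plaquette `p` (two or more such links at a corner). -/
def MatchesBoundary (p : I.Plaquette) (w : Tile (Fin I.colours)) : Prop :=
  (p.1.val = 0 → w.u = I.top p.2) ∧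
  (p.1.val + 1 = I.height → w.d = I.bottom p.2) ∧
  (p.2.val = 0 → w.l = I.left p.1) ∧
  (p.2.val + 1 = I.width → w.r = I.right p.1)

/-- The projector onto the basis state `x`. -/
def proj {X : Type} [DecidableEq X] (x : X) : Matrix X X ℂ :=
  Matrix.single x x 1

/-- The interaction of two plaquettes meeting on a vertical link (first the one on the right):
both are in the tile set and agree on the link, or else the energy is one. -/
def horizontalOp : Matrix (Fin 2 → Tile (Fin I.colours)) (Fin 2 → Tile (Fin I.colours)) ℂ :=
  1 - ∑ w ∈ I.tileSet, ∑ w' ∈ I.tileSet, if w.l = w'.r then proj ![w, w'] else 0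

/-- The interaction of two plaquettes meeting on a horizontal link (first the lower one). -/
def verticalOp : Matrix (Fin 2 → Tile (Fin I.colours)) (Fin 2 → Tile (Fin I.colours)) ℂ :=
  1 - ∑ w ∈ I.tileSet, ∑ w' ∈ I.tileSet, if w.u = w'.d then proj ![w, w'] else 0

open Classical in
/-- The boundary term at a plaquette of the boundary. -/
noncomputable def boundaryOp (p : I.Plaquette) :
    Matrix (Fin 1 → Tile (Fin I.colours)) (Fin 1 → Tile (Fin I.colours)) ℂ :=
  1 - ∑ w ∈ I.tileSet, if I.MatchesBoundary p w then proj ![w] else 0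

/-- The labels of the terms of the Hamiltonian: the pairs of neighbouring plaquettes and the
boundary plaquettes. -/
abbrev TermIndex : Type := (I.HorizontalBond ⊕ I.VerticalBond) ⊕ I.BoundaryPlaquette

/-- An ordered pair of distinct sites, as an embedding. -/
def pairSites {V : Type} (p p' : V) (h : p ≠ p') : Fin 2 ↪ V where
  toFun := ![p, p']
  inj' := by
    intro a b hab
    fin_cases a <;> fin_cases b <;> simp_all [Ne.symm]

/-- A single site, as an embedding. -/
def oneSite {V : Type} (p : V) : Fin 1 ↪ V where
  toFun := ![p]
  inj' := fun _ _ _ => Subsingleton.elim _ _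

lemma HorizontalBond.ne (b : I.HorizontalBond) : b.1.1 ≠ b.1.2 := by
  intro h
  have := b.2.2
  rw [h] at this
  omega

lemma VerticalBond.ne (b : I.VerticalBond) : b.1.1 ≠ b.1.2 := by
  intro h
  have := b.2.2
  rw [h] at this
  omega

/-- The Hamiltonian of the instance: on each plaquette sits a qudit whose basis states are the
four-letter words of colours; there is one term for each pair of neighbouring plaquettes and one
for each boundary plaquette. -/
noncomputable def hamiltonian :
    LocalHamiltonian I.Plaquette (Tile (Fin I.colours)) I.TermIndex where
  arity
    | .inl _ => 2
    | .inr _ => 1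
  site
    | .inl (.inl b) => pairSites b.1.1 b.1.2 (HorizontalBond.ne I b)
    | .inl (.inr b) => pairSites b.1.1 b.1.2 (VerticalBond.ne I b)
    | .inr p => oneSite p.1
  op
    | .inl (.inl _) => I.horizontalOp
    | .inl (.inr _) => I.verticalOp
    | .inr p => I.boundaryOp p.1

/-- Translation invariance in the bulk: all nearest-neighbour terms of the same orientation are
given by the same local operator. -/
def BulkTranslationInvariant : Prop :=
  (∀ b b' : I.HorizontalBond,
    I.hamiltonian.localOp (.inl (.inl b)) = I.hamiltonian.localOp (.inl (.inl b'))) ∧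
  (∀ b b' : I.VerticalBond,
    I.hamiltonian.localOp (.inl (.inr b)) = I.hamiltonian.localOp (.inl (.inr b')))

end BoundedTiling

/-! ### Instances are determined by the words that encode them -/

lemma encodeNat_append_inj {a b : ℕ} {s t : List Letter}
    (h : encodeNat a ++ s = encodeNat b ++ t) : a = b ∧ s = t := by
  induction a generalizing b with
  | zero => cases b <;> simp_all [encodeNat, List.replicate_succ]
  | succ a ih =>
    cases b with
    | zero => simp [encodeNat, List.replicate_succ] at h
    | succ b =>
      have := @ih b (by simpa [encodeNat, List.replicate_succ] using h)
      exact ⟨by omega, this.2⟩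

lemma flatMap_append_inj {α : Type} (g : α → List Letter) (m : Letter)
    (hm : ∀ x, (g x).head? = some m)
    (hg : ∀ x y s t, g x ++ s = g y ++ t → x = y ∧ s = t)
    (l l' : List α) (s t : List Letter) (hs : s.head? ≠ some m) (ht : t.head? ≠ some m)
    (h : l.flatMap g ++ s = l'.flatMap g ++ t) : l = l' ∧ s = t := by
  induction l generalizing l' with
  | nil =>
    cases l' with
    | nil => simpa using h
    | cons y l' =>
      exfalso
      apply hs
      have := congrArg List.head? h
      simpa [List.head?_append, hm] using this
  | cons x l ih =>
    cases l' with
    | nil =>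
      exfalso
      apply ht
      have := congrArg List.head? h
      simpa [List.head?_append, hm, eq_comm] using this
    | cons y l' =>
      simp only [List.flatMap_cons, List.append_assoc] at h
      obtain ⟨h1, h2⟩ := hg _ _ _ _ h
      obtain ⟨h3, h4⟩ := ih l' h2
      exact ⟨by rw [h1, h3], h4⟩

lemma encodeTile_append_inj {c : ℕ} (x y : Tile (Fin c)) (s t : List Letter)
    (h : encodeTile x ++ s = encodeTile y ++ t) : x = y ∧ s = t := by
  simp only [encodeTile, List.cons_append, List.append_assoc, List.cons.injEq, true_and] at h
  obtain ⟨h1, h⟩ := encodeNat_append_inj h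
  obtain ⟨h2, h⟩ := encodeNat_append_inj h
  obtain ⟨h3, h⟩ := encodeNat_append_inj h
  obtain ⟨h4, h⟩ := encodeNat_append_inj h
  cases x; cases y
  simp_all [Fin.ext_iff]

lemma encodePair_append_inj {c : ℕ} (m : Letter) (x y : Fin c × Fin c) (s t : List Letter)
    (h : encodePair m x ++ s = encodePair m y ++ t) : x = y ∧ s = t := by
  simp only [encodePair, List.cons_append, List.append_assoc, List.cons.injEq, true_and] at h
  obtain ⟨h1, h⟩ := encodeNat_append_inj h
  obtain ⟨h2, h⟩ := encodeNat_append_inj h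
  exact ⟨Prod.ext (Fin.ext h1) (Fin.ext h2), h⟩

lemma head?_flatMap_encodePair_ne {c : ℕ} (m k : Letter) (hk : m ≠ k) (l : List (Fin c × Fin c))
    (s : List Letter) (hs : s.head? ≠ some k) :
    (l.flatMap (encodePair m) ++ s).head? ≠ some k := by
  cases l <;> simp_all [encodePair]

theorem BoundedTiling.encode_injective : Function.Injective BoundedTiling.encode := by
  rintro ⟨c, m, n, hm, hn, T, t, b, l, r⟩ ⟨c', m', n', hm', hn', T', t', b', l', r'⟩ h
  simp only [BoundedTiling.encode, List.append_assoc] at h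
  obtain ⟨hc, hA⟩ := encodeNat_append_inj h
  clear h
  subst hc
  obtain ⟨hT, hB⟩ := flatMap_append_inj encodeTile .tile (fun _ => rfl) encodeTile_append_inj
    _ _ _ _
    (head?_flatMap_encodePair_ne .column .tile (by decide) _ _
      (head?_flatMap_encodePair_ne .row .tile (by decide) _ [] (by simp)))
    (head?_flatMap_encodePair_ne .column .tile (by decide) _ _
      (head?_flatMap_encodePair_ne .row .tile (by decide) _ [] (by simp)))
    (by simpa only [List.append_nil] using hA)
  clear hA
  subst hT
  obtain ⟨h1, hC⟩ := flatMap_append_inj (encodePair .column) .column (fun _ => rfl)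
    (encodePair_append_inj _) _ _ _ _
    (head?_flatMap_encodePair_ne .row .column (by decide) _ [] (by simp))
    (head?_flatMap_encodePair_ne .row .column (by decide) _ [] (by simp)) hB
  obtain ⟨h2, -⟩ := flatMap_append_inj (encodePair .row) .row (fun _ => rfl)
    (encodePair_append_inj _) _ _ [] [] (by simp) (by simp) hC
  obtain rfl : n = n' := by simpa using congrArg List.length h1
  obtain rfl : m = m' := by simpa using congrArg List.length h2
  have h1 := List.ofFn_injective h1
  have h2 := List.ofFn_injective h2
  simp only [funext_iff, Prod.mk.injEq] at h1 h2
  obtain rfl : t = t' := funext fun j => (h1 j).1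
  obtain rfl : b = b' := funext fun j => (h1 j).2
  obtain rfl : l = l' := funext fun j => (h2 j).1
  obtain rfl : r = r' := funext fun j => (h2 j).2
  rfl

/-! Every term of the Hamiltonian is a diagonal 0/1 matrix: its entry at an assignment of tiles to
plaquettes is 1 exactly when the constraint of the term fails. Hence the terms commute, and the
Hamiltonian is diagonal with the numbers of violated constraints as its entries (`total_eq`,
`spectrum_total`). The ground state energy is the least such number. It is a natural number, equal
to 0 iff all constraints can be met at once, which means solvability
(`exists_satisfies_iff_solvable`), and at least 1 otherwise. The thresholds 1/3 and 2/3 only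
separate 0 from 1, so it remains to see that bounded tiling is NP-complete.

Membership. A nondeterministic procedure is written as a regular language of stack operations:
products are sequencing, sums are choices, stars are loops, and a word of the language that can be
carried out is a successful run. `StackSimulation.inNP_of_traces` converts such a language with
polynomially bounded runs into a one-tape machine, which keeps the stacks on parallel tracks,
guesses the operations and runs a finite automaton for the language along with them.
`TilingVerifier.program` parses an encoded instance and guesses the tiles row by row, comparing each
with the colours above and to the left. `TilingVerifier.Rel.program` is its soundness,
`TilingVerifier.RelIn.program` its completeness with a cubic bound.

Hardness. As in the Cook–Levin theorem, the successive lines of horizontal links display the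
successive descriptions of a machine, while signals on the vertical links guarantee that there is
exactly one head and carry the state when it moves (`NTM.AcceptsIn.exists_diagram`,
`NTM.Diagram.exists_acceptsIn`). The encoding of the resulting instance is made of fixed words,
repeated a polynomial number of times or attached to the input letters (`NTM.exists_boundedTiling`),
so that an explicit stack machine can write it down (`nonempty_tm2ComputableInPolyTime`). -/

/-! ### Diagonal Hamiltonians -/

/-- For a nonzero entry, `x` and `y` must agree off the sites because of the identity factor, and on
the sites because `op i` is diagonal. -/
lemma LocalHamiltonian.term_eq_diagonal {V S ι : Type} [DecidableEq V] [Fintype V] [DecidableEq S]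
    (H : LocalHamiltonian V S ι) (i : ι) (d : (Fin (H.arity i) → S) → ℂ)
    (hd : H.op i = Matrix.diagonal d) :
    H.term i = Matrix.diagonal fun x => d fun k => x (H.site i k) := by
  ext x y
  rw [LocalHamiltonian.term, hd]
  by_cases hxy : x = y
  · subst hxy; simp
  · rw [Matrix.diagonal_apply_ne _ hxy]
    split_ifs with h
    · refine Matrix.diagonal_apply_ne _ fun h' => hxy (funext fun v => ?_)
      by_cases hv : v ∈ Set.range (H.site i)
      · obtain ⟨k, rfl⟩ := hv
        exact congrFun h' k
      · exact h v hv
    · rfl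

namespace BoundedTiling

variable (I : BoundedTiling)

lemma horizontalOp_eq : I.horizontalOp = Matrix.diagonal fun z =>
    if z 0 ∈ I.tileSet ∧ z 1 ∈ I.tileSet ∧ (z 0).l = (z 1).r then 0 else 1 := by
  ext x y
  have hx : ∀ w w', ![w, w'] = x ↔ w = x 0 ∧ w' = x 1 := fun w w' => by
    rw [funext_iff, Fin.forall_fin_two]; rfl
  simp only [horizontalOp, Matrix.sub_apply, Matrix.sum_apply, Matrix.one_apply,
    Matrix.diagonal_apply]
  by_cases hxy : x = y
  · subst hxy
    -- Only the summand with `w = x 0` and `w' = x 1` contributes at `x`; as a nested indicator it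
    -- makes both sums collapse.
    rw [Finset.sum_congr rfl fun w _ => Finset.sum_congr rfl fun w' _ => show _ =
      if w' = x 1 then (if w = x 0 ∧ w.l = w'.r then (1 : ℂ) else 0) else 0 by
        by_cases h : w.l = w'.r <;> by_cases h1 : w = x 0 <;> by_cases h2 : w' = x 1 <;>
          simp_all [proj, Matrix.single_apply]]
    simp only [Finset.sum_ite_eq', ite_and]
    by_cases h0 : x 0 ∈ I.tileSet <;> by_cases h1 : x 1 ∈ I.tileSet <;>
      by_cases h2 : (x 0).l = (x 1).r <;> simp [h0, h1, h2]
  · rw [if_neg hxy, if_neg hxy, Finset.sum_eq_zero, sub_zero]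
    intro w _
    refine Finset.sum_eq_zero fun w' _ => ?_
    split_ifs
    · exact Matrix.single_apply_of_ne _ _ _ _ _ fun h => hxy (h.1.symm.trans h.2)
    · rfl

lemma verticalOp_eq : I.verticalOp = Matrix.diagonal fun z =>
    if z 0 ∈ I.tileSet ∧ z 1 ∈ I.tileSet ∧ (z 0).u = (z 1).d then 0 else 1 := by
  ext x y
  have hx : ∀ w w', ![w, w'] = x ↔ w = x 0 ∧ w' = x 1 := fun w w' => by
    rw [funext_iff, Fin.forall_fin_two]; rfl
  simp only [verticalOp, Matrix.sub_apply, Matrix.sum_apply, Matrix.one_apply,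
    Matrix.diagonal_apply]
  by_cases hxy : x = y
  · subst hxy
    rw [Finset.sum_congr rfl fun w _ => Finset.sum_congr rfl fun w' _ => show _ =
      if w' = x 1 then (if w = x 0 ∧ w.u = w'.d then (1 : ℂ) else 0) else 0 by
        by_cases h : w.u = w'.d <;> by_cases h1 : w = x 0 <;> by_cases h2 : w' = x 1 <;>
          simp_all [proj, Matrix.single_apply]]
    simp only [Finset.sum_ite_eq', ite_and]
    by_cases h0 : x 0 ∈ I.tileSet <;> by_cases h1 : x 1 ∈ I.tileSet <;>
      by_cases h2 : (x 0).u = (x 1).d <;> simp [h0, h1, h2]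
  · rw [if_neg hxy, if_neg hxy, Finset.sum_eq_zero, sub_zero]
    intro w _
    refine Finset.sum_eq_zero fun w' _ => ?_
    split_ifs
    · exact Matrix.single_apply_of_ne _ _ _ _ _ fun h => hxy (h.1.symm.trans h.2)
    · rfl

open Classical in
lemma boundaryOp_eq (p : I.Plaquette) : I.boundaryOp p = Matrix.diagonal fun z =>
    if z 0 ∈ I.tileSet ∧ I.MatchesBoundary p (z 0) then 0 else 1 := by
  ext x y
  have hx : ∀ w, ![w] = x ↔ w = x 0 := fun w => by
    rw [funext_iff, Fin.forall_fin_one]; rfl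
  simp only [boundaryOp, Matrix.sub_apply, Matrix.sum_apply, Matrix.one_apply,
    Matrix.diagonal_apply]
  by_cases hxy : x = y
  · subst hxy
    rw [Finset.sum_congr rfl fun w _ => show _ =
      if w = x 0 then (if I.MatchesBoundary p w then (1 : ℂ) else 0) else 0 by
        by_cases h : I.MatchesBoundary p w <;> by_cases h1 : w = x 0 <;>
          simp_all [proj, Matrix.single_apply]]
    simp only [Finset.sum_ite_eq']
    by_cases h0 : x 0 ∈ I.tileSet <;> by_cases h1 : I.MatchesBoundary p (x 0) <;>
      simp [h0, h1]
  · rw [if_neg hxy, if_neg hxy, Finset.sum_eq_zero, sub_zero]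
    intro w _
    split_ifs
    · exact Matrix.single_apply_of_ne _ _ _ _ _ fun h => hxy (h.1.symm.trans h.2)
    · rfl

/-- The assignment `x` of tiles to plaquettes satisfies the constraint imposed by a term. -/
def Satisfies (x : I.Plaquette → Tile (Fin I.colours)) : I.TermIndex → Prop
  | .inl (.inl b) => x b.1.1 ∈ I.tileSet ∧ x b.1.2 ∈ I.tileSet ∧ (x b.1.1).l = (x b.1.2).r
  | .inl (.inr b) => x b.1.1 ∈ I.tileSet ∧ x b.1.2 ∈ I.tileSet ∧ (x b.1.1).u = (x b.1.2).d
  | .inr p => x p.1 ∈ I.tileSet ∧ I.MatchesBoundary p.1 (x p.1)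

open Classical in
lemma term_eq (i : I.TermIndex) : I.hamiltonian.term i =
    Matrix.diagonal fun x => if I.Satisfies x i then 0 else 1 := by
  rcases i with (b | b) | p
  · refine (I.hamiltonian.term_eq_diagonal (.inl (.inl b)) _ I.horizontalOp_eq).trans ?_
    exact congrArg Matrix.diagonal (funext fun x => if_congr Iff.rfl rfl rfl)
  · refine (I.hamiltonian.term_eq_diagonal (.inl (.inr b)) _ I.verticalOp_eq).trans ?_
    exact congrArg Matrix.diagonal (funext fun x => if_congr Iff.rfl rfl rfl)
  · refine (I.hamiltonian.term_eq_diagonal (.inr p) _ (I.boundaryOp_eq p.1)).trans ?_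
    exact congrArg Matrix.diagonal (funext fun x => if_congr Iff.rfl rfl rfl)

open Classical in
/-- The number of terms whose constraint is violated. -/
noncomputable def violations (x : I.Plaquette → Tile (Fin I.colours)) : ℕ :=
  (Finset.univ.filter fun i => ¬ I.Satisfies x i).card

lemma violations_eq_zero (x : I.Plaquette → Tile (Fin I.colours)) :
    I.violations x = 0 ↔ ∀ i, I.Satisfies x i := by
  simp [violations, Finset.filter_eq_empty_iff]

lemma total_eq : I.hamiltonian.total = Matrix.diagonal fun x => (I.violations x : ℂ) := by
  classical
  ext x y
  simp only [LocalHamiltonian.total, term_eq, Matrix.sum_apply, Matrix.diagonal_apply]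
  by_cases hxy : x = y
  · subst hxy
    rw [if_pos rfl, violations, Finset.card_filter, Nat.cast_sum]
    refine Finset.sum_congr rfl fun i _ => ?_
    by_cases h : I.Satisfies x i <;> simp [h]
  · simp [hxy]

lemma spectrum_total :
    spectrum ℝ I.hamiltonian.total = Set.range fun x => (I.violations x : ℝ) := by
  rw [total_eq, ← spectrum.preimage_algebraMap ℂ]
  ext r
  simp only [Set.mem_preimage, spectrum_diagonal, Set.mem_range]
  refine exists_congr fun x => ?_
  simp only [Complex.coe_algebraMap]
  norm_cast

lemma groundEnergy_eq : ∃ x, I.hamiltonian.groundEnergy = I.violations x ∧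
    ∀ y, I.violations x ≤ I.violations y := by
  -- The top boundary supplies a colour, so assignments exist even if the tile set is empty.
  have c : Fin I.colours := I.top ⟨0, I.width_pos⟩
  have : Nonempty (I.Plaquette → Tile (Fin I.colours)) := ⟨fun _ => ⟨c, c, c, c⟩⟩
  obtain ⟨x, hx⟩ := Finite.exists_min I.violations
  refine ⟨x, ?_, hx⟩
  rw [LocalHamiltonian.groundEnergy, spectrum_total]
  refine IsLeast.csInf_eq ⟨⟨x, rfl⟩, ?_⟩
  rintro _ ⟨y, rfl⟩
  exact Nat.cast_le.2 (hx y)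

/-- A link either lies between two plaquettes whose tiles agree on it, or lies on the boundary,
where the tile shows the prescribed colour. So assignments of tiles that meet all constraints are
the same as valid colourings of the links. -/
lemma exists_satisfies_iff_solvable : (∃ x, ∀ i, I.Satisfies x i) ↔ I.Solvable := by
  constructor
  · rintro ⟨x, hx⟩
    -- A plaquette of the top row has a boundary term, and any other one has a bond with the
    -- plaquette above it; this also covers lattices with a single row or column.
    have hT : ∀ p, x p ∈ I.tileSet := by
      rintro ⟨⟨i, hi⟩, j⟩
      cases i with
      | zero => exact (hx (.inr ⟨_, Or.inl rfl⟩)).1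
      | succ i =>
        exact (hx (.inl (.inr ⟨(⟨⟨i + 1, hi⟩, j⟩, ⟨⟨i, by omega⟩, j⟩), rfl, rfl⟩))).1
    have hB : ∀ p : I.Plaquette, I.MatchesBoundary p (x p) := by
      intro p
      by_cases h : p.1.val = 0 ∨ p.1.val + 1 = I.height ∨ p.2.val = 0 ∨ p.2.val + 1 = I.width
      · exact (hx (.inr ⟨p, h⟩)).2
      · push Not at h
        exact ⟨fun h' => (h.1 h').elim, fun h' => (h.2.1 h').elim, fun h' => (h.2.2.1 h').elim,
          fun h' => (h.2.2.2 h').elim⟩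
    -- A link takes its colour from the plaquette below it or to its right; where there is none, it
    -- takes the boundary colour.
    refine ⟨⟨fun i j => if h : i.val < I.height then (x (⟨i, h⟩, j)).u else I.bottom j,
      fun i j => if h : j.val < I.width then (x (i, ⟨j, h⟩)).l else I.right i⟩, ?_, ?_, ?_, ?_, ?_⟩
    · intro i j
      convert hT (i, j) using 1
      have hu : (if h : i.val + 1 < I.height then (x (⟨i + 1, h⟩, j)).u else I.bottom j)
          = (x (i, j)).d := by
        split_ifs with h
        · exact (hx (.inl (.inr ⟨(⟨⟨i + 1, h⟩, j⟩, ⟨i, j⟩), rfl, rfl⟩))).2.2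
        · exact ((hB (i, j)).2.1 (by simp only; omega)).symm
      have hl : (if h : j.val + 1 < I.width then (x (i, ⟨j + 1, h⟩)).l else I.right i)
          = (x (i, j)).r := by
        split_ifs with h
        · exact (hx (.inl (.inl ⟨(⟨i, ⟨j + 1, h⟩⟩, ⟨i, j⟩), rfl, rfl⟩))).2.2
        · exact ((hB (i, j)).2.2.2 (by simp only; omega)).symm
      simp [hu, hl]
    · intro j
      simpa [I.height_pos] using (hB (⟨0, I.height_pos⟩, j)).1 rfl
    · intro j
      simp
    · intro i
      simpa [I.width_pos] using (hB (i, ⟨0, I.width_pos⟩)).2.2.1 rfl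
    · intro i
      simp
  · rintro ⟨t, hT, htop, hbot, hleft, hright⟩
    refine ⟨fun p => ⟨t.horizontal p.1.castSucc p.2, t.horizontal p.1.succ p.2,
      t.vertical p.1 p.2.castSucc, t.vertical p.1 p.2.succ⟩, ?_⟩
    rintro ((⟨⟨⟨i, j⟩, ⟨i', j'⟩⟩, h1, h2⟩ | ⟨⟨⟨i, j⟩, ⟨i', j'⟩⟩, h1, h2⟩) | ⟨⟨i, j⟩, hp⟩)
    · obtain rfl : i = i' := h1
      refine ⟨hT _ _, hT _ _, ?_⟩
      exact congrArg (t.vertical i) (Fin.ext h2)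
    · obtain rfl : j = j' := h1
      refine ⟨hT _ _, hT _ _, ?_⟩
      exact congrArg (t.horizontal · j) (Fin.ext h2)
    · refine ⟨hT _ _, fun h => ?_, fun h => ?_, fun h => ?_, fun h => ?_⟩
      · rw [← htop]
        exact congrArg (t.horizontal · j) (Fin.ext h)
      · rw [← hbot]
        exact congrArg (t.horizontal · j) (Fin.ext h)
      · rw [← hleft]
        exact congrArg (t.vertical i) (Fin.ext h)
      · rw [← hright]
        exact congrArg (t.vertical i) (Fin.ext h)

lemma groundEnergy_eq_zero_iff : I.hamiltonian.groundEnergy = 0 ↔ I.Solvable := by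
  rw [← exists_satisfies_iff_solvable]
  simp only [← violations_eq_zero]
  obtain ⟨x, hx, hmin⟩ := I.groundEnergy_eq
  rw [hx, Nat.cast_eq_zero]
  exact ⟨fun h => ⟨x, h⟩, fun ⟨y, hy⟩ => Nat.le_zero.1 (hy ▸ hmin y)⟩

lemma one_le_groundEnergy (h : ¬ I.Solvable) : 1 ≤ I.hamiltonian.groundEnergy := by
  obtain ⟨x, hx, -⟩ := I.groundEnergy_eq
  rw [← groundEnergy_eq_zero_iff] at h
  rw [hx] at h ⊢
  exact Nat.one_le_cast.2 (Nat.one_le_iff_ne_zero.2 (by exact_mod_cast h))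

lemma groundEnergy_le_iff : I.hamiltonian.groundEnergy ≤ 1 / 3 ↔ I.Solvable := by
  refine ⟨fun h => ?_, fun h => ?_⟩
  · by_contra h'
    linarith [I.one_le_groundEnergy h']
  · rw [I.groundEnergy_eq_zero_iff.2 h]; norm_num

lemma le_groundEnergy_iff : 2 / 3 ≤ I.hamiltonian.groundEnergy ↔ ¬ I.Solvable := by
  refine ⟨fun h h' => ?_, fun h => ?_⟩
  · rw [I.groundEnergy_eq_zero_iff.2 h'] at h
    norm_num at h
  · linarith [I.one_le_groundEnergy h]

lemma hamiltonian_isLocal : I.hamiltonian.IsLocal 2 := by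
  classical
  rintro ((b | b) | p)
  · refine ⟨le_rfl, ?_⟩
    change I.horizontalOp.IsHermitian
    rw [horizontalOp_eq]
    exact Matrix.isHermitian_diagonal_of_self_adjoint _ (by
      ext z; simp only [Pi.star_apply]; split_ifs <;> simp)
  · refine ⟨le_rfl, ?_⟩
    change I.verticalOp.IsHermitian
    rw [verticalOp_eq]
    exact Matrix.isHermitian_diagonal_of_self_adjoint _ (by
      ext z; simp only [Pi.star_apply]; split_ifs <;> simp)
  · refine ⟨one_le_two, ?_⟩
    change (I.boundaryOp p.1).IsHermitian
    rw [boundaryOp_eq]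
    exact Matrix.isHermitian_diagonal_of_self_adjoint _ (by
      ext z; simp only [Pi.star_apply]; split_ifs <;> simp)

lemma hamiltonian_isCommuting : I.hamiltonian.IsCommuting := by
  classical
  intro i j
  rw [term_eq, term_eq, Matrix.diagonal_mul_diagonal, Matrix.diagonal_mul_diagonal]
  simp only [mul_comm]

lemma total_posSemidef : I.hamiltonian.total.PosSemidef := by
  rw [total_eq, Matrix.posSemidef_diagonal_iff]
  intro x
  exact_mod_cast Nat.zero_le _

lemma term_isDiag (i : I.TermIndex) : (I.hamiltonian.term i).IsDiag := by
  classical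
  rw [term_eq]
  exact Matrix.isDiag_diagonal _

end BoundedTiling

/-! ### Products and iterations of regular languages -/

namespace Language

open scoped Computability

variable {α : Type}

/-- By the Myhill–Nerode criterion it suffices to find finitely many left quotients. When `x` has
been read, a word of the product is still inside its first factor, or it has left it at some cut `x
= u ++ v`. So the quotient by `x` is determined by the quotient of `L₁` by `x` and the set of
quotients of `L₂` by the possible `v`. -/
theorem IsRegular.mul' {L₁ L₂ : Language α} (h₁ : L₁.IsRegular) (h₂ : L₂.IsRegular) :
    (L₁ * L₂).IsRegular := by
  refine .of_finite_range_leftQuotient (((h₁.finite_range_leftQuotient.prod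
    h₂.finite_range_leftQuotient.powerset).image fun Q : Language α × Set (Language α) =>
      (Q.1 * L₂ + ⨆ R ∈ Q.2, R)).subset ?_)
  rintro _ ⟨x, rfl⟩
  refine ⟨(L₁.leftQuotient x,
    {R | ∃ u v, x = u ++ v ∧ u ∈ L₁ ∧ R = L₂.leftQuotient v}), ⟨⟨x, rfl⟩, ?_⟩, ?_⟩
  · rintro _ ⟨u, v, -, -, rfl⟩
    exact ⟨v, rfl⟩
  · ext y
    simp only [Language.mem_add, Language.mem_mul, Language.mem_leftQuotient, Language.mem_iSup,
      Set.mem_ofPred_eq, exists_prop]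
    constructor
    · rintro (⟨a, ha, b, hb, rfl⟩ | ⟨_, ⟨u, v, rfl, hu, rfl⟩, hy⟩)
      · exact ⟨x ++ a, ha, b, hb, by simp⟩
      · exact ⟨u, hu, v ++ y, hy, by simp⟩
    · rintro ⟨a, ha, b, hb, hab⟩
      rcases List.append_eq_append_iff.1 hab with ⟨c, rfl, rfl⟩ | ⟨c, rfl, rfl⟩
      · exact Or.inr ⟨_, ⟨a, c, rfl, ha, rfl⟩, hb⟩
      · exact Or.inl ⟨c, ha, b, hb, rfl⟩

/-- If `x` is nonempty, then `x = u ++ v` where `u` consists of complete factors and `v` begins the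
current one. The quotient by `x` is the union of the quotients of `L` by such `v`, each followed by
`L∗`; it is determined by a set of left quotients of `L`. -/
theorem IsRegular.kstar' {L : Language α} (h : L.IsRegular) : L∗.IsRegular := by
  refine .of_finite_range_leftQuotient (((h.finite_range_leftQuotient.powerset.image
    fun Z : Set (Language α) => ⨆ R ∈ Z, R * L∗).insert L∗).subset ?_)
  rintro _ ⟨x, rfl⟩
  by_cases hx : x = []
  · subst hx
    exact Or.inl rfl
  refine Or.inr ⟨{R | ∃ u v, x = u ++ v ∧ u ∈ L∗ ∧ R = L.leftQuotient v}, ?_, ?_⟩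
  · rintro _ ⟨u, v, -, -, rfl⟩
    exact ⟨v, rfl⟩
  · ext y
    simp only [Language.mem_leftQuotient, Language.mem_iSup, Set.mem_ofPred_eq, exists_prop]
    constructor
    · rintro ⟨_, ⟨u, v, rfl, hu, rfl⟩, a, ha, b, hb, rfl⟩
      obtain ⟨l, rfl, hl⟩ := Language.mem_kstar.1 hu
      obtain ⟨m, rfl, hm⟩ := Language.mem_kstar.1 hb
      refine Language.mem_kstar.2 ⟨l ++ (v ++ a) :: m, by simp, ?_⟩
      intro z hz
      rcases List.mem_append.1 hz with hz | hz
      · exact hl z hz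
      · rcases List.mem_cons.1 hz with rfl | hz
        · exact ha
        · exact hm z hz
    · intro hy
      obtain ⟨l, hxy, hl⟩ := Language.mem_kstar_iff_exists_nonempty.1 hy
      -- The end of `x` falls between two factors or inside one. In the first case the last complete
      -- factor serves as `v`, with nothing of it left to read.
      rcases List.flatten_eq_append_iff.1 hxy.symm with ⟨as, bs, rfl, rfl, rfl⟩ |
        ⟨as, bs, c, cs, ds, rfl, rfl, rfl⟩
      · rcases List.eq_nil_or_concat as with rfl | ⟨as, b, rfl⟩
        · simp at hx
        · refine ⟨_, ⟨as.flatten, b, by simp, Language.mem_kstar.2 ⟨as, rfl, fun z hz =>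
            (hl z (by simp [hz])).1⟩, rfl⟩, [], ?_, bs.flatten, Language.mem_kstar.2 ⟨bs, rfl,
              fun z hz => (hl z (by simp [hz])).1⟩, rfl⟩
          have hb := (hl b (by simp)).1
          rwa [← List.append_nil b] at hb
      · refine ⟨_, ⟨as.flatten, bs, rfl, Language.mem_kstar.2 ⟨as, rfl, fun z hz =>
            (hl z (by simp [hz])).1⟩, rfl⟩, c :: cs, ?_, ds.flatten, Language.mem_kstar.2 ⟨ds, rfl,
              fun z hz => (hl z (by simp [hz])).1⟩, by simp⟩
        exact (hl (bs ++ c :: cs) (by simp)).1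

theorem isRegular_singleton (w : List α) : ({w} : Language α).IsRegular := by
  refine .of_finite_range_leftQuotient ((((List.finite_toSet w.tails).image
    fun v => ({v} : Language α)).insert 0).subset ?_)
  rintro _ ⟨x, rfl⟩
  have hmem : ∀ y, y ∈ ({w} : Language α).leftQuotient x ↔ x ++ y = w := fun y => Iff.rfl
  by_cases hx : x <+: w
  · obtain ⟨v, rfl⟩ := hx
    refine Or.inr ⟨v, by simp, ?_⟩
    ext y
    rw [hmem, List.append_cancel_left_eq]
    exact Iff.rfl
  · refine Or.inl ?_
    ext y
    rw [hmem]
    exact ⟨fun h => (hx ⟨y, h⟩).elim, fun h => h.elim⟩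

end Language

/-! ### Stack operations and their simulation by a machine with one tape -/

/-- An elementary operation on stacks indexed by `K` over the alphabet `A`. -/
inductive StackOp (K A : Type)
  | push (i : K) (a : A)
  | pop (i : K) (a : A)
  | empty (i : K)

namespace StackOp

variable {K A : Type} [DecidableEq K]

/-- The stack on which an operation acts. -/
def stack : StackOp K A → K
  | push i _ => i
  | pop i _ => i
  | empty i => i

/-- The effect of an operation: `pop i a` is possible only if `a` is on top of stack `i`, and
`empty i` only if stack `i` is empty. -/
def Exec : StackOp K A → (K → List A) → (K → List A) → Prop
  | push i a, S, S' => S' = Function.update S i (a :: S i)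
  | pop i a, S, S' => ∃ s, S i = a :: s ∧ S' = Function.update S i s
  | empty i, S, S' => S i = [] ∧ S' = S

/-- `Runs tr S S'`: the sequence `tr` of operations can be carried out in `S` and leads to `S'`. -/
def Runs : List (StackOp K A) → (K → List A) → (K → List A) → Prop
  | [], S, S' => S' = S
  | o :: tr, S, S' => ∃ T, o.Exec S T ∧ Runs tr T S'

lemma runs_append (tr tr' : List (StackOp K A)) (S S' : K → List A) :
    Runs (tr ++ tr') S S' ↔ ∃ T, Runs tr S T ∧ Runs tr' T S' := by
  induction tr generalizing S with
  | nil => simp [Runs]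
  | cons o tr ih =>
    simp only [List.cons_append, Runs, ih]
    exact ⟨fun ⟨T, h, U, h1, h2⟩ => ⟨U, ⟨T, h, h1⟩, h2⟩,
      fun ⟨U, ⟨T, h, h1⟩, h2⟩ => ⟨T, h, U, h1, h2⟩⟩

lemma Exec.length_le {o : StackOp K A} {S S' : K → List A} (h : o.Exec S S') (i : K) :
    (S' i).length ≤ (S i).length + 1 := by
  cases o with
  | push j a =>
    obtain rfl := h
    by_cases hi : i = j
    · subst hi; simp
    · simp [hi]
  | pop j a =>
    obtain ⟨s, hs, rfl⟩ := h
    by_cases hi : i = j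
    · subst hi; simp [hs]; omega
    · simp [hi]
  | empty j =>
    obtain ⟨-, rfl⟩ := h
    omega

end StackOp

namespace NTM

variable {A : Type} (M : NTM A)

lemma ReachesIn.trans {s t : ℕ} {a b c : M.Cfg} (h : M.ReachesIn s a b) (h' : M.ReachesIn t b c) :
    M.ReachesIn (s + t) a c := by
  induction s generalizing a with
  | zero => obtain rfl : a = b := h; simpa using h'
  | succ s ih =>
    obtain ⟨d, hd, h⟩ := h
    rw [Nat.add_right_comm]
    exact ⟨d, hd, ih h⟩

lemma ReachesIn.single {a b : M.Cfg} (h : M.Step a b) : M.ReachesIn 1 a b := ⟨b, h, rfl⟩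

lemma invariant_of_reachesIn {P : M.Cfg → Prop} (hP : ∀ a b, M.Step a b → P a → P b) {t : ℕ}
    {a b : M.Cfg} (h : M.ReachesIn t a b) (ha : P a) : P b := by
  induction t generalizing a with
  | zero => obtain rfl : a = b := h; exact ha
  | succ t ih =>
    obtain ⟨d, hd, h⟩ := h
    exact ih h (hP _ _ hd ha)

end NTM

namespace StackSimulation

variable (K A σ : Type)

/-- States of the machine that carries out the operations of a word accepted by an automaton with
state set `σ`. -/
inductive State
  | start
  | main (q : σ)
  | seek (o : StackOp K A) (q : σ)
  | popping (i : K) (a : A) (q : σ)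
  | home (q : σ)
  | accept

/-- A symbol holds one cell of each stack and the information whether the cell is cell `0`. -/
abbrev Symbol : Type := (K → Option A) × Bool

variable {K A σ} [DecidableEq K] (D : DFA (StackOp K A) σ)

/-- The program: each operation walks to the top of its stack, acts there and walks back. -/
inductive Instr : State K A σ → Symbol K A → State K A σ → Symbol K A → Move → Prop
  | start (x) : Instr .start x (.main D.start) (x.1, true) .stay
  | begin (q o x) : Instr (.main q) x (.seek o (D.step q o)) x .stay
  | accept (q x) : q ∈ D.accept → Instr (.main q) x .accept x .stay
  | seek (o q x) : x.1 o.stack ≠ none → Instr (.seek o q) x (.seek o q) x .right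
  | push (i a q x) : x.1 i = none →
      Instr (.seek (.push i a) q) x (.home q) (Function.update x.1 i (some a), x.2) .stay
  | turn (i a q x) : x.1 i = none → x.2 = false →
      Instr (.seek (.pop i a) q) x (.popping i a q) x .left
  | pop (i a q x) : x.1 i = some a →
      Instr (.popping i a q) x (.home q) (Function.update x.1 i none, x.2) .stay
  | empty (i q x) : x.1 i = none → x.2 = true → Instr (.seek (.empty i) q) x (.main q) x .stay
  | home (q x) : x.2 = false → Instr (.home q) x (.home q) x .left
  | arrive (q x) : x.2 = true → Instr (.home q) x (.main q) x .stay

instance [Finite K] [Finite A] : Finite (StackOp K A) :=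
  Finite.of_injective
    (fun o : StackOp K A => match o with
      | .push i a => (Sum.inl (i, a) : K × A ⊕ K × A ⊕ K)
      | .pop i a => .inr (.inl (i, a))
      | .empty i => .inr (.inr i))
    (by rintro (_ | _ | _) (_ | _ | _) <;> simp)

instance [Finite K] [Finite A] [Finite σ] : Finite (State K A σ) :=
  Finite.of_injective
    (fun s : State K A σ => match s with
      | .start => (Sum.inl true : Bool ⊕ σ ⊕ (StackOp K A × σ) ⊕ (K × A × σ) ⊕ σ)
      | .accept => .inl false
      | .main q => .inr (.inl q)
      | .seek o q => .inr (.inr (.inl (o, q)))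
      | .popping i a q => .inr (.inr (.inr (.inl (i, a, q))))
      | .home q => .inr (.inr (.inr (.inr q))))
    (by rintro (_ | _ | _ | _ | _ | _) (_ | _ | _ | _ | _ | _) <;> simp)

/-- The machine; its input is on stack `i₀`, the first letter at the bottom. -/
def machine [Finite K] [Finite A] [Finite σ] (i₀ : K) : NTM A where
  Symbol := Symbol K A
  State := State K A σ
  finSymbol := inferInstance
  finState := inferInstance
  blank := (fun _ => none, false)
  letter := ⟨fun a => (Function.update (fun _ => none) i₀ (some a), false), fun a b h => by
    simpa using congrFun (congrArg Prod.fst h) i₀⟩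
  letter_ne_blank a h := by
    have h' : Function.update (fun _ => none) i₀ (some a) i₀ = none :=
      congrFun (congrArg Prod.fst h) i₀
    simp at h'
  start := .start
  accept := .accept
  program := {x | Instr D x.1 x.2.1 x.2.2.1 x.2.2.2.1 x.2.2.2.2}

/-- The tape that represents given stacks. -/
def tapeOf (S : K → List A) : ℤ → Symbol K A
  | Int.ofNat k => (fun i => (S i).reverse[k]?, decide (k = 0))
  | Int.negSucc _ => (fun _ => none, false)

/-- The stacks at the beginning. -/
def initial (i₀ : K) (w : List A) : K → List A :=
  Function.update (fun _ => []) i₀ w.reverse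

omit [DecidableEq K] in
lemma tapeOf_natCast (S : K → List A) (k : ℕ) :
    tapeOf S (k : ℤ) = (fun i => (S i).reverse[k]?, decide (k = 0)) := rfl

/-- Stacks grow to the right from cell `0`, so the only cell that changes is the first free one,
whose index is the length of the stack. -/
lemma tapeOf_push (S : K → List A) (i : K) (a : A) :
    tapeOf (Function.update S i (a :: S i)) = fun z => if z = ((S i).length : ℤ) then
      (Function.update (tapeOf S ((S i).length : ℤ)).1 i (some a), (tapeOf S ((S i).length : ℤ)).2)
      else tapeOf S z := by
  funext z
  cases z with
  | negSucc k => rw [if_neg (by omega)]; rfl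
  | ofNat k =>
    simp only [Int.ofNat_eq_natCast, tapeOf_natCast, Nat.cast_inj]
    split_ifs with h
    · subst h
      ext1
      · funext j
        by_cases hj : j = i
        · subst hj; simp
        · simp [hj]
      · rfl
    · ext1
      · funext j
        by_cases hj : j = i
        · subst hj
          simp only [Function.update_self, List.reverse_cons, List.getElem?_append,
            List.length_reverse]
          split_ifs with h'
          · rfl
          · rw [List.getElem?_eq_none (by simp; omega), List.getElem?_eq_none (by simp; omega)]
        · simp [hj]
      · rfl

lemma tapeOf_pop (S : K → List A) (i : K) (a : A) (s : List A) (hs : S i = a :: s) :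
    tapeOf (Function.update S i s) = fun z => if z = (s.length : ℤ) then
      (Function.update (tapeOf S (s.length : ℤ)).1 i none, (tapeOf S (s.length : ℤ)).2)
      else tapeOf S z := by
  funext z
  cases z with
  | negSucc k => rw [if_neg (by omega)]; rfl
  | ofNat k =>
    simp only [Int.ofNat_eq_natCast, tapeOf_natCast, Nat.cast_inj]
    split_ifs with h
    · subst h
      ext1
      · funext j
        by_cases hj : j = i
        · subst hj; simp
        · simp [hj]
      · rfl
    · ext1
      · funext j
        by_cases hj : j = i
        · subst hj
          simp only [Function.update_self, hs, List.reverse_cons, List.getElem?_append,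
            List.length_reverse]
          split_ifs with h'
          · rfl
          · rw [List.getElem?_eq_none (by simp; omega), List.getElem?_eq_none (by simp; omega)]
        · simp [hj]
      · rfl

variable [Finite K] [Finite A] [Finite σ] (i₀ : K)

/-- The tape at the beginning of a computation. -/
def inputTape (w : List A) : ℤ → Symbol K A
  | Int.ofNat k => (fun i => if i = i₀ then w[k]? else none, false)
  | Int.negSucc _ => (fun _ => none, false)

lemma machine_init (w : List A) :
    (machine D i₀).init w = ⟨State.start, (0 : ℕ), inputTape i₀ w⟩ := by
  refine congrArg (NTM.Cfg.mk (M := machine D i₀) _ _) (funext fun z => ?_)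
  cases z with
  | negSucc k => rfl
  | ofNat k =>
    change (w[k]?).elim ((fun _ => none, false) : Symbol K A)
      (fun a => (Function.update (fun _ => none) i₀ (some a), false)) = _
    refine Prod.ext (funext fun j => ?_) ?_
    · by_cases hj : j = i₀
      · subst hj
        cases h : w[k]? <;> simp [inputTape, h]
      · cases h : w[k]? <;> simp [inputTape, hj]
    · cases h : w[k]? <;> simp [inputTape]

omit [Finite K] [Finite A] in
lemma tapeOf_initial (w : List A) : tapeOf (initial i₀ w) =
    fun z => if z = ((0 : ℕ) : ℤ) then ((inputTape i₀ w (0 : ℕ)).1, true) else inputTape i₀ w z := by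
  funext z
  cases z with
  | negSucc k => rw [if_neg (by omega)]; rfl
  | ofNat k =>
    have hk : (fun i => (initial i₀ w i).reverse[k]?) = fun i => if i = i₀ then w[k]? else none := by
      funext i
      by_cases hi : i = i₀
      · subst hi; simp [initial]
      · simp [initial, hi]
    simp only [Int.ofNat_eq_natCast, tapeOf_natCast, hk, Nat.cast_inj]
    split_ifs with h
    · subst h; rfl
    · simp [h]; rfl

/-- What the reachable descriptions of the machine look like. -/
def Inv (w : List A) (c : (machine D i₀).Cfg) : Prop :=
  c = (machine D i₀).init w ∨
  (∃ tr ∈ D.accepts, ∃ S, StackOp.Runs tr (initial i₀ w) S) ∨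
  ∃ (tr : List (StackOp K A)) (S : K → List A) (h : ℕ), StackOp.Runs tr (initial i₀ w) S ∧
    c.head = h ∧ c.tape = tapeOf S ∧ match (c.state : State K A σ) with
      | .main q => h = 0 ∧ q = D.eval tr
      | .seek o q => h ≤ (S o.stack).length ∧ q = D.step (D.eval tr) o
      | .popping i a q => h + 1 = (S i).length ∧ q = D.step (D.eval tr) (.pop i a)
      | .home q => q = D.eval tr
      | _ => False

omit [Finite K] [Finite A] in
lemma runs_snoc {tr : List (StackOp K A)} {o : StackOp K A} {S T U : K → List A}
    (h : StackOp.Runs tr S T) (h' : o.Exec T U) : StackOp.Runs (tr ++ [o]) S U :=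
  (StackOp.runs_append _ _ _ _).2 ⟨T, h, U, h', rfl⟩

omit [DecidableEq K] [Finite K] [Finite A] in
lemma getElem?_reverse_eq_none {S : K → List A} {i : K} {h : ℕ}
    (h' : (tapeOf S (h : ℤ)).1 i = none) : (S i).length ≤ h := by
  simpa [tapeOf_natCast] using h'

/-- In `Inv`, `tr` is the word of operations completed so far. While an operation is under way, the
automaton state kept by the machine is already the one that follows it, so completing the operation
appends one letter to `tr`. The existence of an accepted run is an absorbing alternative, and
nothing has to be known about descriptions after acceptance. -/
lemma inv_step (w : List A) (c c' : (machine D i₀).Cfg) (hs : (machine D i₀).Step c c')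
    (hc : Inv D i₀ w c) : Inv D i₀ w c' := by
  obtain ⟨q', s', m, hi, h1, h2, h3⟩ := hs
  have same : ∀ x, (x = c.tape c.head) → (fun z => if z = c.head then x else c.tape z) = c.tape := by
    rintro x rfl
    funext z
    split_ifs with hz
    · rw [hz]
    · rfl
  rcases hc with rfl | hc | ⟨tr, S, h, hr, hh, ht, hq⟩
  · refine Or.inr (Or.inr ⟨[], _, 0, rfl, ?_⟩)
    rw [machine_init] at hi h2 h3
    change Instr D State.start (inputTape i₀ w (0 : ℕ)) q' s' m at hi
    generalize hx : inputTape i₀ w (0 : ℕ) = x at hi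
    cases hi
    rw [← hx] at h3
    exact ⟨h2, h3.trans (tapeOf_initial i₀ w).symm, by rw [h1]; exact ⟨rfl, rfl⟩⟩
  · exact Or.inr (Or.inl hc)
  · change Instr D (c.state : State K A σ) (c.tape c.head) q' s' m at hi
    generalize hst : (c.state : State K A σ) = st at hi hq
    generalize hx : c.tape c.head = x at hi
    -- An empty cell of a track lies beyond the top of the stack. With the bound kept while seeking,
    -- this places the head exactly on the first free cell.
    have htop : ∀ {i}, x.1 i = none → (S i).length ≤ h := fun {i} hxi => by
      rw [← hx, ht, hh] at hxi
      exact getElem?_reverse_eq_none hxi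
    have hmark : x.2 = decide (h = 0) := by rw [← hx, ht, hh]; rfl
    cases hi with
    | start => exact hq.elim
    | begin q o =>
      obtain ⟨rfl, rfl⟩ := hq
      exact Or.inr (Or.inr ⟨tr, S, 0, hr, by rw [h2, hh]; rfl, by rw [h3, same _ hx.symm, ht],
        by rw [h1]; exact ⟨Nat.zero_le _, rfl⟩⟩)
    | accept q _ hacc =>
      obtain ⟨rfl, rfl⟩ := hq
      exact Or.inr (Or.inl ⟨tr, hacc, S, hr⟩)
    | seek o q _ hne =>
      obtain ⟨hle, rfl⟩ := hq
      refine Or.inr (Or.inr ⟨tr, S, h + 1, hr, by rw [h2, hh]; rfl,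
        by rw [h3, same _ hx.symm, ht], ?_⟩)
      rw [h1]
      refine ⟨?_, rfl⟩
      rw [← hx, ht, hh, tapeOf_natCast] at hne
      have : ¬ (S o.stack).length ≤ h := by simpa using hne
      omega
    | push i a q _ hnone =>
      obtain ⟨hle, rfl⟩ := hq
      obtain rfl : (S i).length = h := le_antisymm (htop hnone) hle
      refine Or.inr (Or.inr ⟨tr ++ [.push i a], _, _, runs_snoc (o := .push i a) hr rfl,
        by rw [h2, hh]; exact add_zero _, ?_, ?_⟩)
      · rw [h3, tapeOf_push, ← ht, ← hh, hx]
        rfl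
      · rw [h1]
        exact (D.eval_append_singleton tr _).symm
    | turn i a q _ hnone hfalse =>
      obtain ⟨hle, rfl⟩ := hq
      obtain rfl : (S i).length = h := le_antisymm (htop hnone) hle
      -- The unmarked cell is not cell `0`, so the stack is nonempty and the move to the left lands
      -- on its top letter.
      have hpos : (S i).length ≠ 0 := by simpa [hmark] using hfalse
      refine Or.inr (Or.inr ⟨tr, S, (S i).length - 1, hr, ?_, by rw [h3, same _ hx.symm, ht], ?_⟩)
      · rw [h2, hh]
        simp only [Move.toInt]
        omega
      · rw [h1]
        exact ⟨by omega, rfl⟩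
    | pop i a q _ hsome =>
      obtain ⟨hlen, rfl⟩ := hq
      rw [← hx, ht, hh, tapeOf_natCast] at hsome
      cases hS : S i with
      | nil => simp [hS] at hsome
      | cons b s =>
        obtain rfl : h = s.length := by simpa [hS] using hlen
        obtain rfl : b = a := by simpa [hS] using hsome
        refine Or.inr (Or.inr ⟨tr ++ [.pop i b], _, _, runs_snoc (o := .pop i b) hr ⟨s, hS, rfl⟩,
          by rw [h2, hh]; exact add_zero _, ?_, ?_⟩)
        · rw [h3, tapeOf_pop S i b s hS, ← ht, ← hh, hx]
          rfl
        · rw [h1]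
          exact (D.eval_append_singleton tr _).symm
    | empty i q _ hnone htrue =>
      obtain ⟨hle, rfl⟩ := hq
      obtain rfl : h = 0 := by simpa [hmark] using htrue
      have hnil : S i = [] := List.length_eq_zero_iff.1 (Nat.le_zero.1 (htop hnone))
      refine Or.inr (Or.inr ⟨tr ++ [.empty i], S, 0, runs_snoc (o := .empty i) hr ⟨hnil, rfl⟩,
        by rw [h2, hh]; rfl, by rw [h3, same _ hx.symm, ht], ?_⟩)
      rw [h1]
      exact ⟨rfl, (D.eval_append_singleton tr _).symm⟩
    | home q _ hfalse =>
      have hpos : h ≠ 0 := by simpa [hmark] using hfalse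
      refine Or.inr (Or.inr ⟨tr, S, h - 1, hr, ?_, by rw [h3, same _ hx.symm, ht], ?_⟩)
      · rw [h2, hh]
        simp only [Move.toInt]
        omega
      · rw [h1]
        exact hq
    | arrive q _ htrue =>
      obtain rfl : h = 0 := by simpa [hmark] using htrue
      refine Or.inr (Or.inr ⟨tr, S, 0, hr, by rw [h2, hh]; rfl, by rw [h3, same _ hx.symm, ht], ?_⟩)
      rw [h1]
      exact ⟨rfl, hq⟩

lemma exists_trace_of_acceptsIn (w : List A) (t : ℕ) (h : (machine D i₀).AcceptsIn w t) :
    ∃ tr ∈ D.accepts, ∃ S, StackOp.Runs tr (initial i₀ w) S := by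
  obtain ⟨c, hc, hacc⟩ := h
  rcases NTM.invariant_of_reachesIn _ (inv_step D i₀ w) hc (Or.inl rfl) with
    rfl | h | ⟨tr, S, k, -, -, -, hq⟩
  · have h : (State.start : State K A σ) = .accept := hacc
    cases h
  · exact h
  · rw [show (c.state : State K A σ) = .accept from hacc] at hq
    exact hq.elim

/-- A description of the machine. -/
def cfg (s : State K A σ) (h : ℕ) (S : K → List A) : (machine D i₀).Cfg :=
  ⟨s, h, tapeOf S⟩

lemma step_of_instr {s s' : State K A σ} {h h' : ℕ} {S S' : K → List A} {y : Symbol K A} {m : Move}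
    (hi : Instr D s (tapeOf S h) s' y m) (hh : (h' : ℤ) = h + m.toInt)
    (ht : tapeOf S' = fun z : ℤ => if z = h then y else tapeOf S z) :
    (machine D i₀).Step (cfg D i₀ s h S) (cfg D i₀ s' h' S') :=
  ⟨s', y, m, hi, rfl, hh, ht⟩

omit [DecidableEq K] [Finite K] [Finite A] in
lemma tapeOf_same (S : K → List A) (h : ℕ) :
    tapeOf S = fun z => if z = (h : ℤ) then tapeOf S h else tapeOf S z := by
  funext z
  split_ifs with hz
  · rw [hz]
  · rfl

lemma reaches_seek (o : StackOp K A) (q : σ) (S : K → List A) (k h : ℕ)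
    (hk : h + k = (S o.stack).length) :
    (machine D i₀).ReachesIn k (cfg D i₀ (.seek o q) h S)
      (cfg D i₀ (.seek o q) (S o.stack).length S) := by
  induction k generalizing h with
  | zero => obtain rfl : h = _ := hk; rfl
  | succ k ih =>
    refine ⟨_, step_of_instr D i₀ (.seek o q _ ?_) (h' := h + 1) (by simp [Move.toInt])
      (tapeOf_same S h), ih (h + 1) (by omega)⟩
    simp [tapeOf_natCast]
    omega

lemma reaches_home (q : σ) (S : K → List A) (h : ℕ) :
    (machine D i₀).ReachesIn (h + 1) (cfg D i₀ (.home q) h S) (cfg D i₀ (.main q) 0 S) := by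
  induction h with
  | zero =>
    exact .single _ (step_of_instr D i₀ (.arrive q _ rfl) (by simp [Move.toInt]) (tapeOf_same S 0))
  | succ h ih =>
    exact ⟨_, step_of_instr D i₀ (.home q _ (by rw [tapeOf_natCast]; simp)) (h' := h)
      (by simp [Move.toInt]) (tapeOf_same S _), ih⟩

/-- One step chooses the operation; then come the walk to the top, at most two steps there, and the
walk back to the marked cell. -/
lemma reaches_op (o : StackOp K A) (q : σ) (S S' : K → List A) (ho : o.Exec S S') :
    ∃ t ≤ 2 * (S o.stack).length + 4,
      (machine D i₀).ReachesIn t (cfg D i₀ (.main q) 0 S) (cfg D i₀ (.main (D.step q o)) 0 S') := by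
  have h1 : (machine D i₀).ReachesIn 1 (cfg D i₀ (.main q) 0 S)
      (cfg D i₀ (.seek o (D.step q o)) 0 S) :=
    .single _ (step_of_instr D i₀ (.begin q o _) (by simp [Move.toInt]) (tapeOf_same S 0))
  have h2 := h1.trans _ (reaches_seek D i₀ o (D.step q o) S _ 0 (Nat.zero_add _))
  cases o with
  | push i a =>
    obtain rfl := ho
    refine ⟨_, ?_, (h2.trans _ (.single _ (step_of_instr D i₀ (.push i a _ _ ?_) (add_zero _).symm
      ?_))).trans _ (reaches_home D i₀ _ _ _)⟩
    · simp only [StackOp.stack]; omega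
    · simp [tapeOf_natCast, StackOp.stack]
    · exact tapeOf_push S i a
  | pop i a =>
    obtain ⟨s, hs, rfl⟩ := ho
    refine ⟨_, ?_, ((h2.trans _ (.single _ (step_of_instr D i₀ (h' := s.length) (.turn i a _ _ ?_ ?_)
      ?_ (tapeOf_same S _)))).trans _ (.single _ (step_of_instr D i₀ (.pop i a _ _ ?_)
        (add_zero _).symm ?_))).trans _ (reaches_home D i₀ _ _ _)⟩
    · simp only [StackOp.stack, hs, List.length_cons]; omega
    · simp [tapeOf_natCast, StackOp.stack]
    · rw [tapeOf_natCast]; simp [StackOp.stack, hs]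
    · simp [Move.toInt, StackOp.stack, hs]
    · simp [tapeOf_natCast, hs]
    · exact tapeOf_pop S i a s hs
  | empty i =>
    obtain ⟨hnil, rfl⟩ := ho
    refine ⟨_, ?_, h2.trans _ (.single _ (step_of_instr D i₀ (.empty i _ _ ?_ ?_) ?_
      (tapeOf_same _ _)))⟩
    · simp only [StackOp.stack]; omega
    · rw [tapeOf_natCast]; simp [hnil]
    · rw [tapeOf_natCast]; simp [StackOp.stack, hnil]
    · simp [Move.toInt, StackOp.stack, hnil]

/-- An operation lengthens a stack by at most one letter, so no stack ever exceeds `B + tr.length`,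
which bounds the cost of each operation. -/
lemma reaches_trace (tr : List (StackOp K A)) (q : σ) (S S' : K → List A) (B : ℕ)
    (hB : ∀ i, (S i).length ≤ B) (h : StackOp.Runs tr S S') :
    ∃ t ≤ tr.length * (2 * (B + tr.length) + 4),
      (machine D i₀).ReachesIn t (cfg D i₀ (.main q) 0 S) (cfg D i₀ (.main (D.evalFrom q tr)) 0 S') := by
  induction tr generalizing q S B with
  | nil =>
    obtain rfl : S' = S := h
    exact ⟨0, by simp, rfl⟩
  | cons o tr ih =>
    obtain ⟨T, ho, h⟩ := h
    obtain ⟨s, hs, h1⟩ := reaches_op D i₀ o q S T ho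
    obtain ⟨t, ht, h2⟩ := ih (D.step q o) T (B + 1)
      (fun i => (ho.length_le i).trans (Nat.add_le_add_right (hB i) 1)) h
    refine ⟨s + t, ?_, h1.trans _ h2⟩
    have := hB o.stack
    simp only [List.length_cons]
    nlinarith

/-- If a word lies in `L` iff some sequence of operations from a regular set can be carried out on
it, and the length of such a sequence is polynomially bounded, then `L` is in NP. -/
theorem inNP_of_traces {A K : Type} [Finite A] [Finite K] [DecidableEq K] (i₀ : K)
    {P : Language (StackOp K A)} (hP : P.IsRegular) (L : Language A) (p : Polynomial ℕ)
    (sound : ∀ w, ∀ tr ∈ P, ∀ S, StackOp.Runs tr (initial i₀ w) S → w ∈ L)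
    (complete : ∀ w ∈ L, ∃ tr ∈ P, tr.length ≤ p.eval w.length ∧
      ∃ S, StackOp.Runs tr (initial i₀ w) S) : InNP L := by
  obtain ⟨σ, _, D, rfl⟩ := hP
  -- The summand `2` accounts for marking cell `0` at the start and entering the accepting state at
  -- the end; initially no stack is longer than the input.
  have key : ∀ w ∈ L, ∃ t ≤ (2 + p * (2 * (Polynomial.X + p) + 4)).eval w.length,
      (machine D i₀).AcceptsIn w t := by
    intro w hw
    obtain ⟨tr, htr, hlen, S, hS⟩ := complete w hw
    obtain ⟨t, ht, hr⟩ := reaches_trace D i₀ tr D.start (initial i₀ w) S w.length (fun i => by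
      by_cases hi : i = i₀
      · subst hi; simp [initial]
      · simp [initial, hi]) hS
    refine ⟨1 + t + 1, ?_, cfg D i₀ .accept 0 S, (NTM.ReachesIn.trans _ (.single _
      (b := cfg D i₀ (.main D.start) 0 (initial i₀ w)) ?_) hr).trans _ (.single _
        (step_of_instr D i₀ (.accept _ _ htr) (add_zero _).symm (tapeOf_same S 0))), rfl⟩
    · simp only [Polynomial.eval_add, Polynomial.eval_mul, Polynomial.eval_ofNat, Polynomial.eval_X]
      have : tr.length * (2 * (w.length + tr.length) + 4) ≤
          p.eval w.length * (2 * (w.length + p.eval w.length) + 4) := by gcongr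
      omega
    · rw [machine_init]
      exact ⟨State.main D.start, ((inputTape i₀ w (0 : ℕ)).1, true), .stay, Instr.start _, rfl, rfl,
        tapeOf_initial i₀ w⟩
  refine ⟨machine D i₀, 2 + p * (2 * (Polynomial.X + p) + 4), fun w => ⟨fun hw => ?_, ?_⟩, key⟩
  · obtain ⟨t, -, h⟩ := key w hw
    exact ⟨t, h⟩
  · rintro ⟨t, h⟩
    obtain ⟨tr, htr, S, hS⟩ := exists_trace_of_acceptsIn D i₀ w t h
    exact sound w tr htr S hS

end StackSimulation

/-! ### Programs of stack operations -/

namespace StackOp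

open scoped Computability

variable {K A : Type} [DecidableEq K]

/-- Some word of the program `P` can be carried out in `S` and leads to `S'`. -/
def Rel (P : Language (StackOp K A)) (S S' : K → List A) : Prop := ∃ tr ∈ P, Runs tr S S'

/-- Some word of the program `P` of length at most `n` can be carried out in `S` and leads
to `S'`. -/
def RelIn (P : Language (StackOp K A)) (n : ℕ) (S S' : K → List A) : Prop :=
  ∃ tr ∈ P, tr.length ≤ n ∧ Runs tr S S'

lemma rel_mul {P Q : Language (StackOp K A)} {S S' : K → List A} :
    Rel (P * Q) S S' ↔ ∃ T, Rel P S T ∧ Rel Q T S' := by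
  constructor
  · rintro ⟨_, ⟨x, hx, y, hy, rfl⟩, h⟩
    obtain ⟨T, h1, h2⟩ := (runs_append _ _ _ _).1 h
    exact ⟨T, ⟨x, hx, h1⟩, ⟨y, hy, h2⟩⟩
  · rintro ⟨T, ⟨x, hx, h1⟩, ⟨y, hy, h2⟩⟩
    exact ⟨x ++ y, ⟨x, hx, y, hy, rfl⟩, (runs_append _ _ _ _).2 ⟨T, h1, h2⟩⟩

/-- The final stacks `S'` stay fixed and rounds of the loop are added at the front, so `motive` can
relate the current stacks to the final ones. -/
lemma rel_kstar_induction {P : Language (StackOp K A)} {S S' : K → List A} (h : Rel P∗ S S')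
    {motive : (K → List A) → Prop} (base : motive S')
    (step : ∀ T U, Rel P T U → motive U → motive T) : motive S := by
  obtain ⟨_, hx, h⟩ := h
  obtain ⟨l, rfl, hl⟩ := Language.mem_kstar.1 hx
  clear hx
  induction l generalizing S with
  | nil => obtain rfl : S' = S := h; exact base
  | cons x l ih =>
    rw [List.flatten_cons, runs_append] at h
    obtain ⟨T, h1, h2⟩ := h
    exact step _ _ ⟨x, hl x (by simp), h1⟩ (ih (fun y hy => hl y (by simp [hy])) h2)

lemma RelIn.mono {P : Language (StackOp K A)} {m n : ℕ} {S S' : K → List A} (h : RelIn P m S S')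
    (hmn : m ≤ n) : RelIn P n S S' := by
  obtain ⟨x, hx, hl, h⟩ := h
  exact ⟨x, hx, hl.trans hmn, h⟩

lemma RelIn.mul {P Q : Language (StackOp K A)} {m n : ℕ} {S T S' : K → List A}
    (h : RelIn P m S T) (h' : RelIn Q n T S') : RelIn (P * Q) (m + n) S S' := by
  obtain ⟨x, hx, hl, h⟩ := h
  obtain ⟨y, hy, hl', h'⟩ := h'
  exact ⟨x ++ y, ⟨x, hx, y, hy, rfl⟩, by rw [List.length_append]; omega,
    (runs_append _ _ _ _).2 ⟨T, h, h'⟩⟩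

lemma RelIn.kstar_refl (P : Language (StackOp K A)) (S : K → List A) : RelIn P∗ 0 S S :=
  ⟨[], Language.nil_mem_kstar _, le_rfl, rfl⟩

lemma RelIn.kstar_cons {P : Language (StackOp K A)} {m n : ℕ} {S T S' : K → List A}
    (h : RelIn P m S T) (h' : RelIn P∗ n T S') : RelIn P∗ (m + n) S S' := by
  obtain ⟨x, hx, _, h⟩ := h
  obtain ⟨y, hy, hl', h'⟩ := h'
  obtain ⟨l, rfl, hl⟩ := Language.mem_kstar.1 hy
  refine ⟨x ++ l.flatten, Language.mem_kstar.2 ⟨x :: l, by simp, ?_⟩,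
    by rw [List.length_append]; omega, (runs_append _ _ _ _).2 ⟨T, h, h'⟩⟩
  intro z hz
  rcases List.mem_cons.1 hz with rfl | hz
  · exact hx
  · exact hl z hz

/-- Remove the letter `a` from the stacks in `P` and put it on the stacks in `Q`. -/
def transfer (P Q : List K) (a : A) : List (StackOp K A) := P.map (.pop · a) ++ Q.map (.push · a)

/-- From `S` to `S'`, the word `x` is removed from each stack in `P` and put, letter by letter, on
each stack in `Q`. -/
def Moves (P Q : List K) (x : List A) (S S' : K → List A) : Prop :=
  ∀ k, if k ∈ P then S k = x ++ S' k else if k ∈ Q then S' k = x.reverse ++ S k else S' k = S k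

lemma runs_pop (P : List K) (a : A) (hP : P.Nodup) (S S' : K → List A) :
    Runs (P.map (.pop · a)) S S' ↔ ∀ k, if k ∈ P then S k = a :: S' k else S' k = S k := by
  induction P generalizing S with
  | nil => simp [Runs, funext_iff]
  | cons i P ih =>
    obtain ⟨hi, hP⟩ := List.nodup_cons.1 hP
    simp only [List.map_cons, Runs, Exec, ih hP]
    constructor
    · rintro ⟨_, ⟨s, hs, rfl⟩, h⟩ k
      have hk := h k
      by_cases hki : k = i
      · subst hki
        simp only [hi, if_false, Function.update_self] at hk
        simp [hs, hk]
      · simpa [hki] using hk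
    · intro h
      refine ⟨_, ⟨S' i, by simpa using h i, rfl⟩, fun k => ?_⟩
      have hk := h k
      by_cases hki : k = i
      · subst hki
        simp [hi]
      · simpa [hki] using hk

lemma runs_push (Q : List K) (a : A) (hQ : Q.Nodup) (S S' : K → List A) :
    Runs (Q.map (.push · a)) S S' ↔ ∀ k, if k ∈ Q then S' k = a :: S k else S' k = S k := by
  induction Q generalizing S with
  | nil => simp [Runs, funext_iff]
  | cons i Q ih =>
    obtain ⟨hi, hQ⟩ := List.nodup_cons.1 hQ
    simp only [List.map_cons, Runs, Exec, ih hQ, exists_eq_left]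
    refine forall_congr' fun k => ?_
    by_cases hki : k = i
    · subst hki
      simp [hi]
    · simp [hki]

/-- Popping one letter from all stacks in `P` compares their tops, and pushing it on those in `Q`
copies it. As the stacks are distinct, the operations do not interfere. Comparing and copying in
this way is all that the verifier does, apart from tests for emptiness. -/
lemma runs_transfer {P Q : List K} {a : A} (h : (P ++ Q).Nodup) {S S' : K → List A} :
    Runs (transfer P Q a) S S' ↔ Moves P Q [a] S S' := by
  obtain ⟨hP, hQ, hd⟩ := List.nodup_append.1 h
  simp only [transfer, runs_append, runs_pop P a hP, runs_push Q a hQ]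
  constructor
  · rintro ⟨T, h1, h2⟩ k
    have h1 := h1 k
    have h2 := h2 k
    by_cases hkP : k ∈ P
    · have hkQ : k ∉ Q := fun hkQ => hd k hkP k hkQ rfl
      simp_all
    · by_cases hkQ : k ∈ Q <;> simp_all
  · intro h
    refine ⟨fun k => if k ∈ P then S' k else S k, fun k => ?_, fun k => ?_⟩
    all_goals
      have hk := h k
      by_cases hkP : k ∈ P
      · have hkQ : k ∉ Q := fun hkQ => hd k hkP k hkQ rfl
        simp_all
      · by_cases hkQ : k ∈ Q <;> simp_all

lemma Moves.append {P Q : List K} {x y : List A} {S T U : K → List A}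
    (h : Moves P Q x S T) (h' : Moves P Q y T U) : Moves P Q (x ++ y) S U := by
  intro k
  have h := h k
  have h' := h' k
  by_cases hkP : k ∈ P
  · simp_all
  · by_cases hkQ : k ∈ Q <;> simp_all

lemma Moves.split {P Q : List K} {x y : List A} {S U : K → List A}
    (h : Moves P Q (x ++ y) S U) : ∃ T, Moves P Q x S T ∧ Moves P Q y T U := by
  -- Halfway, the stacks in `P` have lost `x` but still hold `y`, and those in `Q` have received `x`
  -- only.
  refine ⟨fun k => if k ∈ P then y ++ U k else if k ∈ Q then x.reverse ++ S k else S k,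
    fun k => ?_, fun k => ?_⟩
  all_goals
    have hk := h k
    by_cases hkP : k ∈ P
    · simp_all
    · by_cases hkQ : k ∈ Q <;> simp_all

lemma moves_nil {P Q : List K} {S S' : K → List A} : Moves P Q [] S S' ↔ S' = S := by
  refine ⟨fun h => funext fun k => ?_, fun h k => ?_⟩
  · have hk := h k
    by_cases hkP : k ∈ P
    · simp_all
    · by_cases hkQ : k ∈ Q <;> simp_all
  · subst h
    by_cases hkP : k ∈ P
    · simp_all
    · by_cases hkQ : k ∈ Q <;> simp_all

/-- The program that transfers one letter. -/
def one (P Q : List K) (a : A) : Language (StackOp K A) := {transfer P Q a}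

/-- The program that transfers a word over the letters in `Y`. -/
def many (Y : List A) (P Q : List K) : Language (StackOp K A) := (Y.map (one P Q)).sum∗

/-- The program that checks that a stack is empty. -/
def isEmpty (i : K) : Language (StackOp K A) := {[.empty i]}

omit [DecidableEq K] in
lemma isRegular_one (P Q : List K) (a : A) : (one P Q a).IsRegular :=
  Language.isRegular_singleton _

omit [DecidableEq K] in
lemma isRegular_isEmpty (i : K) : (isEmpty i : Language (StackOp K A)).IsRegular :=
  Language.isRegular_singleton _

omit [DecidableEq K] in
lemma isRegular_many (Y : List A) (P Q : List K) : (many Y P Q).IsRegular := by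
  refine Language.IsRegular.kstar' ?_
  induction Y with
  | nil =>
    refine .of_finite_range_leftQuotient ((Set.finite_singleton 0).subset ?_)
    rintro _ ⟨x, rfl⟩
    rfl
  | cons a Y ih => exact (isRegular_one P Q a).add ih

omit [DecidableEq K] in
lemma mem_sum_one {Y : List A} {P Q : List K} {tr : List (StackOp K A)} :
    tr ∈ (Y.map (one P Q)).sum ↔ ∃ a ∈ Y, tr = transfer P Q a := by
  induction Y with
  | nil => simp [Language.notMem_zero]
  | cons a Y ih =>
    rw [List.map_cons, List.sum_cons, Language.mem_add, ih]
    simp only [List.mem_cons, exists_eq_or_imp]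
    exact Iff.rfl

lemma rel_one {P Q : List K} {a : A} (h : (P ++ Q).Nodup) {S S' : K → List A} :
    Rel (one P Q a) S S' ↔ Moves P Q [a] S S' := by
  rw [← runs_transfer h]
  exact ⟨fun ⟨_, rfl, h⟩ => h, fun h => ⟨_, rfl, h⟩⟩

lemma rel_isEmpty {i : K} {S S' : K → List A} : Rel (isEmpty i) S S' ↔ S i = [] ∧ S' = S := by
  constructor
  · rintro ⟨_, rfl, T, ⟨h, rfl⟩, rfl⟩
    exact ⟨h, rfl⟩
  · rintro ⟨h, rfl⟩
    exact ⟨_, rfl, _, ⟨h, rfl⟩, rfl⟩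

lemma RelIn.isEmpty {i : K} {S : K → List A} (h : S i = []) : RelIn (isEmpty i) 1 S S :=
  ⟨_, rfl, le_rfl, _, ⟨h, rfl⟩, rfl⟩

lemma Rel.exists_moves {Y : List A} {P Q : List K} (h : (P ++ Q).Nodup) {S S' : K → List A}
    (hS : Rel (many Y P Q) S S') : ∃ x, (∀ a ∈ x, a ∈ Y) ∧ Moves P Q x S S' := by
  refine rel_kstar_induction hS (motive := fun T => ∃ x, (∀ a ∈ x, a ∈ Y) ∧ Moves P Q x T S')
    ⟨[], by simp, moves_nil.2 rfl⟩ ?_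
  rintro T U ⟨_, htr, hTU⟩ ⟨x, hx, hU⟩
  obtain ⟨a, ha, rfl⟩ := mem_sum_one.1 htr
  exact ⟨a :: x, by simpa [ha] using hx, Moves.append ((runs_transfer h).1 hTU) hU⟩

lemma RelIn.one {P Q : List K} {a : A} {S S' : K → List A} (h : (P ++ Q).Nodup)
    (hS : Moves P Q [a] S S') : RelIn (one P Q a) (P ++ Q).length S S' :=
  ⟨_, rfl, by simp [transfer], (runs_transfer h).2 hS⟩

lemma RelIn.many {Y : List A} {P Q : List K} {S S' : K → List A} (x : List A)
    (h : (P ++ Q).Nodup) (hx : ∀ a ∈ x, a ∈ Y) (hS : Moves P Q x S S') :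
    RelIn (many Y P Q) (x.length * (P ++ Q).length) S S' := by
  induction x generalizing S with
  | nil =>
    obtain rfl := moves_nil.1 hS
    exact (RelIn.kstar_refl _ _).mono (Nat.zero_le _)
  | cons a x ih =>
    obtain ⟨T, h1, h2⟩ := Moves.split (x := [a]) hS
    refine (RelIn.kstar_cons ?_ (ih (fun b hb => hx b (by simp [hb])) h2)).mono
      (m := (P ++ Q).length + x.length * (P ++ Q).length)
      (by rw [List.length_cons, Nat.succ_mul, add_comm])
    exact ⟨_, mem_sum_one.2 ⟨a, hx a (by simp), rfl⟩, by simp [transfer], (runs_transfer h).2 h1⟩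

end StackOp

/-! ### A program that recognizes solvable bounded tiling instances -/

namespace TilingVerifier

open StackOp
open scoped Computability

/-- The stacks of the program. -/
inductive Stk
  | inp
  | src
  | cnt
  | cnt'
  | til
  | til'
  | top
  | top'
  | hor
  | bot
  deriving DecidableEq

open Stk

instance : Fintype Stk :=
  ⟨{inp, src, cnt, cnt', til, til', top, top', hor, bot}, fun k => by cases k <;> decide⟩

/-- With this, `simp` turns `Moves` into ten explicit equations between stack contents. -/
lemma Stk.forall {p : Stk → Prop} : (∀ k, p k) ↔ p inp ∧ p src ∧ p cnt ∧ p cnt' ∧ p til ∧ p til' ∧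
    p top ∧ p top' ∧ p hor ∧ p bot :=
  ⟨fun h => ⟨h _, h _, h _, h _, h _, h _, h _, h _, h _, h _⟩,
    fun ⟨_, _, _, _, _, _, _, _, _, _⟩ k => by cases k <;> assumption⟩

abbrev Program := Language (StackOp Stk Letter)

/-- Transfer a whole stack to another one, in reverse order. -/
def moveAll (i j : Stk) : Program :=
  many [.one, .sep, .tile, .column, .row] [i] [j] * isEmpty i

/-- Transfer a number. -/
def num (P Q : List Stk) : Program := many [.one] P Q * one P Q .sep

/-- Transfer a colour of a tile, checking that it is smaller than the number of colours. -/
def readColour : Program :=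
  moveAll cnt' cnt * (many [.one] [src, cnt] [til', cnt'] *
    (one [src] [til'] .sep * one [cnt] [cnt'] .one))

def readTile : Program :=
  one [src] [til'] .tile * (readColour * (readColour * (readColour * readColour)))

def readColumn : Program :=
  one [src] [] .column * (num [src] [top'] * num [src] [bot])

/-- Put a tile on the next plaquette of the current row. -/
def useTile : Program :=
  moveAll til' til * (many [.one, .sep, .tile, .column, .row] [til] [til'] *
    (one [til] [til'] .tile * (num [til, top] [til'] * (num [til] [til', top'] *
      (many [.one] [til, hor] [til'] * (one [til] [til'] .sep * (isEmpty hor *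
        (many [.one] [til] [til', hor] * one [til] [til'] .sep))))))))

/-- At the start `top'` holds the colours above the row with the last column on top; moving them to
`top` puts the first column on top and frees `top'` for the colours below the row. `hor` holds the
colour of the current vertical link in unary, without a separator. -/
def readRow : Program :=
  one [src] [] .row * (many [.one] [src] [hor] * (one [src] [] .sep * (moveAll top' top *
    (useTile∗ * (isEmpty top * (many [.one] [src, hor] [] *
      (one [src] [] .sep * isEmpty hor)))))))

/-- Compare the colours below the last row with the boundary colours. -/
def compare : Program :=
  many [.one, .sep, .tile, .column, .row] [top', bot] [] * (isEmpty top' * isEmpty bot)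

/-- The first transfer reverses the input, so that its first letter is on top of `src`. `cnt` and
`cnt'` together hold the number of colours, `til` and `til'` the tile list on the two sides of a
reading position, and `bot` the bottom colours. One column and one row are read outside the loops
because the lattice has to be non-empty. -/
def program : Program :=
  moveAll inp src * (many [.one] [src] [cnt] * (one [src] [] .sep * (readTile∗ *
    (readColumn * (readColumn∗ * (readRow * (readRow∗ * (isEmpty src * compare))))))))

lemma isRegular_program : program.IsRegular := by
  have hm := fun i j : Stk => (isRegular_many [Letter.one, .sep, .tile, .column, .row] [i] [j]).mul'
    (isRegular_isEmpty i)
  have hn := fun P Q : List Stk => (isRegular_many [Letter.one] P Q).mul' (isRegular_one P Q .sep)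
  have hc : readColour.IsRegular :=
    (hm _ _).mul' ((isRegular_many _ _ _).mul' ((isRegular_one _ _ _).mul' (isRegular_one _ _ _)))
  have ht : readTile.IsRegular :=
    (isRegular_one _ _ _).mul' (hc.mul' (hc.mul' (hc.mul' hc)))
  have hcol : readColumn.IsRegular := (isRegular_one _ _ _).mul' ((hn _ _).mul' (hn _ _))
  have hu : useTile.IsRegular :=
    (hm _ _).mul' ((isRegular_many _ _ _).mul' ((isRegular_one _ _ _).mul' ((hn _ _).mul'
      ((hn _ _).mul' ((isRegular_many _ _ _).mul' ((isRegular_one _ _ _).mul'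
        ((isRegular_isEmpty _).mul' ((isRegular_many _ _ _).mul' (isRegular_one _ _ _)))))))))
  have hr : readRow.IsRegular :=
    (isRegular_one _ _ _).mul' ((isRegular_many _ _ _).mul' ((isRegular_one _ _ _).mul'
      ((hm _ _).mul' (hu.kstar'.mul' ((isRegular_isEmpty _).mul' ((isRegular_many _ _ _).mul'
        ((isRegular_one _ _ _).mul' (isRegular_isEmpty _))))))))
  exact (hm _ _).mul' ((isRegular_many _ _ _).mul' ((isRegular_one _ _ _).mul' (ht.kstar'.mul'
    (hcol.mul' (hcol.kstar'.mul' (hr.mul' (hr.kstar'.mul' ((isRegular_isEmpty _).mul'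
      ((isRegular_many _ _ _).mul' ((isRegular_isEmpty _).mul' (isRegular_isEmpty _)))))))))))

end TilingVerifier

/-! ### Soundness of the verifier: what a successful run proves. -/

namespace TilingVerifier

open StackOp Stk
open scoped Computability

variable {S S' : Stk → List Letter}

lemma Rel.moveAll {i j : Stk} (hij : i ≠ j) (h : Rel (moveAll i j) S S') :
    S' i = [] ∧ S' j = (S i).reverse ++ S j ∧ ∀ k, k ≠ i → k ≠ j → S' k = S k := by
  obtain ⟨T, h1, h2⟩ := rel_mul.1 h
  obtain ⟨h2, rfl⟩ := rel_isEmpty.1 h2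
  obtain ⟨x, -, hx⟩ := h1.exists_moves (by simp [hij])
  have hi := hx i
  have hj := hx j
  simp only [List.mem_singleton, if_true, hij.symm, if_false, h2, List.append_nil] at hi hj
  refine ⟨h2, by rw [hi, hj], fun k hki hkj => ?_⟩
  simpa [hki, hkj] using hx k

lemma eq_replicate_of_forall_mem {x : List Letter} (hx : ∀ a ∈ x, a ∈ [Letter.one]) :
    x = List.replicate x.length .one :=
  List.eq_replicate_iff.2 ⟨rfl, fun a ha => by simpa using hx a ha⟩

lemma Rel.many_one {P Q : List Stk} (hPQ : (P ++ Q).Nodup) (h : Rel (many [.one] P Q) S S') :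
    ∃ n, Moves P Q (List.replicate n Letter.one) S S' := by
  obtain ⟨x, hx, h⟩ := h.exists_moves hPQ
  exact ⟨x.length, eq_replicate_of_forall_mem hx ▸ h⟩

lemma Rel.num {P Q : List Stk} (hPQ : (P ++ Q).Nodup) (h : Rel (num P Q) S S') :
    ∃ n, Moves P Q (encodeNat n) S S' := by
  obtain ⟨T, h1, h2⟩ := rel_mul.1 h
  obtain ⟨n, h1⟩ := Rel.many_one hPQ h1
  exact ⟨n, h1.append ((rel_one hPQ).1 h2)⟩


/-- The counters hold `c` letters in all. They are first gathered on `cnt`; after `n` of them have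
been removed along with the colour, one more must be left, whence `n < c`. -/
lemma Rel.readColour {c : ℕ} (h : Rel readColour S S')
    (hc : (S cnt').reverse ++ S cnt = List.replicate c .one) :
    ∃ n < c, S src = encodeNat n ++ S' src ∧ S' til' = (encodeNat n).reverse ++ S til' ∧
      (S' cnt').reverse ++ S' cnt = List.replicate c .one ∧ S' til = S til ∧ S' top = S top ∧
      S' top' = S top' ∧ S' hor = S hor ∧ S' bot = S bot := by
  simp only [TilingVerifier.readColour, rel_mul] at h
  obtain ⟨T1, h1, T2, h2, T3, h3, h4⟩ := h
  obtain ⟨h1a, h1b, h1⟩ := Rel.moveAll (by decide) h1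
  obtain ⟨n, h2⟩ := Rel.many_one (by decide) h2
  rw [rel_one (by decide)] at h3 h4
  simp [Moves, Stk.forall] at h1 h2 h3 h4
  have hlen := congrArg List.length hc
  refine ⟨n, ?_, ?_⟩
  · simp_all
    have h1 := congrArg List.length h1b
    have h2 := congrArg List.length h3.2.2.1
    simp only [List.length_append, List.length_replicate, List.length_cons] at h1 h2
    omega
  · simp_all [encodeNat]


lemma Rel.readTile {c : ℕ} (h : Rel readTile S S')
    (hc : (S cnt').reverse ++ S cnt = List.replicate c .one) :
    ∃ t : Tile (Fin c), S src = encodeTile t ++ S' src ∧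
      S' til' = (encodeTile t).reverse ++ S til' ∧
      (S' cnt').reverse ++ S' cnt = List.replicate c .one ∧ S' til = S til ∧ S' top = S top ∧
      S' top' = S top' ∧ S' hor = S hor ∧ S' bot = S bot := by
  simp only [TilingVerifier.readTile, rel_mul] at h
  obtain ⟨T1, h1, T2, h2, T3, h3, T4, h4, h5⟩ := h
  rw [rel_one (by decide)] at h1
  simp [Moves, Stk.forall] at h1
  obtain ⟨u, hu, h2⟩ := Rel.readColour (c := c) h2 (by simp only [h1, hc])
  obtain ⟨d, hd, h3⟩ := Rel.readColour h3 h2.2.2.1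
  obtain ⟨l, hl, h4⟩ := Rel.readColour h4 h3.2.2.1
  obtain ⟨r, hr, h5⟩ := Rel.readColour h5 h4.2.2.1
  refine ⟨⟨⟨u, hu⟩, ⟨d, hd⟩, ⟨l, hl⟩, ⟨r, hr⟩⟩, ?_⟩
  simp [encodeTile, h1, h2, h3, h4, h5]

lemma Rel.readTiles {c : ℕ} (h : Rel TilingVerifier.readTile∗ S S') :
    (S cnt').reverse ++ S cnt = List.replicate c .one →
    ∃ ts : List (Tile (Fin c)), S src = ts.flatMap encodeTile ++ S' src ∧
      S' til' = (ts.flatMap encodeTile).reverse ++ S til' ∧ S' til = S til ∧ S' top = S top ∧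
      S' top' = S top' ∧ S' hor = S hor ∧ S' bot = S bot := by
  refine rel_kstar_induction h (motive := fun S =>
    (S cnt').reverse ++ S cnt = List.replicate c .one →
    ∃ ts : List (Tile (Fin c)), S src = ts.flatMap encodeTile ++ S' src ∧
      S' til' = (ts.flatMap encodeTile).reverse ++ S til' ∧ S' til = S til ∧ S' top = S top ∧
      S' top' = S top' ∧ S' hor = S hor ∧ S' bot = S bot) (fun _ => ⟨[], by simp⟩) ?_
  intro T U hTU ih hc
  obtain ⟨t, h⟩ := Rel.readTile hTU hc
  obtain ⟨ts, h'⟩ := ih h.2.2.1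
  exact ⟨t :: ts, by simp [h, h']⟩

/-- The two boundary colours of a column or of a row, given as numbers, as a word. -/
def pairWord (m : Letter) (e : ℕ × ℕ) : List Letter := m :: (encodeNat e.1 ++ encodeNat e.2)

lemma Rel.readColumn (h : Rel readColumn S S') : ∃ e : ℕ × ℕ,
    S src = pairWord .column e ++ S' src ∧ S' top' = (encodeNat e.1).reverse ++ S top' ∧
    S' bot = (encodeNat e.2).reverse ++ S bot ∧ S' til = S til ∧ S' til' = S til' ∧
    S' top = S top ∧ S' hor = S hor := by
  simp only [TilingVerifier.readColumn, rel_mul] at h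
  obtain ⟨T1, h1, T2, h2, h3⟩ := h
  rw [rel_one (by decide)] at h1
  obtain ⟨t, h2⟩ := Rel.num (by decide) h2
  obtain ⟨b, h3⟩ := Rel.num (by decide) h3
  simp [Moves, Stk.forall] at h1 h2 h3
  exact ⟨(t, b), by simp [pairWord, h1, h2, h3]⟩

lemma Rel.readColumns (h : Rel TilingVerifier.readColumn∗ S S') : ∃ es : List (ℕ × ℕ),
    S src = es.flatMap (pairWord .column) ++ S' src ∧
    S' top' = ((es.map Prod.fst).flatMap encodeNat).reverse ++ S top' ∧
    S' bot = ((es.map Prod.snd).flatMap encodeNat).reverse ++ S bot ∧ S' til = S til ∧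
    S' til' = S til' ∧ S' top = S top ∧ S' hor = S hor := by
  refine rel_kstar_induction h (motive := fun S => ∃ es : List (ℕ × ℕ),
    S src = es.flatMap (pairWord .column) ++ S' src ∧
    S' top' = ((es.map Prod.fst).flatMap encodeNat).reverse ++ S top' ∧
    S' bot = ((es.map Prod.snd).flatMap encodeNat).reverse ++ S bot ∧ S' til = S til ∧
    S' til' = S til' ∧ S' top = S top ∧ S' hor = S hor) ⟨[], by simp⟩ ?_
  rintro T U hTU ⟨es, h'⟩
  obtain ⟨e, h⟩ := Rel.readColumn hTU
  exact ⟨e :: es, by simp [h, h']⟩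

/-- The verifier stops at a guessed position of the tile list. Markers occur only where a tile
begins, so a marker at that position shows that a whole tile of the list is being read. -/
lemma exists_tile_of_suffix {c : ℕ} {ts : List (Tile (Fin c))} {x rest : List Letter}
    {u d l r : ℕ} (h : ts.flatMap encodeTile =
      x ++ .tile :: (encodeNat u ++ (encodeNat d ++ (encodeNat l ++ (encodeNat r ++ rest))))) :
    ∃ t ∈ ts, t.u.val = u ∧ t.d.val = d ∧ t.l.val = l ∧ t.r.val = r := by
  induction ts generalizing x with
  | nil => simp at h
  | cons t ts ih =>
    rw [List.flatMap_cons, List.append_eq_append_iff] at h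
    rcases h with ⟨y, rfl, h⟩ | ⟨y, ht, h⟩
    · obtain ⟨t', ht', h⟩ := ih h
      exact ⟨t', by simp [ht'], h⟩
    · cases y with
      | nil =>
        obtain ⟨t', ht', h⟩ := ih (x := []) h.symm
        exact ⟨t', by simp [ht'], h⟩
      | cons a y =>
        obtain ⟨rfl, h⟩ : Letter.tile = a ∧ _ := List.cons.inj h
        cases x with
        | nil =>
          obtain rfl : _ = y := (List.cons.inj ht).2
          simp only [List.append_assoc, List.cons_append, List.cons.injEq, true_and] at h
          obtain ⟨h1, h⟩ := encodeNat_append_inj h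
          obtain ⟨h2, h⟩ := encodeNat_append_inj h
          obtain ⟨h3, h⟩ := encodeNat_append_inj h
          obtain ⟨h4, h⟩ := encodeNat_append_inj h
          exact ⟨t, by simp, h1.symm, h2.symm, h3.symm, h4.symm⟩
        | cons b x =>
          -- The word in front of the guessed position ends inside the code of `t`, behind its
          -- marker, so a second marker would have to occur in that code.
          have hmem : Letter.tile ∈ encodeNat t.u ++ encodeNat t.d ++ encodeNat t.l ++
              encodeNat t.r := by
            rw [(List.cons.inj ht).2]; simp
          simp [encodeNat] at hmem

/-- The invariant is that `til'`, reversed and followed by `til`, spells the whole tile list.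
Separators make the comparison with `top` exact; on `hor` there are none, and the test that it is
empty rules out a left colour smaller than the one required. -/
lemma Rel.useTile {c : ℕ} {ts : List (Tile (Fin c))} (h : Rel useTile S S')
    (hW : (S til').reverse ++ S til = ts.flatMap encodeTile) :
    ∃ t ∈ ts, S top = encodeNat t.u ++ S' top ∧ S' top' = (encodeNat t.d).reverse ++ S top' ∧
      S hor = List.replicate t.l .one ∧ S' hor = List.replicate t.r .one ∧
      (S' til').reverse ++ S' til = ts.flatMap encodeTile ∧ S' src = S src ∧ S' bot = S bot := by
  simp only [TilingVerifier.useTile, rel_mul] at h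
  obtain ⟨T1, h1, T2, h2, T3, h3, T4, h4, T5, h5, T6, h6, T7, h7, T8, h8, T9, h9, h10⟩ := h
  obtain ⟨h1a, h1b, h1⟩ := Rel.moveAll (by decide) h1
  obtain ⟨x, -, h2⟩ := h2.exists_moves (by decide)
  obtain ⟨u, h4⟩ := Rel.num (by decide) h4
  obtain ⟨d, h5⟩ := Rel.num (by decide) h5
  obtain ⟨l, h6⟩ := Rel.many_one (by decide) h6
  obtain ⟨h8, rfl⟩ := rel_isEmpty.1 h8
  obtain ⟨r, h9⟩ := Rel.many_one (by decide) h9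
  rw [rel_one (by decide)] at h3 h7 h10
  simp [Moves, Stk.forall] at h1 h2 h3 h4 h5 h6 h7 h9 h10
  rw [hW] at h1b
  have hx : ts.flatMap encodeTile = x ++ .tile :: (encodeNat u ++ (encodeNat d ++ (encodeNat l ++
      (encodeNat r ++ S' til)))) := by
    simp [← h1b, h2, h3, h4, h5, h6, h7, h9, h10, encodeNat]
  obtain ⟨t, ht, rfl, rfl, rfl, rfl⟩ := exists_tile_of_suffix hx
  refine ⟨t, ht, ?_⟩
  have hW' : (S' til').reverse ++ S' til = ts.flatMap encodeTile := by
    simp [hx, h1a, h2, h3, h4, h5, h6, h7, h9, h10, encodeNat]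
  rw [hW']
  clear hx h1b hW hW'
  simp_all

/-- A row of tiles in which neighbouring tiles agree, with colours `l` and `r` at the ends. -/
inductive Chain {c : ℕ} (T : List (Tile (Fin c))) : ℕ → List (Tile (Fin c)) → ℕ → Prop
  | nil (l : ℕ) : Chain T l [] l
  | cons (t ts) (r : ℕ) : t ∈ T → Chain T t.r ts r → Chain T t.l (t :: ts) r

/-- A stack of rows of tiles with given boundary colours in which neighbouring tiles agree. -/
inductive Rows {c : ℕ} (T : List (Tile (Fin c))) : List (ℕ × ℕ) → List ℕ → List ℕ → Prop
  | nil (L : List ℕ) : Rows T [] L L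
  | cons (l r : ℕ) (es ts B) : Chain T l ts r → Rows T es (ts.map fun t => t.d.val) B →
      Rows T ((l, r) :: es) (ts.map fun t => t.u.val) B

variable {c : ℕ} {T : List (Tile (Fin c))}

lemma replicate_one_inj {m n : ℕ} : List.replicate m Letter.one = List.replicate n .one ↔ m = n :=
  ⟨fun h => by simpa using congrArg List.length h, fun h => h ▸ rfl⟩

lemma flatMap_encodeNat_inj {L M : List ℕ} (h : L.flatMap encodeNat = M.flatMap encodeNat) :
    L = M := by
  induction L generalizing M with
  | nil =>
    cases M with
    | nil => rfl
    | cons b M => simp [encodeNat] at h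
  | cons a L ih =>
    cases M with
    | nil => simp [encodeNat] at h
    | cons b M =>
      obtain ⟨rfl, h'⟩ := encodeNat_append_inj h
      rw [ih h']

lemma Rel.useTiles (h : Rel TilingVerifier.useTile∗ S S') : ∀ l : ℕ,
    (S til').reverse ++ S til = T.flatMap encodeTile → S hor = List.replicate l .one →
    ∃ ts r, Chain T l ts r ∧ S top = (ts.map fun t => t.u.val).flatMap encodeNat ++ S' top ∧
      S' top' = ((ts.map fun t => t.d.val).flatMap encodeNat).reverse ++ S top' ∧
      S' hor = List.replicate r .one ∧
      (S' til').reverse ++ S' til = T.flatMap encodeTile ∧ S' src = S src ∧ S' bot = S bot := by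
  refine rel_kstar_induction h (motive := fun S => ∀ l : ℕ,
    (S til').reverse ++ S til = T.flatMap encodeTile → S hor = List.replicate l .one →
    ∃ ts r, Chain T l ts r ∧ S top = (ts.map fun t => t.u.val).flatMap encodeNat ++ S' top ∧
      S' top' = ((ts.map fun t => t.d.val).flatMap encodeNat).reverse ++ S top' ∧
      S' hor = List.replicate r .one ∧
      (S' til').reverse ++ S' til = T.flatMap encodeTile ∧ S' src = S src ∧ S' bot = S bot)
    (fun l hW hl => ⟨[], l, .nil l, by simp [hW, hl]⟩) ?_
  intro S1 S2 hTU ih l hW hl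
  obtain ⟨t, ht, h⟩ := Rel.useTile hTU hW
  obtain ⟨ts, r, hc, h'⟩ := ih t.r h.2.2.2.2.1 h.2.2.2.1
  rw [h.2.2.1, replicate_one_inj] at hl
  subst hl
  exact ⟨t :: ts, r, .cons t ts r ht hc, by simp [h, h']⟩

lemma Rel.readRow (h : Rel readRow S S') {L : List ℕ}
    (hW : (S til').reverse ++ S til = T.flatMap encodeTile) (hhor : S hor = []) (htop : S top = [])
    (hL : S top' = (L.flatMap encodeNat).reverse) :
    ∃ (e : ℕ × ℕ) (ts : List (Tile (Fin c))), Chain T e.1 ts e.2 ∧ L = ts.map (fun t => t.u.val) ∧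
      S src = pairWord .row e ++ S' src ∧
      S' top' = ((ts.map fun t => t.d.val).flatMap encodeNat).reverse ∧
      (S' til').reverse ++ S' til = T.flatMap encodeTile ∧ S' hor = [] ∧ S' top = [] ∧
      S' bot = S bot := by
  simp only [TilingVerifier.readRow, rel_mul] at h
  obtain ⟨T1, h1, T2, h2, T3, h3, T4, h4, T5, h5, T6, h6, T7, h7, T8, h8, h9⟩ := h
  obtain ⟨l, h2⟩ := Rel.many_one (by decide) h2
  obtain ⟨h4a, h4b, h4⟩ := Rel.moveAll (by decide) h4
  obtain ⟨h6, rfl⟩ := rel_isEmpty.1 h6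
  obtain ⟨r', h7⟩ := Rel.many_one (by decide) h7
  obtain ⟨h9, rfl⟩ := rel_isEmpty.1 h9
  rw [rel_one (by decide)] at h1 h3 h8
  simp [Moves, Stk.forall] at h1 h2 h3 h4 h7 h8
  obtain ⟨ts, r, hc, h5⟩ := Rel.useTiles (T := T) h5 l (by simp [h1, h2, h3, h4, hW])
    (by simp [h1, h2, h3, h4, hhor])
  -- The tiles have used up `top` exactly, so there is one tile per column, with the required upper
  -- colour.
  have hLt : L = ts.map fun t => t.u.val := by
    refine flatMap_encodeNat_inj ?_
    have := h5.1
    rw [h6, h4b] at this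
    simpa [h1, h2, h3, hL, htop] using this
  have hr : r = r' := by
    have := h5.2.2.1
    rw [h7.2.2.2.2.2.2.2.2.1, ← h8.2.2.2.2.2.2.2.2.1, h9, List.append_nil, replicate_one_inj] at this
    exact this.symm
  subst hr
  refine ⟨(l, r), ts, hc, hLt, ?_, ?_, ?_, h9, ?_, ?_⟩
  · rw [h1.2.1, h2.2.1, h3.2.1, ← h4.2.1, ← h5.2.2.2.2.1, h7.2.1, h8.2.1]
    simp [pairWord, encodeNat]
  · simp [h8, h7, h5, h4a]
  · simp [h8, h7, h5]
  · simp [h8, h7, h6]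
  · simp [h1, h2, h3, h4, h5, h7, h8]

lemma Rel.readRows (h : Rel TilingVerifier.readRow∗ S S') : ∀ L : List ℕ,
    (S til').reverse ++ S til = T.flatMap encodeTile → S hor = [] → S top = [] →
    S top' = (L.flatMap encodeNat).reverse →
    ∃ (es : List (ℕ × ℕ)) (B : List ℕ), Rows T es L B ∧ S src = es.flatMap (pairWord .row) ++ S' src ∧
      S' top' = (B.flatMap encodeNat).reverse ∧ S' bot = S bot := by
  refine rel_kstar_induction h (motive := fun S => ∀ L : List ℕ,
    (S til').reverse ++ S til = T.flatMap encodeTile → S hor = [] → S top = [] →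
    S top' = (L.flatMap encodeNat).reverse →
    ∃ (es : List (ℕ × ℕ)) (B : List ℕ), Rows T es L B ∧ S src = es.flatMap (pairWord .row) ++ S' src ∧
      S' top' = (B.flatMap encodeNat).reverse ∧ S' bot = S bot)
    (fun L hW hhor htop hL => ⟨[], L, .nil L, by simp [hL]⟩) ?_
  intro S1 S2 h12 ih L hW hhor htop hL
  obtain ⟨⟨l, r⟩, ts, hc, rfl, h1, h2, h3, h4, h5, h6⟩ := Rel.readRow h12 hW hhor htop hL
  obtain ⟨es, B, hr, h7, h8, h9⟩ := ih _ h3 h4 h5 h2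
  exact ⟨(l, r) :: es, B, .cons l r es ts B hc hr, by simp [h1, h7], h8, by rw [h9, h6]⟩

/-- The word that encodes an instance that is given by lists of numbers. -/
def word (T : List (Tile (Fin c))) (cols rows : List (ℕ × ℕ)) : List Letter :=
  encodeNat c ++ (T.flatMap encodeTile ++ (cols.flatMap (pairWord .column) ++
    rows.flatMap (pairWord .row)))

theorem Rel.program {s : List Letter} (h : Rel program (StackSimulation.initial inp s) S') :
    ∃ (c : ℕ) (T : List (Tile (Fin c))) (cols rows : List (ℕ × ℕ)), cols ≠ [] ∧ rows ≠ [] ∧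
      s = word T cols rows ∧ Rows T rows (cols.map Prod.fst) (cols.map Prod.snd) := by
  simp only [TilingVerifier.program, TilingVerifier.compare, rel_mul] at h
  obtain ⟨T1, h1, T2, h2, T3, h3, T4, h4, T5, h5, T6, h6, T7, h7, T8, h8, T9, h9, T10, h10, T11,
    h11, h12⟩ := h
  obtain ⟨h1a, h1b, h1⟩ := Rel.moveAll (by decide) h1
  obtain ⟨c, h2⟩ := Rel.many_one (by decide) h2
  obtain ⟨h9, rfl⟩ := rel_isEmpty.1 h9
  obtain ⟨x, -, h10⟩ := h10.exists_moves (by decide)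
  obtain ⟨h11, rfl⟩ := rel_isEmpty.1 h11
  obtain ⟨h12, rfl⟩ := rel_isEmpty.1 h12
  rw [rel_one (by decide)] at h3
  simp [Moves, Stk.forall, StackSimulation.initial] at h1 h1b h2 h3 h10
  obtain ⟨T, h4⟩ := Rel.readTiles (c := c) h4 (by simp [h1, h2, h3])
  obtain ⟨e, h5⟩ := Rel.readColumn h5
  obtain ⟨es, h6⟩ := Rel.readColumns h6
  obtain ⟨⟨l, r⟩, ts, hc, hL, h7⟩ := Rel.readRow (T := T) (L := (e :: es).map Prod.fst) h7
    (by simp [h6, h5, h4, h3, h2, h1]) (by simp [h6, h5, h4, h3, h2, h1])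
    (by simp [h6, h5, h4, h3, h2, h1]) (by simp [h6, h5, h4, h3, h2, h1])
  obtain ⟨rows, B, hr, h8⟩ := Rel.readRows (T := T) h8 _ h7.2.2.1 h7.2.2.2.1 h7.2.2.2.2.1 h7.2.1
  refine ⟨c, T, e :: es, (l, r) :: rows, by simp, by simp, ?_, ?_⟩
  · rw [← h1b, h2.2.1, h3.2.1, h4.1, h5.1, h6.1, h7.1, h8.1, h9]
    simp [word, encodeNat]
  · rw [hL]
    have : B = (e :: es).map Prod.snd := by
      refine flatMap_encodeNat_inj (List.reverse_injective ?_)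
      -- The final comparison removes the same word from both stacks and leaves both of them empty.
      have h13 : T9 top' = T9 bot := by
        rw [h10.2.2.2.2.2.2.2.1, h10.2.2.2.2.2.2.2.2.2, h11, h12]
      rw [← h8.2.1, h13]
      simp [h8, h7, h6, h5, h4, h3, h2, h1]
    exact this ▸ .cons l r rows ts B hc hr

end TilingVerifier

/-! ### Completeness of the verifier: short runs on solvable instances. -/

namespace TilingVerifier

open StackOp Stk
open scoped Computability

/-- Stacks with given contents. -/
def mem (i s c c' t t' u u' h b : List Letter) : Stk → List Letter
  | .inp => i
  | .src => s
  | .cnt => c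
  | .cnt' => c'
  | .til => t
  | .til' => t'
  | .top => u
  | .top' => u'
  | .hor => h
  | .bot => b

variable {S S' : Stk → List Letter}

lemma RelIn.moveAll {i j : Stk} (hij : i ≠ j) (h : Moves [i] [j] (S i) S S') :
    RelIn (moveAll i j) ((S i).length * 2 + 1) S S' := by
  refine (RelIn.many (S i) (by simp [hij]) (fun a _ => by cases a <;> simp) h).mul (RelIn.isEmpty ?_)
  simpa using h i

lemma RelIn.many_one {P Q : List Stk} (n : ℕ) (hPQ : (P ++ Q).Nodup)
    (h : Moves P Q (List.replicate n Letter.one) S S') :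
    RelIn (many [.one] P Q) (n * (P ++ Q).length) S S' :=
  (RelIn.many _ hPQ (by simp) h).mono (by rw [List.length_replicate])

lemma RelIn.num {P Q : List Stk} (n : ℕ) (hPQ : (P ++ Q).Nodup)
    (h : Moves P Q (encodeNat n) S S') : RelIn (num P Q) ((n + 1) * (P ++ Q).length) S S' := by
  obtain ⟨T, h1, h2⟩ := h.split
  exact ((RelIn.many_one n hPQ h1).mul (RelIn.one hPQ h2)).mono (by rw [Nat.succ_mul])

lemma length_encodeNat (n : ℕ) : (encodeNat n).length = n + 1 := by simp [encodeNat]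

lemma length_encodeTile {c : ℕ} (t : Tile (Fin c)) :
    (encodeTile t).length = t.u + t.d + t.l + t.r + 5 := by
  simp [encodeTile, length_encodeNat]
  omega

lemma length_pairWord (m : Letter) (e : ℕ × ℕ) : (pairWord m e).length = e.1 + e.2 + 3 := by
  simp [pairWord, length_encodeNat]
  omega

variable {i s k k' t t' u u' h b : List Letter}

lemma RelIn.readColour {c n : ℕ} (hn : n < c) (hk : k'.reverse ++ k = List.replicate c .one) :
    ∃ l l', l'.reverse ++ l = List.replicate c .one ∧
      RelIn readColour (4 * n + 2 * c + 5) (mem i (encodeNat n ++ s) k k' t t' u u' h b)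
        (mem i s l l' t ((encodeNat n).reverse ++ t') u u' h b) := by
  have hk' : k'.length ≤ c := by
    have := congrArg List.length hk
    simp only [List.length_append, List.length_reverse, List.length_replicate] at this
    omega
  -- On `cnt'` end up the `n` letters matched with the colour and the one that certifies `n < c`.
  refine ⟨List.replicate (c - n - 1) .one, .one :: List.replicate n .one, ?_, ?_⟩
  · rw [← List.replicate_succ, List.reverse_replicate, ← List.replicate_add]
    congr 1
    omega
  · refine ((RelIn.moveAll (S' := mem i (encodeNat n ++ s) (List.replicate c .one) [] t t' u u' h b)
      (by decide) ?_).mul ((RelIn.many_one n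
        (S' := mem i (.sep :: s) (List.replicate (c - n) .one) (List.replicate n .one) t
          (List.replicate n .one ++ t') u u' h b) (by decide) ?_).mul ((RelIn.one (S' :=
          mem i s (List.replicate (c - n) .one) (List.replicate n .one) t
          (.sep :: (List.replicate n .one ++ t')) u u' h b) (by decide) ?_).mul
          (RelIn.one (by decide) ?_)))).mono ?_
    · simp [Moves, Stk.forall, mem, hk]
    · simp [Moves, Stk.forall, mem, encodeNat]
      omega
    · simp [Moves, Stk.forall, mem]
    · simp [Moves, Stk.forall, mem, encodeNat, ← List.replicate_succ]
      omega
    · simp [mem]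
      omega

lemma RelIn.readTile {c : ℕ} (x : Tile (Fin c)) (hk : k'.reverse ++ k = List.replicate c .one) :
    ∃ l l', l'.reverse ++ l = List.replicate c .one ∧
      RelIn readTile (4 * (encodeTile x).length + 8 * c + 2)
        (mem i (encodeTile x ++ s) k k' t t' u u' h b)
        (mem i s l l' t ((encodeTile x).reverse ++ t') u u' h b) := by
  obtain ⟨l1, l1', h1, r1⟩ := RelIn.readColour (i := i) (t := t) (u := u) (u' := u') (h := h) (b := b)
    (t' := .tile :: t') (s := encodeNat x.d ++ (encodeNat x.l ++ (encodeNat x.r ++ s))) x.u.2 hk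
  obtain ⟨l2, l2', h2, r2⟩ := RelIn.readColour (i := i) (t := t) (u := u) (u' := u') (h := h) (b := b)
    (t' := (encodeNat x.u).reverse ++ .tile :: t') (s := encodeNat x.l ++ (encodeNat x.r ++ s))
    x.d.2 h1
  obtain ⟨l3, l3', h3, r3⟩ := RelIn.readColour (i := i) (t := t) (u := u) (u' := u') (h := h) (b := b)
    (t' := (encodeNat x.d).reverse ++ ((encodeNat x.u).reverse ++ .tile :: t'))
    (s := encodeNat x.r ++ s) x.l.2 h2
  obtain ⟨l4, l4', h4, r4⟩ := RelIn.readColour (i := i) (t := t) (u := u) (u' := u') (h := h) (b := b)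
    (t' := (encodeNat x.l).reverse ++ ((encodeNat x.d).reverse ++
      ((encodeNat x.u).reverse ++ .tile :: t'))) (s := s) x.r.2 h3
  refine ⟨l4, l4', h4, ((RelIn.one (by decide) ?_).mul (r1.mul (r2.mul (r3.mul ?_)))).mono
    (n := 4 * (encodeTile x).length + 8 * c + 2) (m := _ + (_ + (_ + (_ + (4 * x.r + 2 * c + 5))))) ?_⟩
  · simp [Moves, Stk.forall, mem, encodeTile]
  · convert r4 using 2
    simp [encodeTile]
  · simp [length_encodeTile]
    omega

lemma RelIn.readTiles {c : ℕ} (T : List (Tile (Fin c))) : ∀ {k k' t'},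
    k'.reverse ++ k = List.replicate c .one → ∃ l l',
      RelIn TilingVerifier.readTile∗ (4 * (T.flatMap encodeTile).length + T.length * (8 * c + 2))
        (mem i (T.flatMap encodeTile ++ s) k k' t t' u u' h b)
        (mem i s l l' t ((T.flatMap encodeTile).reverse ++ t') u u' h b) := by
  induction T with
  | nil => exact fun {k k' t'} _ => ⟨k, k', (RelIn.kstar_refl _ _).mono (Nat.zero_le _)⟩
  | cons x T ih =>
    intro k k' t' hk
    obtain ⟨l, l', hl, r⟩ := RelIn.readTile (i := i) (t := t) (u := u) (u' := u') (h := h) (b := b)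
      (t' := t') (s := T.flatMap encodeTile ++ s) x hk
    obtain ⟨m, m', r'⟩ := ih (t' := (encodeTile x).reverse ++ t') hl
    refine ⟨m, m', ?_⟩
    have hr := (r.kstar_cons r').mono
      (n := 4 * ((x :: T).flatMap encodeTile).length + (x :: T).length * (8 * c + 2)) (by
        simp only [List.flatMap_cons, List.length_append, List.length_cons, Nat.succ_mul]
        omega)
    simpa using hr

lemma RelIn.readColumn (e : ℕ × ℕ) : RelIn readColumn (2 * (pairWord .column e).length)
    (mem i (pairWord .column e ++ s) k k' t t' u u' h b)
    (mem i s k k' t t' u ((encodeNat e.1).reverse ++ u') h ((encodeNat e.2).reverse ++ b)) := by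
  refine ((RelIn.one (S' := mem i (encodeNat e.1 ++ (encodeNat e.2 ++ s)) k k' t t' u u' h b)
    (by decide) ?_).mul ((RelIn.num e.1 (S' := mem i (encodeNat e.2 ++ s) k k' t t' u
      ((encodeNat e.1).reverse ++ u') h b) (by decide) ?_).mul
      (RelIn.num e.2 (by decide) ?_))).mono ?_
  · simp [Moves, Stk.forall, mem, pairWord]
  · simp [Moves, Stk.forall, mem]
  · simp [Moves, Stk.forall, mem]
  · simp [length_pairWord]
    omega

lemma RelIn.readColumns (es : List (ℕ × ℕ)) : ∀ {u' b},
    RelIn TilingVerifier.readColumn∗ (2 * (es.flatMap (pairWord .column)).length)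
    (mem i (es.flatMap (pairWord .column) ++ s) k k' t t' u u' h b)
    (mem i s k k' t t' u (((es.map Prod.fst).flatMap encodeNat).reverse ++ u') h
      (((es.map Prod.snd).flatMap encodeNat).reverse ++ b)) := by
  induction es with
  | nil => exact RelIn.kstar_refl _ _
  | cons e es ih =>
    intro u' b
    have hr := ((RelIn.readColumn (i := i) (s := es.flatMap (pairWord .column) ++ s) (k := k)
      (k' := k') (t := t) (t' := t') (u := u) (u' := u') (h := h) (b := b) e).kstar_cons ih).mono
      (n := 2 * ((e :: es).flatMap (pairWord .column)).length) (by
        simp only [List.flatMap_cons, List.length_append]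
        omega)
    simpa using hr

variable {c : ℕ} {T : List (Tile (Fin c))}

/-- Rewinding the tile list and advancing to an occurrence of `x` take two operations per letter
each; the tile itself takes at most three per letter. The factor `7` leaves room for the two tests
of emptiness. -/
lemma RelIn.useTile {x : Tile (Fin c)} (hx : x ∈ T) (hW : t'.reverse ++ t = T.flatMap encodeTile) :
    ∃ a a', a'.reverse ++ a = T.flatMap encodeTile ∧
      RelIn useTile (7 * (T.flatMap encodeTile).length)
        (mem i s k k' t t' (encodeNat x.u ++ u) u' (List.replicate x.l .one) b)
        (mem i s k k' a a' u ((encodeNat x.d).reverse ++ u') (List.replicate x.r .one) b) := by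
  obtain ⟨T1, T2, rfl⟩ := List.append_of_mem hx
  set p := T1.flatMap encodeTile with hp
  set q := T2.flatMap encodeTile with hq
  have hflat : (T1 ++ x :: T2).flatMap encodeTile = p ++ (encodeTile x ++ q) := by
    simp [hp, hq]
  rw [hflat] at hW ⊢
  have hlen : t'.length ≤ (p ++ (encodeTile x ++ q)).length := by
    rw [← hW]; simp
  -- The reading position ends just behind the chosen occurrence of `x`.
  refine ⟨q, (p ++ encodeTile x).reverse, by simp, ?_⟩
  refine ((RelIn.moveAll (S' := mem i s k k' (p ++ (encodeTile x ++ q)) [] (encodeNat x.u ++ u) u'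
      (List.replicate x.l .one) b) (by decide) ?_).mul
    ((RelIn.many p (S' := mem i s k k' (encodeTile x ++ q) p.reverse (encodeNat x.u ++ u) u'
      (List.replicate x.l .one) b) (by decide) (fun a _ => by cases a <;> simp) ?_).mul
    ((RelIn.one (S' := mem i s k k' (encodeNat x.u ++ (encodeNat x.d ++ (encodeNat x.l ++
      (encodeNat x.r ++ q)))) (.tile :: p.reverse) (encodeNat x.u ++ u) u'
      (List.replicate x.l .one) b) (by decide) ?_).mul
    ((RelIn.num x.u (S' := mem i s k k' (encodeNat x.d ++ (encodeNat x.l ++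
      (encodeNat x.r ++ q))) ((encodeNat x.u).reverse ++ .tile :: p.reverse) u u'
      (List.replicate x.l .one) b) (by decide) ?_).mul
    ((RelIn.num x.d (S' := mem i s k k' (encodeNat x.l ++ (encodeNat x.r ++ q))
      ((encodeNat x.d).reverse ++ ((encodeNat x.u).reverse ++ .tile :: p.reverse)) u
      ((encodeNat x.d).reverse ++ u') (List.replicate x.l .one) b) (by decide) ?_).mul
    ((RelIn.many_one x.l (S' := mem i s k k' (.sep :: (encodeNat x.r ++ q))
      (List.replicate x.l .one ++ ((encodeNat x.d).reverse ++ ((encodeNat x.u).reverse ++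
      .tile :: p.reverse))) u ((encodeNat x.d).reverse ++ u') [] b) (by decide) ?_).mul
    ((RelIn.one (S' := mem i s k k' (encodeNat x.r ++ q)
      ((encodeNat x.l).reverse ++ ((encodeNat x.d).reverse ++ ((encodeNat x.u).reverse ++
      .tile :: p.reverse))) u ((encodeNat x.d).reverse ++ u') [] b) (by decide) ?_).mul
    ((RelIn.isEmpty rfl).mul
    ((RelIn.many_one x.r (S' := mem i s k k' (.sep :: q)
      (List.replicate x.r .one ++ ((encodeNat x.l).reverse ++ ((encodeNat x.d).reverse ++
      ((encodeNat x.u).reverse ++ .tile :: p.reverse)))) u ((encodeNat x.d).reverse ++ u')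
      (List.replicate x.r .one) b) (by decide) ?_).mul
    (RelIn.one (by decide) ?_)))))))))).mono ?_
  · simp [Moves, Stk.forall, mem, hW]
  · simp [Moves, Stk.forall, mem]
  · simp [Moves, Stk.forall, mem, encodeTile]
  · simp [Moves, Stk.forall, mem]
  · simp [Moves, Stk.forall, mem]
  · simp [Moves, Stk.forall, mem, encodeNat]
  · simp [Moves, Stk.forall, mem, encodeNat]
  · simp [Moves, Stk.forall, mem, encodeNat]
  · simp [Moves, Stk.forall, mem, encodeNat, encodeTile]
  · simp [mem, length_encodeTile] at hlen ⊢
    omega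

lemma RelIn.useTiles {l r : ℕ} {ts : List (Tile (Fin c))} (hc : Chain T l ts r) : ∀ {t t' u'},
    t'.reverse ++ t = T.flatMap encodeTile → ∃ a a', a'.reverse ++ a = T.flatMap encodeTile ∧
      RelIn TilingVerifier.useTile∗ (ts.length * (7 * (T.flatMap encodeTile).length))
        (mem i s k k' t t' ((ts.map fun t => t.u.val).flatMap encodeNat ++ u) u'
          (List.replicate l .one) b)
        (mem i s k k' a a' u (((ts.map fun t => t.d.val).flatMap encodeNat).reverse ++ u')
          (List.replicate r .one) b) := by
  induction hc with
  | nil l => exact fun {t t' _} hW => ⟨t, t', hW, (RelIn.kstar_refl _ _).mono (Nat.zero_le _)⟩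
  | cons x ts r hx _ ih =>
    intro t t' u' hW
    obtain ⟨a, a', ha, h1⟩ := RelIn.useTile (i := i) (s := s) (k := k) (k' := k') (b := b) (u' := u')
      (u := (ts.map fun t => t.u.val).flatMap encodeNat ++ u) hx hW
    obtain ⟨m, m', hm, h2⟩ := ih (u' := (encodeNat x.d).reverse ++ u') ha
    refine ⟨m, m', hm, ?_⟩
    have hr := (h1.kstar_cons h2).mono
      (n := (x :: ts).length * (7 * (T.flatMap encodeTile).length)) (by
        simp only [List.length_cons, Nat.succ_mul]
        omega)
    simpa using hr

lemma length_le_of_mem {x : Tile (Fin c)} (hx : x ∈ T) :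
    (encodeTile x).length ≤ (T.flatMap encodeTile).length := by
  obtain ⟨T1, T2, rfl⟩ := List.append_of_mem hx
  simp
  omega

lemma Chain.length_le {l r : ℕ} {ts : List (Tile (Fin c))} (hc : Chain T l ts r) :
    ((ts.map fun t => t.u.val).flatMap encodeNat).length ≤
      ts.length * (T.flatMap encodeTile).length := by
  induction hc with
  | nil l => simp
  | cons x ts r hx _ ih =>
    have := length_le_of_mem hx
    rw [length_encodeTile] at this
    simp only [List.map_cons, List.flatMap_cons, List.length_append, length_encodeNat,
      List.length_cons, Nat.succ_mul]
    omega

/-- Of the factor `9`, `useTile` accounts for `7`, and moving the upper colours from `top'` to `top`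
for `2`, their total length being bounded by `Chain.length_le`. -/
lemma RelIn.readRow {l r : ℕ} {ts : List (Tile (Fin c))} (hc : Chain T l ts r)
    (hW : t'.reverse ++ t = T.flatMap encodeTile) : ∃ a a', a'.reverse ++ a = T.flatMap encodeTile ∧
      RelIn readRow (2 * (pairWord .row (l, r)).length + ts.length *
        (9 * (T.flatMap encodeTile).length) + 3)
        (mem i (pairWord .row (l, r) ++ s) k k' t t' []
          ((ts.map fun t => t.u.val).flatMap encodeNat).reverse [] b)
        (mem i s k k' a a' [] ((ts.map fun t => t.d.val).flatMap encodeNat).reverse [] b) := by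
  obtain ⟨a, a', ha, h⟩ := RelIn.useTiles (i := i) (s := encodeNat r ++ s) (k := k) (k' := k')
    (u := []) (u' := []) (b := b) hc hW
  refine ⟨a, a', ha, ?_⟩
  simp only [List.append_nil] at h
  have hlen := hc.length_le
  refine ((RelIn.one (S' := mem i (encodeNat l ++ (encodeNat r ++ s)) k k' t t' []
      ((ts.map fun t => t.u.val).flatMap encodeNat).reverse [] b) (by decide) ?_).mul
    ((RelIn.many_one l (S' := mem i (.sep :: (encodeNat r ++ s)) k k' t t' []
      ((ts.map fun t => t.u.val).flatMap encodeNat).reverse (List.replicate l .one) b)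
      (by decide) ?_).mul
    ((RelIn.one (S' := mem i (encodeNat r ++ s) k k' t t' []
      ((ts.map fun t => t.u.val).flatMap encodeNat).reverse (List.replicate l .one) b)
      (by decide) ?_).mul
    ((RelIn.moveAll (by decide) ?_).mul (h.mul ((RelIn.isEmpty rfl).mul
    ((RelIn.many_one r (S' := mem i (.sep :: s) k k' a a' []
      ((ts.map fun t => t.d.val).flatMap encodeNat).reverse [] b) (by decide) ?_).mul
    ((RelIn.one (by decide) ?_).mul (RelIn.isEmpty rfl))))))))).mono ?_
  · simp [Moves, Stk.forall, mem, pairWord]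
  · simp [Moves, Stk.forall, mem, encodeNat]
  · simp [Moves, Stk.forall, mem]
  · simp [Moves, Stk.forall, mem]
  · simp [Moves, Stk.forall, mem, encodeNat]
  · simp [Moves, Stk.forall, mem]
  · simp only [mem, List.length_reverse, length_pairWord, List.length_append, List.length_cons,
      List.length_nil]
    nlinarith

lemma RelIn.readRows {es : List (ℕ × ℕ)} {L B : List ℕ} (hr : Rows T es L B) : ∀ {t t'},
    t'.reverse ++ t = T.flatMap encodeTile → ∃ a a',
      RelIn TilingVerifier.readRow∗ (2 * (es.flatMap (pairWord .row)).length + es.length *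
        (L.length * (9 * (T.flatMap encodeTile).length) + 3))
        (mem i (es.flatMap (pairWord .row) ++ s) k k' t t' [] (L.flatMap encodeNat).reverse [] b)
        (mem i s k k' a a' [] (B.flatMap encodeNat).reverse [] b) := by
  induction hr with
  | nil L => exact fun {t t'} _ => ⟨t, t', (RelIn.kstar_refl _ _).mono (Nat.zero_le _)⟩
  | cons l r es ts B hc _ ih =>
    intro t t' hW
    obtain ⟨a, a', ha, h1⟩ := RelIn.readRow (i := i) (s := es.flatMap (pairWord .row) ++ s) (k := k)
      (k' := k') (b := b) hc hW
    obtain ⟨m, m', h2⟩ := ih ha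
    refine ⟨m, m', ?_⟩
    have hr := (h1.kstar_cons h2).mono (n := 2 * (((l, r) :: es).flatMap (pairWord .row)).length +
      ((l, r) :: es).length * ((ts.map fun t => t.u.val).length *
        (9 * (T.flatMap encodeTile).length) + 3)) (by
        simp only [List.length_cons, List.flatMap_cons, List.length_append, Nat.succ_mul,
          List.length_map]
        omega)
    simpa using hr

lemma length_le_length_flatMap {α : Type} (g : α → List Letter) (hg : ∀ x, g x ≠ []) (l : List α) :
    l.length ≤ (l.flatMap g).length := by
  induction l with
  | nil => simp
  | cons x l ih =>
    have := List.length_pos_iff.2 (hg x)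
    simp only [List.length_cons, List.flatMap_cons, List.length_append]
    omega

lemma length_flatMap_snd_le (m : Letter) (es : List (ℕ × ℕ)) :
    ((es.map Prod.snd).flatMap encodeNat).length ≤ (es.flatMap (pairWord m)).length := by
  induction es with
  | nil => simp
  | cons e es ih =>
    simp only [List.map_cons, List.flatMap_cons, List.length_append, length_encodeNat,
      length_pairWord]
    omega

lemma Rows.exists_of_cons {l r : ℕ} {es : List (ℕ × ℕ)} {L B : List ℕ}
    (h : Rows T ((l, r) :: es) L B) : ∃ ts, Chain T l ts r ∧ L = ts.map (fun t => t.u.val) ∧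
      Rows T es (ts.map fun t => t.d.val) B := by
  cases h with
  | cons l r es ts B hc h => exact ⟨ts, hc, rfl, h⟩

/-- The cubic term comes from scanning the tile list once per plaquette, the quadratic one from
rewinding the colour counter for every tile of the list. -/
theorem RelIn.program {cols rows : List (ℕ × ℕ)} (hcols : cols ≠ []) (hrows : rows ≠ [])
    (hr : Rows T rows (cols.map Prod.fst) (cols.map Prod.snd)) : ∃ S,
    RelIn program (9 * (word T cols rows).length ^ 3 + 8 * (word T cols rows).length ^ 2 +
      50 * (word T cols rows).length + 20)
      (StackSimulation.initial inp (word T cols rows)) S := by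
  obtain ⟨e, es, rfl⟩ := List.exists_cons_of_ne_nil hcols
  obtain ⟨⟨l, r⟩, fs, rfl⟩ := List.exists_cons_of_ne_nil hrows
  obtain ⟨ts, hc, hL, hr⟩ := Rows.exists_of_cons hr
  set C := (e :: es).flatMap (pairWord .column) with hC
  set R := ((l, r) :: fs).flatMap (pairWord .row) with hR
  set W := T.flatMap encodeTile with hW
  set N := (word T (e :: es) ((l, r) :: fs)).length with hN
  obtain ⟨k, k', h4⟩ := RelIn.readTiles (i := []) (k := List.replicate c .one) (k' := []) (t := [])
    (t' := []) (u := []) (u' := []) (h := []) (b := []) (s := C ++ R) T (by simp)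
  have h5 : RelIn TilingVerifier.readColumn (2 * (pairWord .column e).length)
      (mem [] (C ++ R) k k' [] (W.reverse ++ []) [] [] [] [])
      (mem [] (es.flatMap (pairWord .column) ++ R) k k' [] W.reverse [] (encodeNat e.1).reverse []
        (encodeNat e.2).reverse) := by
    simpa [hC] using RelIn.readColumn (i := []) (k := k) (k' := k') (t := [])
      (t' := W.reverse) (u := []) (u' := []) (h := []) (b := [])
      (s := es.flatMap (pairWord .column) ++ R) e
  have h6 : RelIn TilingVerifier.readColumn∗
      (2 * (es.flatMap (pairWord .column)).length)
      (mem [] (es.flatMap (pairWord .column) ++ R) k k' [] W.reverse [] (encodeNat e.1).reverse []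
        (encodeNat e.2).reverse)
      (mem [] R k k' [] W.reverse [] ((ts.map fun t => t.u.val).flatMap encodeNat).reverse []
        (((e :: es).map Prod.snd).flatMap encodeNat).reverse) := by
    rw [← hL]
    simpa using RelIn.readColumns (i := []) (k := k) (k' := k') (t := [])
      (t' := W.reverse) (u := []) (u' := (encodeNat e.1).reverse) (h := [])
      (b := (encodeNat e.2).reverse) (s := R) es
  obtain ⟨t, t', hW', h7⟩ := RelIn.readRow (i := []) (k := k) (k' := k') (t := [])
    (t' := W.reverse) (b := (((e :: es).map Prod.snd).flatMap encodeNat).reverse)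
    (s := fs.flatMap (pairWord .row)) hc (by simp [hW])
  rw [← List.flatMap_cons (xs := fs), ← hR] at h7
  obtain ⟨t, t', h8⟩ := RelIn.readRows (i := []) (k := k) (k' := k')
    (b := (((e :: es).map Prod.snd).flatMap encodeNat).reverse) (s := []) hr hW'
  rw [List.append_nil] at h8
  have hlen : c + 1 + W.length + C.length + R.length = N := by
    simp [hN, word, length_encodeNat, hW, hC, hR]
    omega
  have hT : T.length ≤ W.length := length_le_length_flatMap _ (fun x => by simp [encodeTile]) T
  have hCl : (e :: es).length ≤ C.length := length_le_length_flatMap _ (fun x => by simp [pairWord]) _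
  have hRl : ((l, r) :: fs).length ≤ R.length :=
    length_le_length_flatMap _ (fun x => by simp [pairWord]) _
  have htl : ts.length = (e :: es).length := by
    simpa using (congrArg List.length hL).symm
  have hbl : (((e :: es).map Prod.snd).flatMap encodeNat).length ≤ C.length :=
    length_flatMap_snd_le .column _
  have hCe : C.length = (pairWord .column e).length + (es.flatMap (pairWord .column)).length := by
    simp [hC]
  have hRe : R.length = (pairWord .row (l, r)).length + (fs.flatMap (pairWord .row)).length := by
    simp [hR]
  have init : StackSimulation.initial inp (word T (e :: es) ((l, r) :: fs)) =
      mem (word T (e :: es) ((l, r) :: fs)).reverse [] [] [] [] [] [] [] [] [] := by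
    funext x
    cases x <;> rfl
  have h1 := RelIn.moveAll (S := mem (word T (e :: es) ((l, r) :: fs)).reverse [] [] [] [] [] [] [] [] [])
    (S' := mem [] (word T (e :: es) ((l, r) :: fs)) [] [] [] [] [] [] [] []) (i := inp) (j := src)
    (by decide) (by simp [Moves, Stk.forall, mem])
  have h2 := RelIn.many_one (P := [src]) (Q := [cnt]) c
    (S := mem [] (word T (e :: es) ((l, r) :: fs)) [] [] [] [] [] [] [] [])
    (S' := mem [] (.sep :: (W ++ (C ++ R))) (List.replicate c .one) [] [] [] [] [] [] [])
    (by decide) (by simp [Moves, Stk.forall, mem, word, encodeNat, hW, hC, hR])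
  have h3 := RelIn.one (P := [src]) (Q := []) (a := Letter.sep)
    (S := mem [] (.sep :: (W ++ (C ++ R))) (List.replicate c .one) [] [] [] [] [] [] [])
    (S' := mem [] (W ++ (C ++ R)) (List.replicate c .one) [] [] [] [] [] [] [])
    (by decide) (by simp [Moves, Stk.forall, mem])
  have h9 := RelIn.many (P := [top', bot]) (Q := []) (Y := [.one, .sep, .tile, .column, .row])
    (S := mem [] [] k k' t t' [] (((e :: es).map Prod.snd).flatMap encodeNat).reverse []
      (((e :: es).map Prod.snd).flatMap encodeNat).reverse)
    (S' := mem [] [] k k' t t' [] [] [] []) (((e :: es).map Prod.snd).flatMap encodeNat).reverse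
    (by decide) (fun a _ => by cases a <;> simp) (by simp [Moves, Stk.forall, mem])
  refine ⟨mem [] [] k k' t t' [] [] [] [], ?_⟩
  rw [init]
  refine (h1.mul (h2.mul (h3.mul (h4.mul (h5.mul (h6.mul (h7.mul (h8.mul ((RelIn.isEmpty rfl).mul
    (h9.mul ((RelIn.isEmpty rfl).mul (RelIn.isEmpty rfl)))))))))))).mono ?_
  rw [List.length_cons] at hRl
  have e1 : T.length * (8 * c + 2) ≤ N * (8 * N + 2) := by gcongr <;> omega
  have e2 : (fs.length + 1) * (ts.length * (9 * W.length) + 3) ≤ N * (N * (9 * N) + 3) := by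
    gcongr <;> omega
  rw [Nat.succ_mul] at e2
  have e3 : N * (8 * N + 2) = 8 * N ^ 2 + 2 * N := by ring
  have e4 : N * (N * (9 * N) + 3) = 9 * N ^ 3 + 3 * N := by ring
  simp only [mem, List.length_map, List.length_reverse, List.length_append, List.length_cons,
    List.length_nil, ← hN, ← hW] at *
  omega

end TilingVerifier

/-! ### Rows of matching tiles and solutions of tiling instances. -/

namespace TilingVerifier

variable {c : ℕ} {T : List (Tile (Fin c))}

/-- The numbers `h i j` and `v i j`, put on the links of a lattice, solve the tiling problem with
boundary colours `rows`, `L` and `B`. -/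
structure Grid (T : List (Tile (Fin c))) (rows : List (ℕ × ℕ)) (L B : List ℕ) (h v : ℕ → ℕ → ℕ) :
    Prop where
  length_eq : B.length = L.length
  top : ∀ j < L.length, h 0 j = L.getD j 0
  bottom : ∀ j < L.length, h rows.length j = B.getD j 0
  left : ∀ i < rows.length, v i 0 = (rows.getD i (0, 0)).1
  right : ∀ i < rows.length, v i L.length = (rows.getD i (0, 0)).2
  tile : ∀ i < rows.length, ∀ j < L.length, ∃ t ∈ T, t.u.val = h i j ∧ t.d.val = h (i + 1) j ∧
    t.l.val = v i j ∧ t.r.val = v i (j + 1)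

lemma chain_of_forall (f : ℕ → Tile (Fin c)) (w : ℕ) : ∀ v : ℕ → ℕ,
    (∀ j < w, f j ∈ T ∧ (f j).l.val = v j ∧ (f j).r.val = v (j + 1)) →
    Chain T (v 0) ((List.range w).map f) (v w) := by
  induction w generalizing f with
  | zero => exact fun v _ => .nil _
  | succ w ih =>
    intro v hv
    have h0 := hv 0 (by omega)
    have := ih (fun j => f (j + 1)) (fun j => v (j + 1)) fun j hj => hv (j + 1) (by omega)
    rw [List.range_succ_eq_map, List.map_cons, List.map_map, ← h0.2.1]
    refine .cons _ _ _ h0.1 ?_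
    rw [h0.2.2]
    exact this

lemma Chain.exists_fun {l r : ℕ} {ts : List (Tile (Fin c))} (h : Chain T l ts r) : ∃ v : ℕ → ℕ,
    v 0 = l ∧ v ts.length = r ∧ ∀ j, ∀ hj : j < ts.length,
      ts[j] ∈ T ∧ ts[j].l.val = v j ∧ ts[j].r.val = v (j + 1) := by
  induction h with
  | nil l => exact ⟨fun _ => l, rfl, rfl, by simp⟩
  | cons t ts r ht _ ih =>
    obtain ⟨v, h0, h1, h2⟩ := ih
    refine ⟨fun j => match j with | 0 => t.l | j + 1 => v j, rfl, h1, ?_⟩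
    rintro (_ | j) hj
    · exact ⟨ht, rfl, h0.symm⟩
    · exact h2 j (by simpa using hj)

/-- The top row is split off: its tiles form a chain, and the colours below them are the upper
boundary of the remaining grid. -/
lemma Grid.rows {rows : List (ℕ × ℕ)} {L B : List ℕ} {h v : ℕ → ℕ → ℕ}
    (hg : Grid T rows L B h v) : Rows T rows L B := by
  induction rows generalizing L h v with
  | nil =>
    have : L = B := by
      refine List.ext_getElem hg.length_eq.symm fun j h1 h2 => ?_
      have := (hg.top j h1).symm.trans (hg.bottom j h1)
      rwa [List.getD_eq_getElem _ _ h1, List.getD_eq_getElem _ _ h2] at this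
    exact this ▸ .nil L
  | cons e rows ih =>
    have hrow := fun j hj => hg.tile 0 (by simp) j hj
    obtain ⟨ts, hc, hlen, hts⟩ : ∃ ts : List (Tile (Fin c)), Chain T (v 0 0) ts (v 0 L.length) ∧
        ts.length = L.length ∧
        ∀ j, ∀ hj : j < ts.length, ts[j].u.val = h 0 j ∧ ts[j].d.val = h 1 j := by
      -- Choosing a tile for each column needs an inhabited type; if there are no tiles at all, the
      -- row has no plaquettes.
      rcases isEmpty_or_nonempty (Tile (Fin c)) with hE | hE
      · have h0 : L.length = 0 := by
          by_contra h0
          exact hE.elim (hrow 0 (by omega)).choose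
        exact ⟨[], by rw [h0]; exact .nil _, by simp [h0], by simp⟩
      · choose! f hf using hrow
        refine ⟨(List.range L.length).map f, chain_of_forall (T := T) f L.length (v 0) fun j hj =>
          ⟨(hf j hj).1, (hf j hj).2.2.2.1, (hf j hj).2.2.2.2⟩, by simp, fun j hj => ?_⟩
        have hj' : j < L.length := by simpa using hj
        simp [(hf j hj').2.1, (hf j hj').2.2.1]
    have hL : L = ts.map fun t => t.u.val := by
      refine List.ext_getElem (by simp [hlen]) fun j h1 h2 => ?_
      have := hg.top j h1
      rw [List.getD_eq_getElem _ _ h1] at this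
      simp [(hts j (by omega)).1, this]
    have hl := hg.left 0 (by simp)
    have hr := hg.right 0 (by simp)
    simp only [List.getD_cons_zero] at hl hr
    rw [hl, hr] at hc
    obtain ⟨l, r⟩ := e
    rw [hL]
    refine .cons l r rows _ B hc (ih (h := fun i => h (i + 1)) (v := fun i => v (i + 1)) ?_)
    refine ⟨by simp [hlen, hg.length_eq], fun j hj => ?_, fun j hj => ?_, fun i hi => ?_,
      fun i hi => ?_, fun i hi j hj => ?_⟩
    · have hj' : j < ts.length := by simpa using hj
      rw [List.getD_eq_getElem _ _ hj]
      simp [(hts j hj').2]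
    · exact hg.bottom j (by simpa [hlen] using hj)
    · simpa using hg.left (i + 1) (by simpa using hi)
    · simpa [hlen] using hg.right (i + 1) (by simpa using hi)
    · exact hg.tile (i + 1) (by simpa using hi) j (by simpa [hlen] using hj)

lemma Rows.exists_grid {rows : List (ℕ × ℕ)} {L B : List ℕ} (hr : Rows T rows L B) :
    ∃ h v, Grid T rows L B h v := by
  induction hr with
  | nil L => exact ⟨fun _ j => L.getD j 0, fun _ _ => 0, rfl, fun _ _ => rfl, fun _ _ => rfl,
      by simp, by simp, by simp⟩
  | cons l r es ts B hc _ ih =>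
    obtain ⟨h, v, hg⟩ := ih
    obtain ⟨w, hl, hr, hw⟩ := hc.exists_fun
    refine ⟨fun i => match i with
        | 0 => fun j => (ts.map fun t => t.u.val).getD j 0
        | i + 1 => h i,
      fun i => match i with | 0 => w | i + 1 => v i, by simpa using hg.length_eq, fun _ _ => rfl,
      fun j hj => hg.bottom j (by simpa using hj), ?_, ?_, ?_⟩
    · rintro (_ | i) hi
      · exact hl
      · simpa using hg.left i (by simpa using hi)
    · rintro (_ | i) hi
      · simpa using hr
      · simpa using hg.right i (by simpa using hi)
    · rintro (_ | i) hi j hj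
      · have hj' : j < ts.length := by simpa using hj
        have ht := hg.top j (by simpa using hj)
        change ∃ t ∈ T, t.u.val = _ ∧ t.d.val = h 0 j ∧ _
        refine ⟨ts[j], (hw j hj').1, ?_, ?_, (hw j hj').2⟩
        · simp [hj']
        · rw [ht, List.getD_eq_getElem _ _ (by simpa using hj)]
          simp
      · exact hg.tile i (by simpa using hi) j (by simpa using hj)

/-- The verifier never compares the boundary colours with the number of colours. It need not: there
is at least one row and one column, so every link borders on a plaquette, and its number is a colour
of a tile and hence smaller than `c`. -/
lemma exists_instance {cols rows : List (ℕ × ℕ)} (hcols : cols ≠ []) (hrows : rows ≠ [])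
    (hr : Rows T rows (cols.map Prod.fst) (cols.map Prod.snd)) :
    ∃ I : BoundedTiling, I.Solvable ∧ I.encode = word T cols rows := by
  obtain ⟨h, v, hg⟩ := hr.exists_grid
  obtain ⟨_, htop, hbot, hleft, hright, htile⟩ := hg
  have hw : 0 < cols.length := List.length_pos_iff.2 hcols
  have hh : 0 < rows.length := List.length_pos_iff.2 hrows
  simp only [List.length_map] at htop hbot hright htile
  have hhc : ∀ i ≤ rows.length, ∀ j < cols.length, h i j < c := by
    rintro (_ | i) hi j hj
    · obtain ⟨t, -, h1, -⟩ := htile 0 hh j hj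
      exact h1 ▸ t.u.2
    · obtain ⟨t, -, -, h1, -⟩ := htile i hi j hj
      exact h1 ▸ t.d.2
  have hvc : ∀ i < rows.length, ∀ j ≤ cols.length, v i j < c := by
    rintro i hi (_ | j) hj
    · obtain ⟨t, -, -, -, h1, -⟩ := htile i hi 0 hw
      exact h1 ▸ t.l.2
    · obtain ⟨t, -, -, -, -, h1⟩ := htile i hi j hj
      exact h1 ▸ t.r.2
  let I : BoundedTiling :=
    { colours := c
      height := rows.length
      width := cols.length
      height_pos := hh
      width_pos := hw
      tiles := T
      top := fun j => ⟨h 0 j, hhc 0 (Nat.zero_le _) j j.2⟩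
      bottom := fun j => ⟨h rows.length j, hhc _ le_rfl j j.2⟩
      left := fun i => ⟨v i 0, hvc i i.2 0 (Nat.zero_le _)⟩
      right := fun i => ⟨v i cols.length, hvc i i.2 _ le_rfl⟩ }
  refine ⟨I, ⟨⟨fun i j => ⟨h i j, hhc i (Nat.lt_succ_iff.1 i.2) j j.2⟩,
    fun i j => ⟨v i j, hvc i i.2 j (Nat.lt_succ_iff.1 j.2)⟩⟩, fun i j => ?_, fun _ => rfl,
      fun _ => rfl, fun _ => rfl, fun _ => rfl⟩, ?_⟩
  · obtain ⟨t, ht, h1, h2, h3, h4⟩ := htile i i.2 j j.2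
    refine List.mem_toFinset.2 ?_
    convert ht using 1
    obtain ⟨u, d, l, r⟩ := t
    simp only [Tile.mk.injEq]
    exact ⟨Fin.ext h1.symm, Fin.ext h2.symm, Fin.ext h3.symm, Fin.ext h4.symm⟩
  · have flat : ∀ (m : Letter) (l : List (Fin c × Fin c)), l.flatMap (encodePair m) =
        (l.map fun e => (e.1.val, e.2.val)).flatMap (pairWord m) := fun m l => by
      rw [List.flatMap_map]; rfl
    have hC : (List.ofFn fun j => (I.top j, I.bottom j)).map (fun e => (e.1.val, e.2.val)) = cols := by
      refine List.ext_getElem (by simp [I]) fun j h1 h2 => ?_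
      have ht := htop j h2
      have hb := hbot j h2
      rw [List.getD_eq_getElem _ _ (by simpa using h2), List.getElem_map] at ht hb
      simp [I, ht, hb]
    have hR : (List.ofFn fun i => (I.left i, I.right i)).map (fun e => (e.1.val, e.2.val)) = rows := by
      refine List.ext_getElem (by simp [I]) fun j h1 h2 => ?_
      have hl := hleft j h2
      have hr := hright j h2
      rw [List.getD_eq_getElem _ _ h2] at hl hr
      simp [I, hl, hr]
    simp only [BoundedTiling.encode, word, List.append_assoc]
    rw [flat, flat, hC, hR]

lemma exists_word (I : BoundedTiling) (hI : I.Solvable) : ∃ cols rows : List (ℕ × ℕ), cols ≠ [] ∧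
    rows ≠ [] ∧ I.encode = word I.tiles cols rows ∧
    Rows I.tiles rows (cols.map Prod.fst) (cols.map Prod.snd) := by
  obtain ⟨t, htile, htop, hbot, hleft, hright⟩ := hI
  have flat : ∀ (m : Letter) (l : List (Fin I.colours × Fin I.colours)), l.flatMap (encodePair m) =
      (l.map fun e => (e.1.val, e.2.val)).flatMap (pairWord m) := fun m l => by
    rw [List.flatMap_map]; rfl
  refine ⟨(List.ofFn fun j => (I.top j, I.bottom j)).map fun e => (e.1.val, e.2.val),
    (List.ofFn fun i => (I.left i, I.right i)).map fun e => (e.1.val, e.2.val),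
    List.ne_nil_of_length_pos (by simpa using I.width_pos),
    List.ne_nil_of_length_pos (by simpa using I.height_pos), ?_, ?_⟩
  · simp only [BoundedTiling.encode, word, List.append_assoc, flat]
  -- The value `0` is given to links outside the lattice, which no condition of `Grid` mentions.
  · refine Grid.rows
      (h := fun i j => if hij : i < I.height + 1 ∧ j < I.width then
        t.horizontal ⟨i, hij.1⟩ ⟨j, hij.2⟩ else 0)
      (v := fun i j => if hij : i < I.height ∧ j < I.width + 1 then
        t.vertical ⟨i, hij.1⟩ ⟨j, hij.2⟩ else 0) ⟨by simp, ?_, ?_, ?_, ?_, ?_⟩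
    · intro j hj
      have hj' : j < I.width := by simpa using hj
      have := htop ⟨j, hj'⟩
      simp [hj', ← this]
    · intro j hj
      have hj' : j < I.width := by simpa using hj
      have := hbot ⟨j, hj'⟩
      simp [hj', ← this, Fin.last]
    · intro i hi
      have hi' : i < I.height := by simpa using hi
      have := hleft ⟨i, hi'⟩
      simp [hi', ← this]
    · intro i hi
      have hi' : i < I.height := by simpa using hi
      have := hright ⟨i, hi'⟩
      simp [hi', ← this, Fin.last]
    · intro i hi j hj
      have hi' : i < I.height := by simpa using hi
      have hj' : j < I.width := by simpa using hj
      refine ⟨_, List.mem_toFinset.1 (htile ⟨i, hi'⟩ ⟨j, hj'⟩), ?_, ?_, ?_, ?_⟩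
      · simp [hj', hi'.trans (Nat.lt_succ_self _)]
      · simp [hj', hi']
      · simp [hi', hj'.trans (Nat.lt_succ_self _)]
      · simp [hi', hj']

end TilingVerifier

/-- The solvable bounded tiling instances form a language in NP. -/
theorem BoundedTiling.inNP_solvable :
    InNP ({s | ∃ I ∈ {I : BoundedTiling | I.Solvable}, I.encode = s} : Language Letter) := by
  have : Finite Letter := Finite.of_surjective
    (fun i : Fin 5 => match i with | 0 => Letter.one | 1 => .sep | 2 => .tile | 3 => .column | 4 => .row)
    (by rintro (_ | _ | _ | _ | _); exacts [⟨0, rfl⟩, ⟨1, rfl⟩, ⟨2, rfl⟩, ⟨3, rfl⟩, ⟨4, rfl⟩])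
  refine StackSimulation.inNP_of_traces TilingVerifier.Stk.inp TilingVerifier.isRegular_program _
    (9 * Polynomial.X ^ 3 + 8 * Polynomial.X ^ 2 + 50 * Polynomial.X + 20) ?_ ?_
  · intro s tr htr S hS
    obtain ⟨c, T, cols, rows, hcols, hrows, rfl, hr⟩ := TilingVerifier.Rel.program ⟨tr, htr, hS⟩
    exact TilingVerifier.exists_instance hcols hrows hr
  · rintro _ ⟨I, hI, rfl⟩
    obtain ⟨cols, rows, hcols, hrows, he, hr⟩ := TilingVerifier.exists_word I hI
    rw [he]
    obtain ⟨S, tr, htr, hlen, hS⟩ := TilingVerifier.RelIn.program hcols hrows hr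
    exact ⟨tr, htr, by simpa using hlen, S, hS⟩

/-! ### Space-time diagrams of nondeterministic machines. -/

namespace NTM

variable {A : Type} (M : NTM A)

/-- The colours with which the space-time diagrams of `M` are drawn: on horizontal links the
contents of a cell, with or without the head, the mark of the last line, and the mark from which
the computation starts; on vertical links the signals that separate the cells before the head from
those after it and carry the state along when the head moves. -/
inductive Colour
  | cell (s : M.Symbol)
  | head (s : M.Symbol) (q : M.State)
  | fin
  | pre
  | bef
  | aft
  | goRight (q : M.State)
  | goLeft (q : M.State)

instance : Nonempty M.Colour := ⟨.fin⟩

instance : Finite M.Colour := by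
  have := M.finSymbol
  have := M.finState
  let f : M.Symbol ⊕ (M.Symbol × M.State) ⊕ M.State ⊕ M.State ⊕ Fin 4 → M.Colour
    | .inl s => .cell s
    | .inr (.inl (s, q)) => .head s q
    | .inr (.inr (.inl q)) => .goRight q
    | .inr (.inr (.inr (.inl q))) => .goLeft q
    | .inr (.inr (.inr (.inr 0))) => .fin
    | .inr (.inr (.inr (.inr 1))) => .pre
    | .inr (.inr (.inr (.inr 2))) => .bef
    | .inr (.inr (.inr (.inr 3))) => .aft
  refine Finite.of_surjective f ?_
  rintro (s | ⟨s, q⟩ | _ | _ | _ | _ | q | q)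
  exacts [⟨.inl s, rfl⟩, ⟨.inr (.inl (s, q)), rfl⟩, ⟨.inr (.inr (.inr (.inr 0))), rfl⟩,
    ⟨.inr (.inr (.inr (.inr 1))), rfl⟩, ⟨.inr (.inr (.inr (.inr 2))), rfl⟩,
    ⟨.inr (.inr (.inr (.inr 3))), rfl⟩, ⟨.inr (.inr (.inl q)), rfl⟩,
    ⟨.inr (.inr (.inr (.inl q))), rfl⟩]

/-- The tiles (up, down, left, right) of space-time diagrams. -/
inductive Rule : M.Colour → M.Colour → M.Colour → M.Colour → Prop
  | cellBef (s) : Rule (.cell s) (.cell s) .bef .bef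
  | cellAft (s) : Rule (.cell s) (.cell s) .aft .aft
  | stay {q s q' s'} (h : (q, s, q', s', Move.stay) ∈ M.program) :
      Rule (.head s q) (.head s' q') .bef .aft
  | right {q s q' s'} (h : (q, s, q', s', Move.right) ∈ M.program) :
      Rule (.head s q) (.cell s') .bef (.goRight q')
  | left {q s q' s'} (h : (q, s, q', s', Move.left) ∈ M.program) :
      Rule (.head s q) (.cell s') (.goLeft q') .aft
  | fromLeft (s q) : Rule (.cell s) (.head s q) (.goRight q) .aft
  | fromRight (s q) : Rule (.cell s) (.head s q) .bef (.goLeft q)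
  | accept (s) : Rule (.head s M.accept) (.head s M.accept) .bef .aft
  | finBef (s) : Rule (.cell s) .fin .bef .bef
  | finAft (s) : Rule (.cell s) .fin .aft .aft
  | finAccept (s) : Rule (.head s M.accept) .fin .bef .aft
  | pre : Rule .pre (.cell M.blank) .bef (.goRight M.start)

variable {M}

/-- This confines `fin` to the last line of a diagram, since no row can be placed below it. -/
lemma Rule.ne_fin {u d l r : M.Colour} (h : M.Rule u d l r) : u ≠ .fin := by
  cases h <;> simp

/-- The line of a space-time diagram that shows the description `c`. -/
def Cfg.line (c : M.Cfg) (z : ℤ) : M.Colour :=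
  open Classical in if z = c.head then .head (c.tape z) c.state else .cell (c.tape z)

lemma Cfg.line_head (c : M.Cfg) : c.line c.head = .head (c.tape c.head) c.state := by
  simp [Cfg.line]

lemma Cfg.line_of_ne (c : M.Cfg) {z : ℤ} (h : z ≠ c.head) : c.line z = .cell (c.tape z) := by
  simp [Cfg.line, h]

section Row

variable {a b : ℤ} {u d v : ℤ → M.Colour}

/-- From the left border, `bef` is passed on through cells without a head. Only `fromRight` can
change it, into `goLeft`; since no tile with a plain cell on top accepts `goLeft` from its left,
this can happen only immediately before `z`. So at most one head enters on this side, next to `z`,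
and every other cell is copied or ended. -/
lemma signal_left (ha : v a = .bef) (ht : ∀ z, a ≤ z → z < b → M.Rule (u z) (d z) (v z) (v (z + 1)))
    {z : ℤ} (hz : a ≤ z) (hzb : z ≤ b) (hu : ∀ y, a ≤ y → y < z → ∃ s, u y = .cell s) :
    (v z = .bef ∧ ∀ y, a ≤ y → y < z → d y = u y ∨ d y = .fin) ∨
    (∃ q s, v z = .goLeft q ∧ a ≤ z - 1 ∧ u (z - 1) = .cell s ∧ d (z - 1) = .head s q ∧
      ∀ y, a ≤ y → y < z - 1 → d y = u y ∨ d y = .fin) := by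
  induction z, hz using Int.leInduction with
  | base => exact .inl ⟨ha, fun y h1 h2 => by omega⟩
  | succ z hz ih =>
    have htz := ht z hz (by omega)
    obtain ⟨s, hs⟩ := hu z hz (by omega)
    rcases ih (by omega) fun y h1 h2 => hu y h1 (by omega) with ⟨hv, hd⟩ | ⟨q, s', hv, -⟩
    · rw [hs, hv] at htz
      generalize hdz : d z = x at htz
      generalize hvz : v (z + 1) = y at htz
      cases htz with
      | cellBef =>
        refine .inl ⟨rfl, fun y h1 h2 => ?_⟩
        rcases (by omega : y < z ∨ y = z) with h | rfl
        · exact hd y h1 h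
        · exact .inl (hdz.trans hs.symm)
      | finBef =>
        refine .inl ⟨rfl, fun y h1 h2 => ?_⟩
        rcases (by omega : y < z ∨ y = z) with h | rfl
        · exact hd y h1 h
        · exact .inr hdz
      | fromRight _ q =>
        refine .inr ⟨q, s, rfl, by omega, by simpa using hs, by simpa using hdz, ?_⟩
        exact fun y h1 h2 => hd y h1 (by omega)
    · rw [hs, hv] at htz
      generalize d z = x at htz
      cases htz

/-- The mirror image of `signal_left`: from the right border, `aft` can be replaced only by
`goRight`, and only right at `z`. -/
lemma signal_right (hb : v b = .aft)
    (ht : ∀ z, a ≤ z → z < b → M.Rule (u z) (d z) (v z) (v (z + 1)))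
    {z : ℤ} (hz : z ≤ b) (hza : a ≤ z) (hu : ∀ y, z ≤ y → y < b → ∃ s, u y = .cell s) :
    (v z = .aft ∧ ∀ y, z ≤ y → y < b → d y = u y ∨ d y = .fin) ∨
    (∃ q s, v z = .goRight q ∧ z < b ∧ u z = .cell s ∧ d z = .head s q ∧
      ∀ y, z < y → y < b → d y = u y ∨ d y = .fin) := by
  induction z, hz using Int.leInductionDown with
  | base => exact .inl ⟨hb, fun y h1 h2 => by omega⟩
  | pred z hz ih =>
    have htz := ht (z - 1) hza (by omega)
    obtain ⟨s, hs⟩ := hu (z - 1) le_rfl (by omega)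
    rw [sub_add_cancel] at htz
    rcases ih (by omega) fun y h1 h2 => hu y (by omega) h2 with ⟨hv, hd⟩ | ⟨q, s', hv, -⟩
    · rw [hs, hv] at htz
      generalize hdz : d (z - 1) = x at htz
      generalize hvz : v (z - 1) = y at htz
      cases htz with
      | cellAft =>
        refine .inl ⟨rfl, fun y h1 h2 => ?_⟩
        rcases (by omega : z ≤ y ∨ y = z - 1) with h | rfl
        · exact hd y h h2
        · exact .inl (hdz.trans hs.symm)
      | finAft =>
        refine .inl ⟨rfl, fun y h1 h2 => ?_⟩
        rcases (by omega : z ≤ y ∨ y = z - 1) with h | rfl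
        · exact hd y h h2
        · exact .inr hdz
      | fromLeft _ q =>
        refine .inr ⟨q, s, rfl, by omega, hs, rfl, ?_⟩
        exact fun y h1 h2 => hd y (by omega) h2
    · rw [hs, hv] at htz
      generalize d (z - 1) = x at htz
      generalize v (z - 1) = y at htz
      cases htz

/-- The tile under the head either needs the accepting state or carries out an instruction of the
program. In the latter case its two signals decide between the alternatives of `signal_left` and
`signal_right`, so the new head appears exactly where the instruction sends it. -/
lemma exists_step_of_row {c : M.Cfg} (ha : v a = .bef) (hb : v b = .aft)
    (ht : ∀ z, a ≤ z → z < b → M.Rule (u z) (d z) (v z) (v (z + 1)))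
    (h1 : a ≤ c.head) (h2 : c.head < b) (hu : ∀ z, a ≤ z → z < b → u z = c.line z) :
    c.state = M.accept ∨ d c.head ≠ .fin ∧ ((∀ z, a ≤ z → z < b → d z ≠ .fin) →
      ∃ c', M.Step c c' ∧ a ≤ c'.head ∧ c'.head < b ∧ ∀ z, a ≤ z → z < b → d z = c'.line z) := by
  have hl := signal_left ha ht h1 h2.le fun y h3 h4 =>
    ⟨_, (hu y h3 (by omega)).trans (c.line_of_ne h4.ne)⟩
  have hr := signal_right hb ht (z := c.head + 1) (by omega) (by omega) fun y h3 h4 =>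
    ⟨_, (hu y (by omega) h4).trans (c.line_of_ne (by omega))⟩
  have hh := ht c.head h1 h2
  rw [hu _ h1 h2, c.line_head] at hh
  generalize hd : d c.head = x at hh
  generalize hvl : v c.head = vl at hh hl
  generalize hvr : v (c.head + 1) = vr at hh hr
  generalize hs : c.tape c.head = s at hh
  generalize hq : c.state = q at hh
  cases hh with
  | @stay q s q' s' hp =>
    refine .inr ⟨by simp, fun hf => ⟨⟨q', c.head, fun z => open Classical in
      if z = c.head then s' else c.tape z⟩,
      ⟨q', s', .stay, by rwa [hq, hs], rfl, by simp [Move.toInt], by ext; simp⟩, h1, h2,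
      fun z h3 h4 => ?_⟩⟩
    simp only [reduceCtorEq, false_and, exists_false, or_false, true_and] at hl hr
    rcases lt_trichotomy z c.head with h | h | h
    · rw [(hl z h3 h).resolve_right (hf z h3 h4), hu z h3 h4]
      simp [Cfg.line, h.ne]
    · subst h
      simp [Cfg.line, hd]
    · rw [(hr z h h4).resolve_right (hf z h3 h4), hu z h3 h4]
      simp [Cfg.line, h.ne']
  | @right q s q' s' hp =>
    refine .inr ⟨by simp, fun hf => ?_⟩
    simp only [reduceCtorEq, false_and, exists_false, or_false, true_and, false_or,
      Colour.goRight.injEq] at hl hr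
    obtain ⟨_, s₁, rfl, h5, h6, h7, h8⟩ := hr
    refine ⟨⟨q', c.head + 1, fun z => open Classical in
      if z = c.head then s' else c.tape z⟩,
      ⟨q', s', .right, by rwa [hq, hs], rfl, by simp [Move.toInt], by ext; simp⟩, by simp; omega, h5,
      fun z h3 h4 => ?_⟩
    rw [hu _ (by omega) h5, c.line_of_ne (by omega)] at h6
    rcases (by omega : z < c.head ∨ z = c.head ∨ z = c.head + 1 ∨ c.head + 1 < z) with h | h | h | h
    · rw [(hl z h3 h).resolve_right (hf z h3 h4), hu z h3 h4]
      simp [Cfg.line, h.ne, show z ≠ c.head + 1 by omega]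
    · subst h
      simp [Cfg.line, hd]
    · subst h
      rw [h7]
      simp only [Colour.cell.injEq] at h6
      simp [Cfg.line, h6]
    · rw [(h8 z h h4).resolve_right (hf z h3 h4), hu z h3 h4]
      simp [Cfg.line, h.ne', show z ≠ c.head by omega]
  | @left q s q' s' hp =>
    refine .inr ⟨by simp, fun hf => ?_⟩
    simp only [reduceCtorEq, false_and, exists_false, or_false, true_and, false_or,
      Colour.goLeft.injEq] at hl hr
    obtain ⟨_, s₁, rfl, h5, h6, h7, h8⟩ := hl
    refine ⟨⟨q', c.head - 1, fun z => open Classical in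
      if z = c.head then s' else c.tape z⟩,
      ⟨q', s', .left, by rwa [hq, hs], rfl, by simp [Move.toInt, sub_eq_add_neg], by ext; simp⟩, h5,
      by simp; omega, fun z h3 h4 => ?_⟩
    rw [hu _ h5 (by omega), c.line_of_ne (by omega)] at h6
    rcases (by omega : z < c.head - 1 ∨ z = c.head - 1 ∨ z = c.head ∨ c.head < z) with h | h | h | h
    · rw [(h8 z h3 h).resolve_right (hf z h3 h4), hu z h3 h4]
      simp [Cfg.line, h.ne, show z ≠ c.head by omega]
    · subst h
      rw [h7]
      simp only [Colour.cell.injEq] at h6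
      simp [Cfg.line, h6]
    · subst h
      simp [Cfg.line, hd, show c.head ≠ c.head - 1 by omega]
    · rw [(hr z h h4).resolve_right (hf z h3 h4), hu z h3 h4]
      simp [Cfg.line, h.ne', show z ≠ c.head - 1 by omega]
  | accept => exact .inl rfl
  | finAccept => exact .inl rfl

/-- The signal is `bef` up to the head and `aft` behind it; a move puts the new state on the one
link that the head crosses. -/
lemma exists_row_of_step {c c' : M.Cfg} (hc : M.Step c c') (h1 : a ≤ c.head) (h2 : c.head < b)
    (h3 : a ≤ c'.head) (h4 : c'.head < b) :
    ∃ v : ℤ → M.Colour, v a = .bef ∧ v b = .aft ∧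
      ∀ z, M.Rule (c.line z) (c'.line z) (v z) (v (z + 1)) := by
  obtain ⟨q, i, t⟩ := c
  obtain ⟨q', i', t'⟩ := c'
  obtain ⟨_, s', m, hp, rfl, h5, h6⟩ := hc
  simp only at h1 h2 h3 h4 h5 h6 hp
  subst h5
  cases m with
  | stay =>
    refine ⟨fun z => if z ≤ i then .bef else .aft, if_pos h1, if_neg (by omega), fun z => ?_⟩
    rcases lt_trichotomy z i with h | rfl | h
    · simpa [Cfg.line, h6, h.ne, Move.toInt, h.le, show z + 1 ≤ i by omega] using Rule.cellBef _
    · simpa [Cfg.line, h6, Move.toInt] using Rule.stay hp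
    · simpa [Cfg.line, h6, h.ne', Move.toInt, h.not_ge, show ¬ z + 1 ≤ i by omega]
        using Rule.cellAft _
  | right =>
    simp only [Move.toInt] at h3 h4
    refine ⟨fun z => if z ≤ i then .bef else if z = i + 1 then .goRight q' else .aft, if_pos h1,
      by simp only; rw [if_neg (by omega), if_neg (by omega)], fun z => ?_⟩
    rcases (by omega : z < i ∨ z = i ∨ z = i + 1 ∨ i + 1 < z) with h | rfl | rfl | h
    · simpa [Cfg.line, h6, h.ne, Move.toInt, h.le, show z + 1 ≤ i by omega,
        show z ≠ i + 1 by omega] using Rule.cellBef _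
    · simpa [Cfg.line, h6, Move.toInt] using Rule.right hp
    · simpa [Cfg.line, h6, Move.toInt] using Rule.fromLeft _ _
    · simpa [Cfg.line, h6, h.ne', Move.toInt, show ¬ z ≤ i by omega, show z ≠ i by omega,
        show ¬ z + 1 ≤ i by omega] using Rule.cellAft _
  | left =>
    simp only [Move.toInt] at h3 h4
    refine ⟨fun z => if z < i then .bef else if z = i then .goLeft q' else .aft, if_pos (by omega),
      by simp only; rw [if_neg (by omega), if_neg (by omega)], fun z => ?_⟩
    rcases (by omega : z < i + -1 ∨ z = i + -1 ∨ z = i ∨ i < z) with h | rfl | rfl | h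
    · simpa [Cfg.line, h6, h.ne, Move.toInt, show z < i by omega, show z ≠ i by omega,
        show z + 1 < i by omega] using Rule.cellBef _
    · simpa [Cfg.line, h6, Move.toInt] using Rule.fromRight _ _
    · simpa [Cfg.line, h6, Move.toInt] using Rule.left hp
    · simpa [Cfg.line, h6, h.ne', Move.toInt, show ¬ z < i by omega, show z ≠ i + -1 by omega,
        show ¬ z + 1 < i by omega, show z + 1 ≠ i by omega] using Rule.cellAft _

lemma exists_row_of_accept {c : M.Cfg} (hc : c.state = M.accept) (h1 : a ≤ c.head)
    (h2 : c.head < b) : ∃ v : ℤ → M.Colour, v a = .bef ∧ v b = .aft ∧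
      ∀ z, M.Rule (c.line z) (c.line z) (v z) (v (z + 1)) ∧
        M.Rule (c.line z) .fin (v z) (v (z + 1)) := by
  refine ⟨fun z => if z ≤ c.head then .bef else .aft, if_pos h1, if_neg (by omega), fun z => ?_⟩
  rcases lt_trichotomy z c.head with h | rfl | h
  · simpa [Cfg.line, h.ne, h.le, show z + 1 ≤ c.head by omega] using
      And.intro (Rule.cellBef _) (Rule.finBef _)
  · simpa [Cfg.line, hc] using And.intro (Rule.accept _) (Rule.finAccept _)
  · simpa [Cfg.line, h.ne', h.not_ge, show ¬ z + 1 ≤ c.head by omega] using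
      And.intro (Rule.cellAft _) (Rule.finAft _)

end Row

variable (M)

/-- The first line of the space-time diagrams with input `w`. -/
def firstLine (w : List A) (z : ℤ) : M.Colour :=
  if z = -1 then .pre else .cell ((M.init w).tape z)

/-- The space-time diagram of `M` on input `w`, with `k` lines and margins of width `k`. -/
structure Diagram (w : List A) (k : ℕ) (h v : ℕ → ℤ → M.Colour) : Prop where
  rule : ∀ i < k, ∀ z : ℤ, -(k + 1 : ℤ) ≤ z → z < w.length + k →
    M.Rule (h i z) (h (i + 1) z) (v i z) (v i (z + 1))
  first : ∀ z : ℤ, -(k + 1 : ℤ) ≤ z → z < w.length + k → h 0 z = M.firstLine w z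
  last : ∀ z : ℤ, -(k + 1 : ℤ) ≤ z → z < w.length + k → h k z = .fin
  left : ∀ i < k, v i (-(k + 1 : ℤ)) = .bef
  right : ∀ i < k, v i (w.length + k) = .aft

variable {M}

/-- The mark `pre` at cell `-1`, which is blank, sends the initial state to cell `0` as if the head
were moving right. Therefore the colour above an input cell depends on its letter alone, and the
empty input is no exception. -/
lemma exists_firstRow (w : List A) {a b : ℤ} (ha : a ≤ -1) (hb : 0 < b) :
    ∃ v : ℤ → M.Colour, v a = .bef ∧ v b = .aft ∧
      ∀ z, M.Rule (M.firstLine w z) ((M.init w).line z) (v z) (v (z + 1)) := by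
  refine ⟨fun z => if z < 0 then .bef else if z = 0 then .goRight M.start else .aft,
    if_pos (by omega), by simp only; rw [if_neg (by omega), if_neg (by omega)], fun z => ?_⟩
  have h0 : (M.init w).head = 0 := rfl
  have h1 : (M.init w).tape (-1) = M.blank := rfl
  have h2 : (M.init w).state = M.start := rfl
  rcases (by omega : z < -1 ∨ z = -1 ∨ z = 0 ∨ 0 < z) with h | rfl | rfl | h
  · simpa [firstLine, Cfg.line, h0, h.ne, show z < 0 by omega, show z ≠ 0 by omega,
      show z + 1 < 0 by omega] using Rule.cellBef _
  · simpa [firstLine, Cfg.line, h0, h1] using Rule.pre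
  · simpa [firstLine, Cfg.line, h0, h2] using Rule.fromLeft _ _
  · simpa [firstLine, Cfg.line, h0, h.not_gt, show z ≠ 0 by omega, show z ≠ -1 by omega,
      show ¬ z + 1 < 0 by omega, show z + 1 ≠ 0 by omega] using Rule.cellAft _

lemma Step.abs_head_le {c c' : M.Cfg} (h : M.Step c c') : |c'.head| ≤ |c.head| + 1 := by
  obtain ⟨_, _, m, _, _, h, _⟩ := h
  rw [h]
  refine (abs_add_le _ _).trans (add_le_add_right ?_ _)
  cases m <;> simp [Move.toInt]

lemma ReachesIn.exists_fun {t : ℕ} {c c' : M.Cfg} (h : M.ReachesIn t c c') : ∃ f : ℕ → M.Cfg,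
    f 0 = c ∧ (∀ i < t, M.Step (f i) (f (i + 1))) ∧ ∀ i, t ≤ i → f i = c' := by
  induction t generalizing c with
  | zero => exact ⟨fun _ => c', h.symm, by simp, fun _ _ => rfl⟩
  | succ t ih =>
    obtain ⟨d, hd, h⟩ := h
    obtain ⟨f, h0, h1, h2⟩ := ih h
    refine ⟨fun i => match i with | 0 => c | i + 1 => f i, rfl, ?_, ?_⟩
    · rintro (_ | i) hi
      · simpa [h0] using hd
      · exact h1 i (by omega)
    · rintro (_ | i) hi
      · omega
      · exact h2 i (by omega)

/-- One row installs the head, `t` rows carry out the steps, the following ones repeat the accepting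
description, and the last one leads to `fin`; this needs `t + 2` rows. The head stays within
distance `t < k` of cell `0`, that is, inside the margins. -/
lemma AcceptsIn.exists_diagram {w : List A} {t k : ℕ} (h : M.AcceptsIn w t) (hk : t + 2 ≤ k) :
    ∃ h v, M.Diagram w k h v := by
  obtain ⟨c, hr, hacc⟩ := h
  obtain ⟨f, h0, hstep, hf⟩ := ReachesIn.exists_fun hr
  have habs : ∀ i, |(f i).head| ≤ t := by
    have h1 : ∀ i ≤ t, |(f i).head| ≤ i := by
      intro i
      induction i with
      | zero => intro _; simp [h0, init]
      | succ i ih =>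
        intro hi
        have := Step.abs_head_le (hstep i (by omega))
        have := ih (by omega)
        push_cast
        omega
    intro i
    rcases le_total i t with hi | hi
    · exact (h1 i hi).trans (by exact_mod_cast hi)
    · rw [hf i hi, ← hf t le_rfl]
      exact h1 t le_rfl
  have hwin : ∀ i, -(k + 1 : ℤ) ≤ (f i).head ∧ (f i).head < w.length + k := fun i => by
    have := abs_le.1 (habs i)
    omega
  have hrow : ∀ i < k, ∃ v : ℤ → M.Colour, v (-(k + 1 : ℤ)) = .bef ∧ v (w.length + k) = .aft ∧
      ∀ z, M.Rule (if i = 0 then M.firstLine w z else (f (i - 1)).line z)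
        (if i + 1 = k then .fin else (f i).line z) (v z) (v (z + 1)) := by
    intro i hi
    rcases Nat.eq_zero_or_pos i with rfl | hi0
    · obtain ⟨v, h1, h2, h3⟩ := exists_firstRow (M := M) w (a := -(k + 1 : ℤ))
        (b := w.length + k) (by omega) (by omega)
      refine ⟨v, h1, h2, fun z => ?_⟩
      rw [if_pos rfl, if_neg (by omega), h0]
      exact h3 z
    · obtain ⟨i, rfl⟩ : ∃ j, i = j + 1 := ⟨i - 1, by omega⟩
      rcases lt_or_ge i t with hit | hit
      · obtain ⟨v, h1, h2, h3⟩ := exists_row_of_step (hstep i hit) (hwin i).1 (hwin i).2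
          (hwin (i + 1)).1 (hwin (i + 1)).2
        refine ⟨v, h1, h2, fun z => ?_⟩
        rw [if_neg (by omega), if_neg (by omega)]
        exact h3 z
      · have hst : (f i).state = M.accept := by rw [hf i hit, hacc]
        obtain ⟨v, h1, h2, h3⟩ := exists_row_of_accept hst (hwin i).1 (hwin i).2
        refine ⟨v, h1, h2, fun z => ?_⟩
        rw [if_neg (by omega), hf (i + 1) (by omega), ← hf i hit]
        split_ifs
        exacts [(h3 z).2, (h3 z).1]
  choose! v hv1 hv2 hv3 using hrow
  -- Line `i` shows `f (i - 1)`, since line `0` precedes the initial description.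
  refine ⟨fun i z => if i = 0 then M.firstLine w z else if i = k then .fin else (f (i - 1)).line z,
    v, fun i hi z _ _ => ?_, fun z _ _ => rfl, fun z _ _ => ?_, hv1, hv2⟩
  · convert hv3 i hi z using 1
    · rw [if_neg hi.ne]
    · simp
  · rw [if_neg (by omega), if_pos rfl]

/-- Followed downwards, the lines show a computation for as long as no accepting state is met. One
must be met, because under a head in any other state the last line could not carry `fin`. -/
lemma Diagram.exists_acceptsIn {w : List A} {k : ℕ} (hk : 0 < k) {h v : ℕ → ℤ → M.Colour}
    (hD : M.Diagram w k h v) : ∃ t, M.AcceptsIn w t := by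
  set a : ℤ := -(k + 1 : ℤ) with ha
  set b : ℤ := w.length + k with hb
  have hfin : ∀ i, i + 1 < k → ∀ z, a ≤ z → z < b → h (i + 1) z ≠ .fin := fun i hi z h1 h2 =>
    (hD.rule (i + 1) hi z h1 h2).ne_fin
  -- Here `n` is the number of rows below line `i`.
  have key : ∀ n i, i + n = k → ∀ c : M.Cfg, a ≤ c.head → c.head < b → i < k →
      (∀ z, a ≤ z → z < b → h i z = c.line z) →
      ∃ t c', M.ReachesIn t c c' ∧ c'.state = M.accept := by
    intro n
    induction n with
    | zero => intro i hi c _ _ hik; omega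
    | succ n ih =>
      intro i hi c h1 h2 hik hc
      rcases exists_step_of_row (hD.left i hik) (hD.right i hik) (hD.rule i hik) h1 h2 hc with
        hacc | ⟨hne, hstep⟩
      · exact ⟨0, c, rfl, hacc⟩
      · have hik' : i + 1 < k := by
          rcases (by omega : i + 1 < k ∨ i + 1 = k) with h3 | h3
          · exact h3
          · exact absurd (h3 ▸ hD.last _ h1 h2) hne
        obtain ⟨c₁, hs, h3, h4, h5⟩ := hstep (hfin i hik')
        obtain ⟨t, c', ht, hacc⟩ := ih (i + 1) (by omega) c₁ h3 h4 hik' h5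
        exact ⟨t + 1, c', ⟨c₁, hs, ht⟩, hacc⟩
  have hfirst : ∀ z : ℤ, a ≤ z → z < b → z ≠ -1 → h 0 z = .cell ((M.init w).tape z) :=
    fun z h1 h2 h3 => by rw [hD.first z h1 h2, firstLine, if_neg h3]
  have hl := signal_left (hD.left 0 hk) (hD.rule 0 hk) (z := -1) (by omega) (by omega)
    fun y h3 h4 => ⟨_, hfirst y h3 (by omega) (by omega)⟩
  have hr := signal_right (hD.right 0 hk) (hD.rule 0 hk) (z := 0) (by omega) (by omega)
    fun y h3 h4 => ⟨_, hfirst y (by omega) h4 (by omega)⟩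
  have hp := hD.rule 0 hk (-1) (by omega) (by omega)
  rw [hD.first _ (by omega) (by omega), firstLine, if_pos rfl] at hp
  norm_num at hp
  generalize hd : h 1 (-1) = x at hp
  generalize hvl : v 0 (-1) = vl at hp hl
  generalize hvr : v 0 0 = vr at hp hr
  cases hp
  simp only [reduceCtorEq, false_and, exists_false, or_false, true_and, false_or,
      Colour.goRight.injEq] at hl hr
  obtain ⟨_, s, rfl, h5, h6, h7, h8⟩ := hr
  -- Below `pre` there is a blank cell and not `fin`, so the first row is not the last.
  have hk1 : 0 + 1 < k := by
    rcases (by omega : 0 + 1 < k ∨ k = 1) with h3 | h3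
    · exact h3
    · subst h3
      simp [hD.last _ (show a ≤ -1 by omega) (by omega)] at hd
  obtain ⟨t, c', ht, hacc⟩ := key (k - 1) 1 (by omega) (M.init w) (by simp [init]; omega)
    (by simp [init]; omega) hk1 fun z h3 h4 => by
    have hne := hfin 0 hk1 z h3 h4
    have h0 : (M.init w).head = 0 := rfl
    rcases (by omega : z < -1 ∨ z = -1 ∨ z = 0 ∨ 0 < z) with h | rfl | rfl | h
    · rw [(hl z h3 h).resolve_right hne, hfirst z h3 h4 h.ne]
      simp [Cfg.line, h0, show z ≠ 0 by omega]
    · rw [hd]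
      simp [Cfg.line, h0, show (M.init w).tape (-1) = M.blank from rfl]
    · rw [hfirst 0 h3 h4 (by omega)] at h6
      simp only [Colour.cell.injEq] at h6
      rw [h7]
      simp [Cfg.line, h0, h6]
      rfl
    · rw [(h8 z h h4).resolve_right hne, hfirst z h3 h4 (by omega)]
      simp [Cfg.line, h0, show z ≠ 0 by omega]
  exact ⟨t, c', ht, hacc⟩

end NTM

/-! ### Tiling instances that express acceptance. -/

/-- The bounded tiling instance with given lists of tiles, of pairs of colours at the two ends of
the columns, and of pairs of colours at the two ends of the rows. -/
def BoundedTiling.ofLists {c : ℕ} (T : List (Tile (Fin c))) (cols rows : List (Fin c × Fin c))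
    (hcols : 0 < cols.length) (hrows : 0 < rows.length) : BoundedTiling where
  colours := c
  height := rows.length
  width := cols.length
  height_pos := hrows
  width_pos := hcols
  tiles := T
  top j := (cols.get j).1
  bottom j := (cols.get j).2
  left i := (rows.get i).1
  right i := (rows.get i).2

lemma BoundedTiling.encode_ofLists {c : ℕ} (T : List (Tile (Fin c)))
    (cols rows : List (Fin c × Fin c)) (hcols : 0 < cols.length) (hrows : 0 < rows.length) :
    (BoundedTiling.ofLists T cols rows hcols hrows).encode = encodeNat c ++ T.flatMap encodeTile ++
      cols.flatMap (encodePair .column) ++ rows.flatMap (encodePair .row) := by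
  simp only [BoundedTiling.encode, BoundedTiling.ofLists, Prod.mk.eta]
  rw [List.ofFn_get, List.ofFn_get]

namespace NTM

variable {A : Type} (M : NTM A)

/-- The colours at the ends of the columns, for the diagrams of `M` on input `w` with margins of
width `k`. -/
def columns {Γ : Type} (e : M.Colour → Γ) (w : List A) (k : ℕ) : List (Γ × Γ) :=
  List.replicate k (e (.cell M.blank), e .fin) ++ (e .pre, e .fin) ::
    (w.map fun a => (e (.cell (M.letter a)), e .fin)) ++
    List.replicate k (e (.cell M.blank), e .fin)

lemma length_columns {Γ : Type} (e : M.Colour → Γ) (w : List A) (k : ℕ) :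
    (M.columns e w k).length = k + 1 + w.length + k := by
  simp [columns]; omega

/-- Column `j` stands for the tape cell `j - (k + 1)`; in particular the column of `pre`, behind `k`
blanks, is cell `-1`. -/
lemma getElem_columns {Γ : Type} (e : M.Colour → Γ) (w : List A) (k j : ℕ)
    (hj : j < (M.columns e w k).length) :
    (M.columns e w k)[j] = (e (M.firstLine w (j - (k + 1))), e .fin) := by
  have hj' := hj
  rw [length_columns] at hj'
  rcases (by omega : j < k ∨ j = k ∨ k < j) with h | rfl | h
  · have h1 : (j - (k + 1) : ℤ) = Int.negSucc (k - j) := by omega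
    simp only [columns, List.append_assoc]
    rw [List.getElem_append_left (by simpa using h), firstLine, if_neg (by omega), h1]
    simp [init]
  · simp [columns, firstLine]
  · obtain ⟨i, rfl⟩ : ∃ i, j = k + 1 + i := ⟨j - (k + 1), by omega⟩
    have h1 : ((k + 1 + i : ℕ) - (k + 1) : ℤ) = Int.ofNat i := by simp
    rw [h1, firstLine, if_neg (by simp)]
    simp only [columns, List.append_assoc, List.cons_append]
    rw [List.getElem_append_right (by simp; omega)]
    simp only [List.length_replicate, show k + 1 + i - k = i + 1 by omega, List.getElem_cons_succ]
    rcases lt_or_ge i w.length with hi | hi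
    · rw [List.getElem_append_left (by simpa using hi)]
      simp [init, hi]
    · rw [List.getElem_append_right (by simpa using hi)]
      simp [init, hi]

/-- The acceptance problem of a machine is expressed by bounded tiling instances whose encodings
are put together from fixed words, one word for each letter of the input. -/
theorem exists_boundedTiling : ∃ (W₀ Wb Wp Wr : List Letter) (g : A → List Letter),
    ∀ (w : List A) (k : ℕ), 0 < k → ∃ I : BoundedTiling,
      I.encode = W₀ ++ (List.replicate k Wb).flatten ++ Wp ++ w.flatMap g ++
        (List.replicate k Wb).flatten ++ (List.replicate k Wr).flatten ∧
      (I.Solvable → ∃ t, M.AcceptsIn w t) ∧ (∀ t, M.AcceptsIn w t → t + 2 ≤ k → I.Solvable) := by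
  classical
  obtain ⟨c, ⟨e⟩⟩ := Finite.exists_equiv_fin M.Colour
  have hfin : Set.Finite {t : Tile (Fin c) | M.Rule (e.symm t.u) (e.symm t.d) (e.symm t.l)
    (e.symm t.r)} := Set.toFinite _
  let T : List (Tile (Fin c)) := hfin.toFinset.toList
  have hT : ∀ u d l r, (⟨u, d, l, r⟩ : Tile (Fin c)) ∈ T.toFinset ↔
      M.Rule (e.symm u) (e.symm d) (e.symm l) (e.symm r) := fun u d l r => by simp [T]
  refine ⟨encodeNat c ++ T.flatMap encodeTile, encodePair .column (e (.cell M.blank), e .fin),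
    encodePair .column (e .pre, e .fin), encodePair .row (e .bef, e .aft),
    fun a => encodePair .column (e (.cell (M.letter a)), e .fin), fun w k hk => ?_⟩
  have hcols : 0 < (M.columns e w k).length := by rw [length_columns]; omega
  have hrows : 0 < (List.replicate k (e .bef, e .aft)).length := by simpa using hk
  refine ⟨.ofLists T (M.columns e w k) (List.replicate k (e .bef, e .aft)) hcols hrows, ?_, ?_, ?_⟩
  · rw [BoundedTiling.encode_ofLists]
    simp [columns, List.flatMap_replicate, List.flatMap_map]
  · rintro ⟨⟨h, v⟩, htile, htop, hbot, hleft, hright⟩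
    have hlen := M.length_columns e w k
    dsimp only [BoundedTiling.ofLists, BoundedTiling.tileSet] at h v htile htop hbot hleft hright
    have hlen' := List.length_replicate (n := k) (a := (e Colour.bef, e Colour.aft))
    -- Adding `k + 1` turns tape positions into column numbers; the value `fin` outside the window
    -- plays no role.
    refine Diagram.exists_acceptsIn hk
      (h := fun i z => if hij : i < (List.replicate k (e Colour.bef, e Colour.aft)).length + 1 ∧
        (z + (k + 1)).toNat < (M.columns e w k).length then e.symm (h ⟨i, hij.1⟩ ⟨_, hij.2⟩)
        else .fin)
      (v := fun i z => if hij : i < (List.replicate k (e Colour.bef, e Colour.aft)).length ∧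
        (z + (k + 1)).toNat < (M.columns e w k).length + 1 then e.symm (v ⟨i, hij.1⟩ ⟨_, hij.2⟩)
        else .fin) ⟨fun i hi z h1 h2 => ?_, fun z h1 h2 => ?_, fun z h1 h2 => ?_, fun i hi => ?_,
          fun i hi => ?_⟩
    · obtain ⟨j, rfl⟩ : ∃ j : ℕ, z = j - (k + 1) := ⟨(z + (k + 1)).toNat, by omega⟩
      have hj : j < (M.columns e w k).length := by omega
      have := (hT _ _ _ _).1 (htile ⟨i, by omega⟩ ⟨j, hj⟩)
      have e1 : ((j : ℤ) - (k + 1) + (k + 1)).toNat = j := by omega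
      have e2 : ((j : ℤ) - (k + 1) + 1 + (k + 1)).toNat = j + 1 := by omega
      simp only [e1, e2]
      rw [dif_pos ⟨by omega, hj⟩, dif_pos ⟨by omega, hj⟩, dif_pos ⟨by omega, by omega⟩,
        dif_pos ⟨by omega, by omega⟩]
      exact this
    · obtain ⟨j, rfl⟩ : ∃ j : ℕ, z = j - (k + 1) := ⟨(z + (k + 1)).toNat, by omega⟩
      have hj : j < (M.columns e w k).length := by omega
      have := htop ⟨j, hj⟩
      have e1 : ((j : ℤ) - (k + 1) + (k + 1)).toNat = j := by omega
      simp only [e1]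
      rw [dif_pos ⟨by omega, hj⟩]
      refine (congrArg e.symm this).trans ?_
      simp only [List.get_eq_getElem, getElem_columns, Equiv.symm_apply_apply]
    · obtain ⟨j, rfl⟩ : ∃ j : ℕ, z = j - (k + 1) := ⟨(z + (k + 1)).toNat, by omega⟩
      have hj : j < (M.columns e w k).length := by omega
      have := hbot ⟨j, hj⟩
      have e1 : ((j : ℤ) - (k + 1) + (k + 1)).toNat = j := by omega
      simp only [e1]
      rw [dif_pos ⟨by omega, hj⟩]
      simp only [List.get_eq_getElem, getElem_columns] at this
      rw [← e.symm_apply_apply Colour.fin, ← this]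
      congr 2
      exact Fin.ext hlen'.symm
    · have := hleft ⟨i, by omega⟩
      have e1 : (-(k + 1 : ℤ) + (k + 1)).toNat = 0 := by omega
      simp only [e1]
      rw [dif_pos ⟨by omega, by omega⟩]
      refine (congrArg e.symm this).trans ?_
      simp
    · have := hright ⟨i, by omega⟩
      have e1 : ((w.length + k : ℤ) + (k + 1)).toNat = (M.columns e w k).length := by omega
      simp only [e1]
      rw [dif_pos ⟨by omega, by omega⟩]
      refine (congrArg e.symm this).trans ?_
      simp
  · intro t ht htk
    obtain ⟨h, v, hD⟩ := ht.exists_diagram htk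
    have hlen := M.length_columns e w k
    have hlen' := List.length_replicate (n := k) (a := (e Colour.bef, e Colour.aft))
    refine ⟨⟨fun i j => e (h i (j - (k + 1))), fun i j => e (v i (j - (k + 1)))⟩, ?_⟩
    dsimp only [BoundedTiling.ofLists, BoundedTiling.IsValid, BoundedTiling.tileSet]
    refine ⟨fun i j => ?_, fun j => ?_, fun j => ?_, fun i => ?_, fun i => ?_⟩
    · rw [hT]
      have hi := i.2
      have hj := j.2
      have := hD.rule i (by omega) (j - (k + 1)) (by omega) (by omega)
      simp only [Equiv.symm_apply_apply]
      rw [show ((j : ℕ) - (k + 1) + 1 : ℤ) = ((j + 1 : ℕ) : ℤ) - (k + 1) by push_cast; ring] at this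
      exact this
    · have hj := j.2
      rw [List.get_eq_getElem, getElem_columns]
      exact congrArg e (hD.first _ (by omega) (by omega))
    · have hj := j.2
      rw [List.get_eq_getElem, getElem_columns]
      simp only [Fin.val_last, hlen']
      exact congrArg e (hD.last _ (by omega) (by omega))
    · have hi := i.2
      rw [List.get_eq_getElem, List.getElem_replicate]
      refine congrArg e ?_
      convert hD.left i (by omega) using 2
      simp
    · have hi := i.2
      rw [List.get_eq_getElem, List.getElem_replicate]
      refine congrArg e ?_
      convert hD.right i (by omega) using 2
      simp only [Fin.val_last, hlen]
      push_cast
      ring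

end NTM

/-! ### A polynomial-time stack machine that writes the instances. -/

namespace TilingWriter

/-- The stacks of the machine that writes down tiling instances: the input, its reversal, the
output, and four counters. -/
inductive Stk
  | inp
  | rev
  | out
  | len
  | len'
  | acc
  | acc'
  deriving DecidableEq

instance : Fintype Stk where
  elems := {.inp, .rev, .out, .len, .len', .acc, .acc'}
  complete x := by cases x <;> simp

/-- The stack alphabets. -/
abbrev Alph (A : Type) : Stk → Type
  | .inp => A
  | .rev => Option A
  | .out => Letter
  | .len | .len' | .acc | .acc' => Unit

/-- The labels: reading the input, multiplying the counter `acc` by `len` a number of times, and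
writing the parts of the output from the last to the first. -/
inductive Label (d : ℕ)
  | read
  | load (i : Fin (d + 1))
  | add (i : Fin (d + 1))
  | restore (i : Fin (d + 1))
  | store (i : Fin (d + 1))
  | clear
  | rows
  | padRight
  | letters
  | padLeft

instance (d : ℕ) : Finite (Label d) := by
  let f : Fin 6 ⊕ (Fin 4 × Fin (d + 1)) → Label d
    | .inl 0 => .read
    | .inl 1 => .clear
    | .inl 2 => .rows
    | .inl 3 => .padRight
    | .inl 4 => .letters
    | .inl 5 => .padLeft
    | .inr (0, i) => .load i
    | .inr (1, i) => .add i
    | .inr (2, i) => .restore i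
    | .inr (3, i) => .store i
  refine Finite.of_surjective f ?_
  rintro (_ | i | i | i | i | _ | _ | _ | _ | _)
  exacts [⟨.inl 0, rfl⟩, ⟨.inr (0, i), rfl⟩, ⟨.inr (1, i), rfl⟩, ⟨.inr (2, i), rfl⟩,
    ⟨.inr (3, i), rfl⟩, ⟨.inl 1, rfl⟩, ⟨.inl 2, rfl⟩, ⟨.inl 3, rfl⟩, ⟨.inl 4, rfl⟩, ⟨.inl 5, rfl⟩]

/-- The last symbol that was popped, if there was one: a letter, or `none` from a counter. -/
abbrev Reg (A : Type) : Type := Option (Option A)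

variable {A : Type} {d : ℕ}

/-- The statements of the machine. -/
abbrev Code (A : Type) (d : ℕ) : Type := Turing.TM2.Stmt (Alph A) (Label d) (Reg A)

/-- Writes the first `m` letters of the word `W v`, where `v` is the content of the register. -/
def write (W : Reg A → List Letter) : ℕ → Code A d → Code A d
  | 0, q => q
  | m + 1, q => .branch (fun v => decide (m < (W v).length))
      (.push .out (fun v => (W v).getD m .one) (write W m q)) (write W m q)

/-- Puts the letter in the register on the stack `rev`. -/
def keep (q : Code A d) : Code A d := .push .rev Option.join q

/-- Increases the counter `len`. -/
def incLen (q : Code A d) : Code A d := .push .len (fun _ => ()) q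

/-- Increases the counter `len'`. -/
def incLen' (q : Code A d) : Code A d := .push .len' (fun _ => ()) q

/-- Increases the counter `acc`. -/
def incAcc (q : Code A d) : Code A d := .push .acc (fun _ => ()) q

/-- Increases the counter `acc'`. -/
def incAcc' (q : Code A d) : Code A d := .push .acc' (fun _ => ()) q

/-- Adds `c` to the counter `acc`. -/
def addConst : ℕ → Code A d → Code A d
  | 0, q => q
  | c + 1, q => incAcc (addConst c q)

/-- Pops a symbol from stack `k` and branches on whether there was one. -/
def popThen (k : Stk) (f : Alph A k → Option A) (q₁ q₂ : Code A d) : Code A d :=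
  .pop k (fun _ x => x.map f) (.branch Option.isSome q₁ q₂)

/-- Goes to a fixed label. -/
def jump (l : Label d) : Code A d := .goto fun _ => l

/-- The stacks with given contents. -/
def stk (inp : List A) (rev : List (Option A)) (out : List Letter) (n n' y z : ℕ) :
    ∀ k, List (Alph A k)
  | .inp => inp
  | .rev => rev
  | .out => out
  | .len => List.replicate n ()
  | .len' => List.replicate n' ()
  | .acc => List.replicate y ()
  | .acc' => List.replicate z ()

section Effects

open Turing.TM2 Function

variable (inp : List A) (rev : List (Option A)) (out : List Letter) (n n' y z : ℕ)

lemma update_inp (l : List A) :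
    update (stk inp rev out n n' y z) .inp l = stk l rev out n n' y z := by
  funext k; cases k <;> rfl

lemma update_rev (l : List (Option A)) :
    update (stk inp rev out n n' y z) .rev l = stk inp l out n n' y z := by
  funext k; cases k <;> rfl

lemma update_out (l : List Letter) :
    update (stk inp rev out n n' y z) .out l = stk inp rev l n n' y z := by
  funext k; cases k <;> rfl

lemma update_len (m : ℕ) :
    update (stk inp rev out n n' y z) .len (List.replicate m ()) = stk inp rev out m n' y z := by
  funext k; cases k <;> rfl

lemma update_len' (m : ℕ) :
    update (stk inp rev out n n' y z) .len' (List.replicate m ()) = stk inp rev out n m y z := by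
  funext k; cases k <;> rfl

lemma update_acc (m : ℕ) :
    update (stk inp rev out n n' y z) .acc (List.replicate m ()) = stk inp rev out n n' m z := by
  funext k; cases k <;> rfl

lemma update_acc' (m : ℕ) :
    update (stk inp rev out n n' y z) .acc' (List.replicate m ()) = stk inp rev out n n' y m := by
  funext k; cases k <;> rfl

variable (v : Reg A) (q q₁ q₂ : Code A d)

@[simp] lemma stepAux_incLen : stepAux (incLen q) v (stk inp rev out n n' y z) =
    stepAux q v (stk inp rev out (n + 1) n' y z) :=
  congrArg (stepAux q v) (update_len inp rev out n n' y z (n + 1))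

@[simp] lemma stepAux_popThen_len_zero (f : Alph A .len → Option A) :
    stepAux (popThen .len f q₁ q₂) v (stk inp rev out 0 n' y z) =
      stepAux q₂ none (stk inp rev out 0 n' y z) :=
  congrArg (stepAux q₂ none) (update_len inp rev out 0 n' y z 0)

@[simp] lemma stepAux_popThen_len_succ (f : Alph A .len → Option A) :
    stepAux (popThen .len f q₁ q₂) v (stk inp rev out (n + 1) n' y z) =
      stepAux q₁ (some (f ())) (stk inp rev out n n' y z) :=
  congrArg (stepAux q₁ _) (update_len inp rev out (n + 1) n' y z n)

@[simp] lemma stepAux_incLen' : stepAux (incLen' q) v (stk inp rev out n n' y z) =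
    stepAux q v (stk inp rev out n (n' + 1) y z) :=
  congrArg (stepAux q v) (update_len' inp rev out n n' y z (n' + 1))

@[simp] lemma stepAux_popThen_len'_zero (f : Alph A .len' → Option A) :
    stepAux (popThen .len' f q₁ q₂) v (stk inp rev out n 0 y z) =
      stepAux q₂ none (stk inp rev out n 0 y z) :=
  congrArg (stepAux q₂ none) (update_len' inp rev out n 0 y z 0)

@[simp] lemma stepAux_popThen_len'_succ (f : Alph A .len' → Option A) :
    stepAux (popThen .len' f q₁ q₂) v (stk inp rev out n (n' + 1) y z) =
      stepAux q₁ (some (f ())) (stk inp rev out n n' y z) :=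
  congrArg (stepAux q₁ _) (update_len' inp rev out n (n' + 1) y z n')

@[simp] lemma stepAux_incAcc : stepAux (incAcc q) v (stk inp rev out n n' y z) =
    stepAux q v (stk inp rev out n n' (y + 1) z) :=
  congrArg (stepAux q v) (update_acc inp rev out n n' y z (y + 1))

@[simp] lemma stepAux_popThen_acc_zero (f : Alph A .acc → Option A) :
    stepAux (popThen .acc f q₁ q₂) v (stk inp rev out n n' 0 z) =
      stepAux q₂ none (stk inp rev out n n' 0 z) :=
  congrArg (stepAux q₂ none) (update_acc inp rev out n n' 0 z 0)

@[simp] lemma stepAux_popThen_acc_succ (f : Alph A .acc → Option A) :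
    stepAux (popThen .acc f q₁ q₂) v (stk inp rev out n n' (y + 1) z) =
      stepAux q₁ (some (f ())) (stk inp rev out n n' y z) :=
  congrArg (stepAux q₁ _) (update_acc inp rev out n n' (y + 1) z y)

@[simp] lemma stepAux_incAcc' : stepAux (incAcc' q) v (stk inp rev out n n' y z) =
    stepAux q v (stk inp rev out n n' y (z + 1)) :=
  congrArg (stepAux q v) (update_acc' inp rev out n n' y z (z + 1))

@[simp] lemma stepAux_popThen_acc'_zero (f : Alph A .acc' → Option A) :
    stepAux (popThen .acc' f q₁ q₂) v (stk inp rev out n n' y 0) =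
      stepAux q₂ none (stk inp rev out n n' y 0) :=
  congrArg (stepAux q₂ none) (update_acc' inp rev out n n' y 0 0)

@[simp] lemma stepAux_popThen_acc'_succ (f : Alph A .acc' → Option A) :
    stepAux (popThen .acc' f q₁ q₂) v (stk inp rev out n n' y (z + 1)) =
      stepAux q₁ (some (f ())) (stk inp rev out n n' y z) :=
  congrArg (stepAux q₁ _) (update_acc' inp rev out n n' y (z + 1) z)

@[simp] lemma stepAux_popThen_inp_nil (f : Alph A .inp → Option A) :
    stepAux (popThen .inp f q₁ q₂) v (stk [] rev out n n' y z) =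
      stepAux q₂ none (stk [] rev out n n' y z) :=
  congrArg (stepAux q₂ none) (update_inp [] rev out n n' y z [])

@[simp] lemma stepAux_popThen_inp_cons (f : Alph A .inp → Option A) (a : A) :
    stepAux (popThen .inp f q₁ q₂) v (stk (a :: inp) rev out n n' y z) =
      stepAux q₁ (some (f a)) (stk inp rev out n n' y z) :=
  congrArg (stepAux q₁ _) (update_inp (a :: inp) rev out n n' y z inp)

@[simp] lemma stepAux_popThen_rev_nil (f : Alph A .rev → Option A) :
    stepAux (popThen .rev f q₁ q₂) v (stk inp [] out n n' y z) =
      stepAux q₂ none (stk inp [] out n n' y z) :=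
  congrArg (stepAux q₂ none) (update_rev inp [] out n n' y z [])

@[simp] lemma stepAux_popThen_rev_cons (f : Alph A .rev → Option A) (a : Option A) :
    stepAux (popThen .rev f q₁ q₂) v (stk inp (a :: rev) out n n' y z) =
      stepAux q₁ (some (f a)) (stk inp rev out n n' y z) :=
  congrArg (stepAux q₁ _) (update_rev inp (a :: rev) out n n' y z rev)

-- The letters of `rev` lie in `Option A` so that joining the register always yields one, without a
-- default element of `A`.
@[simp] lemma stepAux_keep : stepAux (keep q) v (stk inp rev out n n' y z) =
    stepAux q v (stk inp (v.join :: rev) out n n' y z) :=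
  congrArg (stepAux q v) (update_rev inp rev out n n' y z (v.join :: rev))

@[simp] lemma stepAux_jump (l : Label d) (S : ∀ k, List (Alph A k)) :
    stepAux (jump l) v S = ⟨some l, v, S⟩ := rfl

-- The shape of a statement cannot depend on the register. So there is one test for each position
-- below a common bound `m`, and pushing from the last letter to the first leaves the word in the
-- right order.
@[simp] lemma stepAux_write (W : Reg A → List Letter) (m : ℕ) :
    stepAux (write W m q) v (stk inp rev out n n' y z) =
      stepAux q v (stk inp rev ((W v).take m ++ out) n n' y z) := by
  induction m generalizing out with
  | zero => rfl
  | succ m ih =>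
    have h : stepAux (write W (m + 1) q) v (stk inp rev out n n' y z) =
        cond (decide (m < (W v).length))
          (stepAux (write W m q) v
            (update (stk inp rev out n n' y z) .out ((W v).getD m .one :: out)))
          (stepAux (write W m q) v (stk inp rev out n n' y z)) := rfl
    rw [h, update_out, ih, ih]
    rcases lt_or_ge m (W v).length with h | h
    · rw [decide_eq_true h, cond_true, List.getD_eq_getElem _ _ h, List.take_succ_eq_append_getElem h,
        List.append_assoc, List.singleton_append]
    · simp [h.not_gt, List.take_of_length_le h, List.take_of_length_le (Nat.le_succ_of_le h)]

@[simp] lemma stepAux_addConst (c : ℕ) :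
    stepAux (addConst c q) v (stk inp rev out n n' y z) =
      stepAux q v (stk inp rev out n n' (y + c) z) := by
  induction c generalizing y with
  | zero => rfl
  | succ c ih => rw [addConst, stepAux_incAcc, ih, add_assoc, add_comm 1 c]

end Effects

/-- The program. -/
def program (W₀ Wb Wp Wr : List Letter) (g : A → List Letter) (c m : ℕ) : Label d → Code A d
  | .read => popThen .inp some
      (keep (incLen (jump .read)))
      (incLen (addConst c (jump (.load 0))))
  | .load i => popThen .acc (fun _ => none) (jump (.add i)) (jump (.store i))
  | .add i => popThen .len (fun _ => none)
      (incLen' (incAcc' (jump (.add i)))) (jump (.restore i))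
  | .restore i => popThen .len' (fun _ => none)
      (incLen (jump (.restore i))) (jump (.load i))
  | .store i => popThen .acc' (fun _ => none)
      (incAcc (jump (.store i)))
      (jump (if h : i.val < d then .load ⟨i + 1, by omega⟩ else .clear))
  | .clear => popThen .len (fun _ => none) (jump .clear) (jump .rows)
  | .rows => popThen .acc (fun _ => none)
      (incAcc' (write (fun _ => Wr) m (jump .rows))) (jump .padRight)
  | .padRight => popThen .acc' (fun _ => none)
      (incAcc (write (fun _ => Wb) m (jump .padRight))) (jump .letters)
  | .letters => popThen .rev id
      (write (fun v => (Option.join v).elim [] g) m (jump .letters))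
      (write (fun _ => Wp) m (jump .padLeft))
  | .padLeft => popThen .acc (fun _ => none)
      (write (fun _ => Wb) m (jump .padLeft)) (write (fun _ => W₀) m .halt)

/-- The machine gets from `c` to `c'` in at most `t` steps. -/
def RunsWithin {K Λ σ : Type} [DecidableEq K] {Γ : K → Type} (M : Λ → Turing.TM2.Stmt Γ Λ σ)
    (t : ℕ) (c c' : Turing.TM2.Cfg Γ Λ σ) : Prop :=
  ∃ s ≤ t, (flip bind (Turing.TM2.step M))^[s] (some c) = some c'

section Runs

variable {K Λ σ : Type} [DecidableEq K] {Γ : K → Type} {M : Λ → Turing.TM2.Stmt Γ Λ σ}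

lemma RunsWithin.trans {s t : ℕ} {c₁ c₂ c₃ : Turing.TM2.Cfg Γ Λ σ} (h₁ : RunsWithin M s c₁ c₂)
    (h₂ : RunsWithin M t c₂ c₃) : RunsWithin M (s + t) c₁ c₃ := by
  obtain ⟨s', hs, h₁⟩ := h₁
  obtain ⟨t', ht, h₂⟩ := h₂
  exact ⟨t' + s', by omega, by rw [Function.iterate_add_apply, h₁, h₂]⟩

lemma RunsWithin.mono {s t : ℕ} {c c' : Turing.TM2.Cfg Γ Λ σ} (h : RunsWithin M s c c')
    (hst : s ≤ t) : RunsWithin M t c c' := by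
  obtain ⟨s', hs, h⟩ := h
  exact ⟨s', hs.trans hst, h⟩

lemma RunsWithin.of_stepAux {l : Λ} {v : σ} {S : ∀ k, List (Γ k)} {c : Turing.TM2.Cfg Γ Λ σ}
    (h : Turing.TM2.stepAux (M l) v S = c) : RunsWithin M 1 ⟨some l, v, S⟩ c :=
  ⟨1, le_rfl, congrArg some h⟩

end Runs

section Phases

variable (W₀ Wb Wp Wr : List Letter) (g : A → List Letter) (c m : ℕ)
  (inp : List A) (rev : List (Option A)) (out : List Letter) (n n' y z : ℕ)

lemma runs_read (v : Reg A) : RunsWithin (program (d := d) W₀ Wb Wp Wr g c m) (inp.length + 1)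
    ⟨some .read, v, stk inp rev out n n' y z⟩
    ⟨some (.load 0), none, stk [] ((inp.map some).reverse ++ rev) out (n + inp.length + 1) n'
      (y + c) z⟩ := by
  induction inp generalizing rev n v with
  | nil => exact .of_stepAux (by simp [program])
  | cons a inp ih =>
    have h := RunsWithin.of_stepAux (M := (program (d := d) W₀ Wb Wp Wr g c m)) (l := .read) (v := v)
      (S := stk (a :: inp) rev out n n' y z)
      (c := ⟨some .read, some (some a), stk inp (some a :: rev) out (n + 1) n' y z⟩)
      (by simp [program])
    have := (h.trans (ih (some a :: rev) (n + 1) (some (some a)))).mono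
      (t := (a :: inp).length + 1) (by simp; omega)
    convert this using 3
    · simp
    · simp only [List.length_cons]
      ring

lemma runs_add (i : Fin (d + 1)) (v : Reg A) : RunsWithin (program (d := d) W₀ Wb Wp Wr g c m) (n + 1)
    ⟨some (.add i), v, stk inp rev out n n' y z⟩
    ⟨some (.restore i), none, stk inp rev out 0 (n' + n) y (z + n)⟩ := by
  induction n generalizing n' z v with
  | zero => exact .of_stepAux (by simp [program])
  | succ n ih =>
    have h := RunsWithin.of_stepAux (M := (program (d := d) W₀ Wb Wp Wr g c m)) (l := .add i) (v := v)
      (S := stk inp rev out (n + 1) n' y z)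
      (c := ⟨some (.add i), some none, stk inp rev out n (n' + 1) y (z + 1)⟩)
      (by simp [program])
    have := (h.trans (ih (n' + 1) (z + 1) (some none))).mono (t := n + 1 + 1) (by omega)
    convert this using 3 <;> ring

lemma runs_restore (i : Fin (d + 1)) (v : Reg A) : RunsWithin (program (d := d) W₀ Wb Wp Wr g c m) (n' + 1)
    ⟨some (.restore i), v, stk inp rev out n n' y z⟩
    ⟨some (.load i), none, stk inp rev out (n + n') 0 y z⟩ := by
  induction n' generalizing n v with
  | zero => exact .of_stepAux (by simp [program])
  | succ n' ih =>
    have h := RunsWithin.of_stepAux (M := (program (d := d) W₀ Wb Wp Wr g c m)) (l := .restore i) (v := v)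
      (S := stk inp rev out n (n' + 1) y z)
      (c := ⟨some (.restore i), some none, stk inp rev out (n + 1) n' y z⟩)
      (by simp [program])
    have := (h.trans (ih (n + 1) (some none))).mono (t := n' + 1 + 1) (by omega)
    convert this using 3; ring

/-- Multiplication by repeated addition: for each unit of `acc`, the counter `len` is emptied into
`len'` while it is added to `acc'`, and is then restored. This takes `1 + (n + 1) + (n + 1)` steps
per unit. -/
lemma runs_load (i : Fin (d + 1)) (v : Reg A) : RunsWithin (program (d := d) W₀ Wb Wp Wr g c m) (y * (2 * n + 3) + 1)
    ⟨some (.load i), v, stk inp rev out n 0 y z⟩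
    ⟨some (.store i), none, stk inp rev out n 0 0 (z + y * n)⟩ := by
  induction y generalizing z v with
  | zero => exact (RunsWithin.of_stepAux (by simp [program])).mono (by omega)
  | succ y ih =>
    have h := RunsWithin.of_stepAux (M := (program (d := d) W₀ Wb Wp Wr g c m)) (l := .load i) (v := v)
      (S := stk inp rev out n 0 (y + 1) z)
      (c := ⟨some (.add i), some none, stk inp rev out n 0 y z⟩)
      (by simp [program])
    have h1 := h.trans (runs_add W₀ Wb Wp Wr g c m inp rev out n 0 y z i (some none))
    have h2 := h1.trans (runs_restore W₀ Wb Wp Wr g c m inp rev out 0 (0 + n) y (z + n) i none)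
    simp only [zero_add] at h2
    have := (h2.trans (ih (z + n) none)).mono (t := (y + 1) * (2 * n + 3) + 1) (by linarith)
    convert this using 3; ring

lemma runs_store (i : Fin (d + 1)) (v : Reg A) : RunsWithin (program (d := d) W₀ Wb Wp Wr g c m) (z + 1)
    ⟨some (.store i), v, stk inp rev out n n' y z⟩
    ⟨some (if h : i.val < d then .load ⟨i + 1, by omega⟩ else .clear), none,
      stk inp rev out n n' (y + z) 0⟩ := by
  induction z generalizing y v with
  | zero => exact .of_stepAux (by simp [program])
  | succ z ih =>
    have h := RunsWithin.of_stepAux (M := (program (d := d) W₀ Wb Wp Wr g c m)) (l := .store i) (v := v)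
      (S := stk inp rev out n n' y (z + 1))
      (c := ⟨some (.store i), some none, stk inp rev out n n' (y + 1) z⟩)
      (by simp [program])
    have := (h.trans (ih (y + 1) (some none))).mono (t := z + 1 + 1) (by omega)
    convert this using 3; ring

/-- From label `d - j` there are `j + 1` rounds to go, each multiplying `acc` by `n`. A round that
starts with the value `y` costs `y * (2 * n + 3) + 1` and `y * n + 1` steps; as `n > 0`, no value
exceeds the final one. -/
lemma runs_multiply (j : ℕ) (hj : j ≤ d) (hn : 0 < n) (v : Reg A) :
    RunsWithin (program (d := d) W₀ Wb Wp Wr g c m) ((j + 1) * (y * n ^ (j + 1) * (3 * n + 3) + 2))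
    ⟨some (.load ⟨d - j, by omega⟩), v, stk inp rev out n 0 y 0⟩
    ⟨some .clear, none, stk inp rev out n 0 (y * n ^ (j + 1)) 0⟩ := by
  induction j generalizing y v with
  | zero =>
    have h1 := runs_load W₀ Wb Wp Wr g c m inp rev out n y 0 (⟨d - 0, by omega⟩ : Fin (d + 1)) v
    have h2 := h1.trans (runs_store W₀ Wb Wp Wr g c m inp rev out n 0 0 (0 + y * n) _ none)
    simp only [Nat.sub_zero, lt_irrefl, dite_false, zero_add, pow_one] at h2 ⊢
    refine h2.mono ?_
    have : y ≤ y * n := Nat.le_mul_of_pos_right y hn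
    nlinarith
  | succ j ih =>
    have h1 := runs_load W₀ Wb Wp Wr g c m inp rev out n y 0
      (⟨d - (j + 1), by omega⟩ : Fin (d + 1)) v
    have h2 := h1.trans (runs_store W₀ Wb Wp Wr g c m inp rev out n 0 0 (0 + y * n) _ none)
    have h3 : d - (j + 1) + 1 = d - j := by omega
    rw [dif_pos (show d - (j + 1) < d by omega)] at h2
    simp only [h3, zero_add] at h2
    have h4 := h2.trans (ih (y * n) (by omega) none)
    have h5 : y * n * n ^ (j + 1) = y * n ^ (j + 1 + 1) := by ring
    rw [h5] at h4
    refine h4.mono ?_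
    have h6 : y ≤ y * n ^ (j + 1 + 1) := Nat.le_mul_of_pos_right y (by positivity)
    have h7 : y * n ≤ y * n ^ (j + 1 + 1) :=
      Nat.mul_le_mul_left y (Nat.le_self_pow (by omega) n)
    nlinarith

/-- A halting configuration in the sense of `Turing.haltList` has all stacks except the output
empty, so `len` must be removed. -/
lemma runs_clear (v : Reg A) : RunsWithin (program (d := d) W₀ Wb Wp Wr g c m) (n + 1)
    ⟨some .clear, v, stk inp rev out n n' y z⟩
    ⟨some .rows, none, stk inp rev out 0 n' y z⟩ := by
  induction n generalizing v with
  | zero => exact .of_stepAux (by simp [program])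
  | succ n ih =>
    have h := RunsWithin.of_stepAux (M := (program (d := d) W₀ Wb Wp Wr g c m)) (l := .clear) (v := v)
      (S := stk inp rev out (n + 1) n' y z)
      (c := ⟨some .clear, some none, stk inp rev out n n' y z⟩)
      (by simp [program])
    exact (h.trans (ih (some none))).mono (t := n + 1 + 1) (by omega)

variable {m}

lemma flatten_replicate_append (k : ℕ) (W : List Letter) :
    (List.replicate k W).flatten ++ (W ++ out) = (List.replicate (k + 1) W).flatten ++ out := by
  rw [List.replicate_succ']
  simp

/-- The output is a stack, so its last part is written first. The count consumed on `acc` is rebuilt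
on `acc'`; `padRight` brings it back for `padLeft`, and all three write the same number of copies.
-/
lemma runs_rows (hm : Wr.length ≤ m) (v : Reg A) : RunsWithin (program (d := d) W₀ Wb Wp Wr g c m) (y + 1)
    ⟨some .rows, v, stk inp rev out n n' y z⟩
    ⟨some .padRight, none,
      stk inp rev ((List.replicate y Wr).flatten ++ out) n n' 0 (z + y)⟩ := by
  induction y generalizing z out v with
  | zero => exact .of_stepAux (by simp [program])
  | succ y ih =>
    have h := RunsWithin.of_stepAux (M := (program (d := d) W₀ Wb Wp Wr g c m)) (l := .rows) (v := v)
      (S := stk inp rev out n n' (y + 1) z)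
      (c := ⟨some .rows, some none, stk inp rev (Wr ++ out) n n' y (z + 1)⟩)
      (by simp [program, List.take_of_length_le hm])
    have := (h.trans (ih (Wr ++ out) (z + 1) (some none))).mono (t := y + 1 + 1) (by omega)
    rw [flatten_replicate_append] at this
    convert this using 3; ring

lemma runs_padRight (hm : Wb.length ≤ m) (v : Reg A) : RunsWithin (program (d := d) W₀ Wb Wp Wr g c m) (z + 1)
    ⟨some .padRight, v, stk inp rev out n n' y z⟩
    ⟨some .letters, none,
      stk inp rev ((List.replicate z Wb).flatten ++ out) n n' (y + z) 0⟩ := by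
  induction z generalizing y out v with
  | zero => exact .of_stepAux (by simp [program])
  | succ z ih =>
    have h := RunsWithin.of_stepAux (M := (program (d := d) W₀ Wb Wp Wr g c m)) (l := .padRight) (v := v)
      (S := stk inp rev out n n' y (z + 1))
      (c := ⟨some .padRight, some none, stk inp rev (Wb ++ out) n n' (y + 1) z⟩)
      (by simp [program, List.take_of_length_le hm])
    have := (h.trans (ih (Wb ++ out) (y + 1) (some none))).mono (t := z + 1 + 1) (by omega)
    rw [flatten_replicate_append] at this
    convert this using 3; ring

/-- Reading has left the last input letter on top of `rev`, which is the order needed for writing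
backwards. -/
lemma runs_letters (hm : ∀ a, (g a).length ≤ m) (hp : Wp.length ≤ m) (w : List A) (v : Reg A) :
    RunsWithin (program (d := d) W₀ Wb Wp Wr g c m) (w.length + 1)
    ⟨some .letters, v, stk inp (w.map some) out n n' y z⟩
    ⟨some .padLeft, none, stk inp [] (Wp ++ w.reverse.flatMap g ++ out) n n' y z⟩ := by
  induction w generalizing out v with
  | nil => exact .of_stepAux (by simp [program, List.take_of_length_le hp])
  | cons a w ih =>
    have h := RunsWithin.of_stepAux (M := (program (d := d) W₀ Wb Wp Wr g c m)) (l := .letters) (v := v)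
      (S := stk inp ((a :: w).map some) out n n' y z)
      (c := ⟨some .letters, some (some a), stk inp (w.map some) (g a ++ out) n n' y z⟩)
      (by simp [program, List.take_of_length_le (hm a)])
    have := (h.trans (ih (g a ++ out) (some (some a)))).mono (t := (a :: w).length + 1)
      (by simp; omega)
    convert this using 3
    simp

lemma runs_padLeft (hm : Wb.length ≤ m) (h0 : W₀.length ≤ m) (v : Reg A) : RunsWithin (program (d := d) W₀ Wb Wp Wr g c m) (y + 1)
    ⟨some .padLeft, v, stk inp rev out n n' y z⟩
    ⟨none, none,
      stk inp rev (W₀ ++ (List.replicate y Wb).flatten ++ out) n n' 0 z⟩ := by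
  induction y generalizing out v with
  | zero => exact .of_stepAux (by simp [program, List.take_of_length_le h0])
  | succ y ih =>
    have h := RunsWithin.of_stepAux (M := (program (d := d) W₀ Wb Wp Wr g c m)) (l := .padLeft) (v := v)
      (S := stk inp rev out n n' (y + 1) z)
      (c := ⟨some .padLeft, some none, stk inp rev (Wb ++ out) n n' y z⟩)
      (by simp [program, List.take_of_length_le hm])
    have := (h.trans (ih (Wb ++ out) (some none))).mono (t := y + 1 + 1) (by omega)
    rwa [List.append_assoc, flatten_replicate_append, ← List.append_assoc] at this

lemma runs_program (hg : ∀ a, (g a).length ≤ m) (h0 : W₀.length ≤ m) (hb : Wb.length ≤ m)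
    (hp : Wp.length ≤ m) (hr : Wr.length ≤ m) (w : List A) (N P : ℕ) (hN : N = w.length + 1)
    (hP : P = c * N ^ (d + 1)) :
    RunsWithin (program (d := d) W₀ Wb Wp Wr g c m) ((d + 1) * (P * (3 * N + 3) + 2) + 3 * N + 3 * P + 4)
    ⟨some .read, none, stk w [] [] 0 0 0 0⟩
    ⟨none, none, stk [] [] (W₀ ++ (List.replicate P Wb).flatten ++ Wp ++ w.flatMap g ++
        (List.replicate P Wb).flatten ++ (List.replicate P Wr).flatten) 0 0 0 0⟩ := by
  have h1 := runs_read (d := d) W₀ Wb Wp Wr g c m w [] [] 0 0 0 0 none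
  simp only [List.append_nil, zero_add, ← hN] at h1
  have h2 := runs_multiply (d := d) W₀ Wb Wp Wr g c m [] (w.map some).reverse [] N c d le_rfl
    (by omega) none
  simp only [Nat.sub_self, ← hP] at h2
  have h3 := runs_clear (d := d) W₀ Wb Wp Wr g c m [] (w.map some).reverse [] N 0 P 0 none
  have h4 := runs_rows (d := d) W₀ Wb Wp Wr g c [] (w.map some).reverse [] 0 0 P 0 hr none
  have h5 := runs_padRight (d := d) W₀ Wb Wp Wr g c [] (w.map some).reverse
    ((List.replicate P Wr).flatten ++ []) 0 0 0 (0 + P) hb none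
  have h6 := runs_letters (d := d) W₀ Wb Wp Wr g c []
    ((List.replicate P Wb).flatten ++ ((List.replicate P Wr).flatten ++ [])) 0 0 P 0 hg hp
    w.reverse none
  have h7 := runs_padLeft (d := d) W₀ Wb Wp Wr g c [] []
    (Wp ++ w.flatMap g ++ ((List.replicate P Wb).flatten ++
      ((List.replicate P Wr).flatten ++ []))) 0 0 P 0 hb h0 none
  simp only [List.reverse_reverse, List.map_reverse, zero_add] at h2 h3 h4 h5 h6 h7 h1
  have := (((((h1.trans h2).trans h3).trans h4).trans h5).trans h6).trans h7
  have h := this.mono (t := (d + 1) * (P * (3 * N + 3) + 2) + 3 * N + 3 * P + 4)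
    (by simp only [List.length_reverse]; omega)
  simpa only [List.append_nil, List.append_assoc] using h

end Phases

end TilingWriter

open TilingWriter in
/-- A map whose values are written as words of the shape shown in the hypothesis, with a number of
repetitions that is given by a power of the length of the input, is polynomial-time computable. -/
theorem nonempty_tm2ComputableInPolyTime {A X : Type} [Finite A] {enc : X → List Letter}
    {f : List A → X} (W₀ Wb Wp Wr : List Letter) (g : A → List Letter) (c d : ℕ)
    (hf : ∀ w, enc (f w) = W₀ ++ (List.replicate (c * (w.length + 1) ^ (d + 1)) Wb).flatten ++ Wp ++
      w.flatMap g ++ (List.replicate (c * (w.length + 1) ^ (d + 1)) Wb).flatten ++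
      (List.replicate (c * (w.length + 1) ^ (d + 1)) Wr).flatten) :
    Nonempty (Turing.TM2ComputableInPolyTime (id : List A → List A) enc f) := by
  have := Fintype.ofFinite A
  have := Fintype.ofFinite (Label d)
  -- A bound for the lengths of all words that are written; the supremum exists because the alphabet
  -- is finite.
  let m := Finset.univ.sup (fun a => (g a).length) + W₀.length + Wb.length + Wp.length + Wr.length
  have hg : ∀ a, (g a).length ≤ m := fun a => by
    have := Finset.le_sup (f := fun a => (g a).length) (Finset.mem_univ a)
    simp only [m]
    omega
  let tm : Turing.FinTM2 :=
    { K := Stk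
      k₀ := .inp
      k₁ := .out
      Γ := Alph A
      Λ := Label d
      main := .read
      σ := Reg A
      initialState := none
      Γk₀Fin := inferInstanceAs (Fintype A)
      m := program W₀ Wb Wp Wr g c m }
  let N : Polynomial ℕ := Polynomial.X + 1
  let P : Polynomial ℕ := Polynomial.C c * N ^ (d + 1)
  refine ⟨⟨⟨tm, Equiv.refl _, Equiv.refl _⟩,
    (Polynomial.C (d + 1) * (P * (3 * N + 3) + 2) + 3 * N + 3 * P + 4), fun w => ?_⟩⟩
  have h := runs_program (d := d) W₀ Wb Wp Wr g c (m := m) hg (by simp only [m]; omega)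
    (by simp only [m]; omega) (by simp only [m]; omega) (by simp only [m]; omega) w _ _ rfl rfl
  have hi : ∀ l : List A, Turing.initList tm l = ⟨some .read, none, stk l [] [] 0 0 0 0⟩ :=
    fun l => by
      have : (Turing.initList tm l).stk = stk l [] [] 0 0 0 0 := by funext k; cases k <;> rfl
      rw [← this]; rfl
  have ho : ∀ l : List Letter, Turing.haltList tm l = ⟨none, none, stk [] [] l 0 0 0 0⟩ :=
    fun l => by
      have : (Turing.haltList tm l).stk = stk [] [] l 0 0 0 0 := by funext k; cases k <;> rfl
      rw [← this]; rfl
  -- The goal is data including a number of steps, whereas the run is only known to exist.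
  refine Classical.choice ?_
  obtain ⟨s, hs, h⟩ := h
  refine ⟨⟨⟨s, ?_⟩, hs.trans (le_of_eq (by simp [N, P]))⟩⟩
  have hw : w.map (Equiv.refl A).invFun = w := List.map_id w
  have hfw : (enc (f w)).map (Equiv.refl Letter).invFun = enc (f w) := List.map_id _
  refine Eq.trans ?_ (h.trans ?_)
  · exact congrArg (fun x => (flip bind (Turing.TM2.step tm.m))^[s] (some x))
      ((congrArg (Turing.initList tm) hw).trans (hi w))
  · rw [← hf]
    exact congrArg some ((congrArg (Turing.haltList tm) hfw).trans (ho _)).symm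

/-! ### The reduction and the theorem. -/

/-- A polynomial is bounded by a multiple of a power of `n + 1`. -/
lemma Polynomial.exists_eval_le (p : Polynomial ℕ) :
    ∃ c d : ℕ, ∀ n, p.eval n ≤ c * (n + 1) ^ (d + 1) := by
  induction p using Polynomial.induction_on' with
  | add p q hp hq =>
    obtain ⟨c, d, hp⟩ := hp
    obtain ⟨c', d', hq⟩ := hq
    refine ⟨c + c', d + d', fun n => ?_⟩
    rw [Polynomial.eval_add, add_mul]
    exact add_le_add
      ((hp n).trans (Nat.mul_le_mul_left _ (Nat.pow_le_pow_right (by omega) (by omega))))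
      ((hq n).trans (Nat.mul_le_mul_left _ (Nat.pow_le_pow_right (by omega) (by omega))))
  | monomial k a =>
    refine ⟨a, k, fun n => ?_⟩
    rw [Polynomial.eval_monomial]
    exact Nat.mul_le_mul_left _ ((Nat.pow_le_pow_left (by omega) k).trans
      (Nat.pow_le_pow_right (by omega) (by omega)))

/-- Every language in NP over a finite alphabet reduces to the solvability of bounded tilings. -/
theorem InNP.exists_reduction {A : Type} [Finite A] {L : Language A} (hL : InNP L) :
    ∃ f : List A → BoundedTiling,
      Nonempty (Turing.TM2ComputableInPolyTime (id : List A → List A) BoundedTiling.encode f) ∧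
      ∀ w, (f w).Solvable ↔ w ∈ L := by
  obtain ⟨M, p, hM, hp⟩ := hL
  -- The summand `2` provides the first and the last row of the diagram; it also makes the number of
  -- rows positive.
  obtain ⟨c, d, hc⟩ := (p + 2).exists_eval_le
  obtain ⟨W₀, Wb, Wp, Wr, g, h⟩ := M.exists_boundedTiling
  have hk : ∀ w : List A, p.eval w.length + 2 ≤ c * (w.length + 1) ^ (d + 1) := fun w => by
    simpa using hc w.length
  choose f hf₁ hf₂ hf₃ using fun w : List A =>
    h w (c * (w.length + 1) ^ (d + 1)) (by have := hk w; omega)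
  refine ⟨f, nonempty_tm2ComputableInPolyTime W₀ Wb Wp Wr g c d hf₁, fun w =>
    ⟨fun hs => (hM w).2 (hf₂ w hs), fun hw => ?_⟩⟩
  obtain ⟨t, ht, hacc⟩ := hp w hw
  exact hf₃ w t hacc (by have := hk w; omega)

theorem theorem2 :
    -- the Hamiltonians of bounded tiling instances are instances of the 2-local commuting
    -- Hamiltonian problem; they are classical and translation invariant in the bulk,
    -- non-negative, and have ground state energy zero iff the instance is solvable
    (∀ I : BoundedTiling,
      I.hamiltonian.IsLocal 2 ∧
      I.hamiltonian.IsCommuting ∧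
      (∀ i, (I.hamiltonian.term i).IsDiag) ∧
      I.BulkTranslationInvariant ∧
      I.hamiltonian.total.PosSemidef ∧
      (I.hamiltonian.groundEnergy = 0 ↔ I.Solvable) ∧
      (I.hamiltonian.groundEnergy ≤ 1 / 3 ∨ 2 / 3 ≤ I.hamiltonian.groundEnergy)) ∧
    -- to decide whether the ground state energy is at most 1/3 or at least 2/3 is NP-complete
    IsNPComplete BoundedTiling.encode
      {I | I.hamiltonian.groundEnergy ≤ 1 / 3} {I | 2 / 3 ≤ I.hamiltonian.groundEnergy} := by
  refine ⟨fun I => ⟨I.hamiltonian_isLocal, I.hamiltonian_isCommuting, I.term_isDiag,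
    ⟨fun _ _ => rfl, fun _ _ => rfl⟩, I.total_posSemidef, I.groundEnergy_eq_zero_iff, ?_⟩, ?_, ?_⟩
  · rw [I.groundEnergy_le_iff, I.le_groundEnergy_iff]
    exact em _
  · simp only [BoundedTiling.groundEnergy_le_iff]
    exact BoundedTiling.inNP_solvable
  · intro A _ L hL
    obtain ⟨f, hf, h⟩ := hL.exists_reduction
    exact ⟨f, hf, fun w hw => (f w).groundEnergy_le_iff.2 ((h w).2 hw),
      fun w hw => (f w).le_groundEnergy_iff.2 (mt (h w).1 hw)⟩
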